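/- Fix $m\ge 0$ and write $\Lambda=(-\Delta)^{1/4}$ on $\mathbb R$, i.e. $\Lambda\varphi(x)=\int_{\mathbb R}\frac{\varphi(x)-\varphi(y)}{|x-y|^{3/2}}\,dy$ for $\varphi\in C_c^\infty(\mathbb R)$ (this is $(-\Delta)^{1/4}$ up to a positive multiplicative constant), extended to functions and distributions by duality. For $0<s<1$ let $$\|f\|_{\dot B^s_{r,q}}=\Big(\int_{\mathbb R}|h|^{-1-sq}\,\|f(\cdot+h)-f\|_{L^r(\mathbb R)}^q\,dh\Big)^{1/q},\qquad \dot H^{1/2}=\dot B^{1/2}_{2,2},$$ and for $-1<s<0$, $1<r,q<\infty$ let $\dot B^{s}_{r,q}$ be the dual space of $\dot B^{-s}_{r',q'}$ ($r',q'$ the conjugate exponents): it consists of the distributions $F$ with $\|F\|_{\dot B^{s}_{r,q}}=\sup_{0\ne\varphi\in C_c^\infty(\mathbb R,\mathbb R^m)}|F(\varphi)|/\|\varphi\|_{\dot B^{-s}_{r',q'}}<\infty$. Put $H^{-1/2}:=\dot B^{-1/2}_{2,2}=(\dot H^{1/2})'$. Let $\mathrm{Sym}_m$ be the space of real symmetric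 $m\times m$ matrices, $P\in L^\infty(\mathbb R,\mathrm{Sym}_m)$ and $Q\in\dot H^{1/2}(\mathbb R,\mathrm{Sym}_m)$ (that is, $Q\in L^1_{loc}$ and $\|Q\|_{\dot H^{1/2}}<\infty$), and let $$V_{P,Q}:=(PQ)\circ\Lambda-P\circ\Lambda\circ Q+Q\circ\Lambda\circ P-\Lambda\circ(QP)-(\Lambda Q)\,P-\Lambda(PQ)+(\Lambda P)\,Q ,$$ where in the first four terms $P,Q,PQ,QP$ act as multiplication operators and the last three terms are the operators of multiplication by the matrices $(\Lambda Q)P$, $\Lambda(PQ)$, $(\Lambda P)Q$. For $v\in C_c^\infty(\mathbb R,\mathbb R^m)$ each of the seven terms of $V_{P,Q}v$ is a well-defined distribution; products are read through the pairing with $\varphi\in C_c^\infty(\mathbb R,\mathbb R^m)$, e.g. $\langle Q\Lambda(Pv),\varphi\rangle=\int (Pv)\cdot\Lambda(Q\varphi)$, $\langle\Lambda(PQ)v,\varphi\rangle=\sum_{i,j}\int (PQ)_{ij}\,\Lambda(\varphi_i v_j)$ and $\langle(\Lambda P)Qv,\varphi\rangle=\sum_{i,k}\int P_{ik}\,\Lambda(\varphi_i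 (Qv)_k)$, all the integrals being absolutely convergent. Then $V_{P,Q}$ extends continuously from $C_c^\infty$ to $L^2$, and the extension maps $L^2(\mathbb R,\mathbb R^m)$ continuously into $\dot B^{-1/2+1/p}_{2p/(p+2),2}(\mathbb R,\mathbb R^m)$ for every $p>2$. More precisely, there are constants $C_p$ $(p>2)$ and $C_0$, independent of $P$, $Q$ and $v$, such that for all such $P,Q$ there is exactly one linear map $V_{P,Q}$ from $L^2(\mathbb R,\mathbb R^m)$ to distributions that is given by the formula above on $C_c^\infty(\mathbb R,\mathbb R^m)$ and satisfies, for all $v\in L^2(\mathbb R,\mathbb R^m)$ and $p>2$, $$\|V_{P,Q}v\|_{\dot B^{-1/2+1/p}_{2p/(p+2),2}}\le C_p\,\|P\|_{L^\infty}\|Q\|_{\dot H^{1/2}}\|v\|_{L^2},\qquad \|V_{P,Q}v\|_{H^{-1/2}}\le C_0\,\|P\|_{L^\infty}\|Q\|_{\dot H^{1/2}}\|v\|_{L^2}.$$ Moreover $\dot B^{-1/2+1/p}_{2p/(p+2),2}\hookrightarrow H^{-1/2}$ continuously for every $p>2$. -/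

import Mathlib

open MeasureTheory Matrix
open scoped ENNReal NNReal Distributions

attribute [local instance] Matrix.frobeniusNormedAddCommGroup

noncomputable section

/-! ### Besov spaces -/

/-- The homogeneous Besov (semi)norm
`(∫ |h|^(-1 - s q) ‖f(· + h) - f‖_{L^r}^q dh)^(1/q)` of a function on `ℝ`, for `0 < s < 1`. -/
def besovNorm {E : Type*} [NormedAddCommGroup E] (s r q : ℝ) (f : ℝ → E) : ℝ≥0∞ :=
  (∫⁻ h : ℝ, ENNReal.ofReal (|h| ^ (-1 - s * q)) *
    eLpNorm (fun x => f (x + h) - f x) (ENNReal.ofReal r) volume ^ q) ^ (1 / q)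

/-- The norm of `Ḣ^{1/2}(ℝ) = Ḃ^{1/2}_{2,2}(ℝ)`. -/
def hHalfNorm {E : Type*} [NormedAddCommGroup E] (f : ℝ → E) : ℝ≥0∞ :=
  besovNorm (1 / 2) 2 2 f

/-- Membership in `Ḣ^{1/2}(ℝ)`. -/
def MemHHalf {E : Type*} [NormedAddCommGroup E] (f : ℝ → E) : Prop :=
  LocallyIntegrable f volume ∧ hHalfNorm f < ∞

/-- Smooth compactly supported maps `ℝ → ℝ^m`. -/
abbrev VTest (m : ℕ) : Type := 𝓓((⊤ : TopologicalSpace.Opens ℝ), EuclideanSpace ℝ (Fin m))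

/-- `ℝ^m`-valued distributions on `ℝ`. -/
abbrev VDist (m : ℕ) : Type := VTest m →L[ℝ] ℝ

/-- The norm of the homogeneous Besov space `Ḃ^s_{r,q}(ℝ, ℝ^m)` of negative order `-1 < s < 0`,
with `1 < r, q < ∞`: this space is the dual of `Ḃ^{-s}_{r',q'}`, where `r'`, `q'` are the conjugate
exponents, and its norm is the dual norm (test functions are dense in `Ḃ^{-s}_{r',q'}`). A
distribution belongs to the space if and only if this norm is finite. -/
def negBesovNorm {m : ℕ} (s r q : ℝ) (F : VDist m) : ℝ≥0∞ :=
  ⨆ φ : VTest m, ‖F φ‖ₑ / besovNorm (-s) (Real.conjExponent r) (Real.conjExponent q) φ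

/-- The norm of `H^{-1/2}(ℝ, ℝ^m) = Ḃ^{-1/2}_{2,2}(ℝ, ℝ^m)`, the dual of `Ḣ^{1/2}`. -/
def hNegHalfNorm {m : ℕ} (F : VDist m) : ℝ≥0∞ :=
  negBesovNorm (-1 / 2) 2 2 F

/-- A test function as an element of `L²`. -/
def testToL2 {m : ℕ} (v : VTest m) : Lp (EuclideanSpace ℝ (Fin m)) 2 (volume : Measure ℝ) :=
  (v.continuous.memLp_of_hasCompactSupport v.hasCompactSupport :
    MemLp v 2 (volume : Measure ℝ)).toLp v

/-! ### The operator `(-Δ)^{1/4}` -/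

/-- `(-Δ)^{1/4} φ (x) = ∫ (φ(x) - φ(y)) / |x - y|^{3/2} dy` for a smooth compactly supported `φ`;
the integral converges absolutely. -/
def quarterLapTest (φ : ℝ → ℝ) (x : ℝ) : ℝ :=
  ∫ y : ℝ, (φ x - φ y) / |x - y| ^ (3 / 2 : ℝ)

open scoped ContDiff in
/-- `(-Δ)^{1/4} u = g` in the sense of distributions, for functions `u` and `g`. For a smooth
compactly supported `φ` one has `(-Δ)^{1/4} φ (x) = O((1 + |x|)^(-3/2))`, so that the first
condition makes `∫ u (-Δ)^{1/4} φ` converge. -/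
def HasQuarterLap (u g : ℝ → ℝ) : Prop :=
  Integrable (fun x => u x * (1 + |x|) ^ (-(3 / 2) : ℝ)) volume ∧
  LocallyIntegrable g volume ∧
  ∀ φ : ℝ → ℝ, ContDiff ℝ ∞ φ → HasCompactSupport φ →
    ∫ x, u x * quarterLapTest φ x = ∫ x, φ x * g x

/-- The distributional `(-Δ)^{1/4} u` determines its representing function almost everywhere. -/
theorem HasQuarterLap.unique {u g g' : ℝ → ℝ} (h : HasQuarterLap u g) (h' : HasQuarterLap u g') :
    ∀ᵐ x, g x = g' x := by
  refine ae_eq_of_integral_contDiff_smul_eq h.2.1 h'.2.1 fun φ hφ hc => ?_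
  simp only [smul_eq_mul]
  rw [← h.2.2 φ hφ hc, ← h'.2.2 φ hφ hc]

open Classical in
/-- The function representing the distribution `(-Δ)^{1/4} u` (and `0` if it is not a function). -/
def quarterLap (u : ℝ → ℝ) : ℝ → ℝ :=
  if h : ∃ g, HasQuarterLap u g then h.choose else 0

/-! ### The multi-commutator

In what follows `Λ = (-Δ)^{1/4}`, and
`V_{P,Q} = (PQ) ∘ Λ - P ∘ Λ ∘ Q + Q ∘ Λ ∘ P - Λ ∘ (QP) - (ΛQ) P - Λ(PQ) + (ΛP) Q`,
the last three terms being multiplication operators. On smooth compactly supported `v` each of the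
seven terms is a distribution, whose value on a smooth compactly supported `φ` is the integral of
one of the seven functions below. Where `Λ` acts on an object which is only a distribution
(`Λ(Pv)`, `Λ(QPv)`, `Λ(PQ)` and `ΛP`), it is transposed onto the remaining factors. -/

section MultiCommutator

variable {m : ℕ}

/-- `φ · (P Q) (Λ v)`. -/
def mcTerm1 (P Q : ℝ → Matrix (Fin m) (Fin m) ℝ) (v φ : VTest m) (x : ℝ) : ℝ :=
  (φ x).ofLp ⬝ᵥ ((P x * Q x) *ᵥ fun j => quarterLapTest (fun y => v y j) x)

/-- `φ · P (Λ (Q v))`. -/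
def mcTerm2 (P Q : ℝ → Matrix (Fin m) (Fin m) ℝ) (v φ : VTest m) (x : ℝ) : ℝ :=
  (φ x).ofLp ⬝ᵥ (P x *ᵥ fun j => quarterLap (fun y => (Q y *ᵥ (v y).ofLp) j) x)

/-- `φ · Q (Λ (P v))`, in the transposed form `Λ (Qᵗ φ) · P v`. -/
def mcTerm3 (P Q : ℝ → Matrix (Fin m) (Fin m) ℝ) (v φ : VTest m) (x : ℝ) : ℝ :=
  (fun j => quarterLap (fun y => ((Q y)ᵀ *ᵥ (φ y).ofLp) j) x) ⬝ᵥ (P x *ᵥ (v x).ofLp)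

/-- `φ · Λ (Q P v)`, in the transposed form `Λ φ · Q P v`. -/
def mcTerm4 (P Q : ℝ → Matrix (Fin m) (Fin m) ℝ) (v φ : VTest m) (x : ℝ) : ℝ :=
  (fun i => quarterLapTest (fun y => φ y i) x) ⬝ᵥ ((Q x * P x) *ᵥ (v x).ofLp)

/-- `φ · (Λ Q) P v`. -/
def mcTerm5 (P Q : ℝ → Matrix (Fin m) (Fin m) ℝ) (v φ : VTest m) (x : ℝ) : ℝ :=
  (φ x).ofLp ⬝ᵥ
    ((Matrix.of (fun i j => quarterLap (fun y => Q y i j) x) * P x) *ᵥ (v x).ofLp)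

/-- `φ · (Λ (P Q)) v`, in the transposed form `∑ i j, (P Q)_{ij} Λ (φ_i v_j)`. -/
def mcTerm6 (P Q : ℝ → Matrix (Fin m) (Fin m) ℝ) (v φ : VTest m) (x : ℝ) : ℝ :=
  ∑ i, ∑ j, (P x * Q x) i j * quarterLapTest (fun y => φ y i * v y j) x

/-- `φ · (Λ P) Q v`, in the transposed form `∑ i k, P_{ik} Λ (φ_i (Q v)_k)`. -/
def mcTerm7 (P Q : ℝ → Matrix (Fin m) (Fin m) ℝ) (v φ : VTest m) (x : ℝ) : ℝ :=
  ∑ i, ∑ k, P x i k * quarterLap (fun y => φ y i * (Q y *ᵥ (v y).ofLp) k) x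

/-- The pairing `⟨V_{P,Q} v, φ⟩` of the distribution `V_{P,Q} v` with `φ`. -/
def multiComm (P Q : ℝ → Matrix (Fin m) (Fin m) ℝ) (v φ : VTest m) : ℝ :=
  (∫ x, mcTerm1 P Q v φ x) - (∫ x, mcTerm2 P Q v φ x) + (∫ x, mcTerm3 P Q v φ x)
    - (∫ x, mcTerm4 P Q v φ x) - (∫ x, mcTerm5 P Q v φ x) - (∫ x, mcTerm6 P Q v φ x)
    + (∫ x, mcTerm7 P Q v φ x)

/-- Everything that enters `⟨V_{P,Q} v, φ⟩` is meaningful: the distributions `ΛQ`, `Λ(Qv)`,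
`Λ(Qᵗφ)`, `Λ(φ_i (Qv)_k)` are functions, and the seven integrals converge absolutely. -/
def MultiCommWellDefined (P Q : ℝ → Matrix (Fin m) (Fin m) ℝ) (v φ : VTest m) : Prop :=
  (∀ i j, ∃ g, HasQuarterLap (fun y => Q y i j) g) ∧
  (∀ j, ∃ g, HasQuarterLap (fun y => (Q y *ᵥ (v y).ofLp) j) g) ∧
  (∀ j, ∃ g, HasQuarterLap (fun y => ((Q y)ᵀ *ᵥ (φ y).ofLp) j) g) ∧
  (∀ i k, ∃ g, HasQuarterLap (fun y => φ y i * (Q y *ᵥ (v y).ofLp) k) g) ∧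
  Integrable (mcTerm1 P Q v φ) volume ∧ Integrable (mcTerm2 P Q v φ) volume ∧
  Integrable (mcTerm3 P Q v φ) volume ∧ Integrable (mcTerm4 P Q v φ) volume ∧
  Integrable (mcTerm5 P Q v φ) volume ∧ Integrable (mcTerm6 P Q v φ) volume ∧
  Integrable (mcTerm7 P Q v φ) volume

end MultiCommutator

end

noncomputable section

/-! ### Minkowski's inequality for series and averages -/

/-! The seven terms are arranged so that, after symmetrisation, only products of increments survive.
Replace every `Λ u (x)` by `∫ (u x - u (x + h)) |h|^(-3/2) dh` and collect the integrands at a fixed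
pair `x`, `y = x + h`. Terms 1, 2, 6, 7 add up to `(φ x - φ y) · P x (Q y - Q x) v y`, and terms 3,
4, 5 to `(φ x - φ y) · (Q y - Q x) P x v x`. So `⟨V v, φ⟩` is the double integral `mcForm` of the
kernel `mcKer` against `|h|^(-3/2) dh dx` (`mcKer_eq_sum`, `multiComm_eq_mcForm`). Each summand
contains one increment of `φ` and one of `Q`, while `P` enters only through its values; no
smoothness of `P` is needed.

The estimate is then Hölder. With `1/p + 1/q = 1/2`, Hölder in `x` with exponents `q`, `p`, `2`
bounds the inner integral by the `L^q` increment of `φ`, the `L^p` increment of `Q` and the `L²`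
norm of `v`. Cauchy–Schwarz in `h`, splitting `|h|^(-3/2)` into `|h|^(-1/2-1/q) |h|^(-1/2-1/p)`,
produces the norms of `φ` in `Ḃ^{1/q}_{q,2}` and of `Q` in `Ḃ^{1/p}_{p,2}`
(`lintegral_le_of_increment_bound`). The embedding of `Ḣ^{1/2}` into `Ḃ^{1/p}_{p,2}`
(`besovNorm_le_hHalfNorm`) finishes the bound on `Q`. For `q = 2p/(p-2)` the norm of `φ` is the one
dual to `Ḃ^{-1/2+1/p}_{2p/(p+2),2}`, and the same embedding applied to `φ` gives both the `H^{-1/2}`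
bound and, by duality, the inclusion into `H^{-1/2}`. The embedding itself is proved in physical
space: an increment of `f` is a sum of averages of increments at dyadically smaller scales, and
averaging over length `s` maps `L²` to `L^p` with norm `s^(1/p-1/2)`.

What remains is to justify the rearrangement, since the seven terms are defined separately and by
duality. The kernel is truncated away from `0` and `∞`, where everything is elementary. For `u ∈
Ḣ^{1/2}` the truncations of `Λ u` are Cauchy in `L²` by an almost-orthogonality argument on second
differences (`IsTruncation.lintegral_incLap_sq_le`), and their limit represents the distribution `Λ
u`. Each of the seven truncated pairings converges to its term, the truncated sum is a truncated
integral of `mcKer`, and integrability of `mcKer` gives the limit. Uniqueness follows from density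
of test functions in `L²`. -/

theorem lintegral_Lp_sum_range_le {α : Type*} [MeasurableSpace α] {μ : Measure α} {p : ℝ}
    (hp : 1 ≤ p) {F : ℕ → α → ℝ≥0∞} (hF : ∀ k, AEMeasurable (F k) μ) (n : ℕ) :
    (∫⁻ a, (∑ k ∈ Finset.range n, F k a) ^ p ∂μ) ^ (1 / p) ≤
      ∑ k ∈ Finset.range n, (∫⁻ a, F k a ^ p ∂μ) ^ (1 / p) := by
  have hp0 : 0 < p := by linarith
  induction n with
  | zero => simp [hp0]
  | succ n ih =>
    simp only [Finset.sum_range_succ]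
    refine le_trans ?_ (add_le_add_left ih _)
    exact ENNReal.lintegral_Lp_add_le (Finset.aemeasurable_fun_sum _ fun k _ => hF k) (hF n) hp

/-- Minkowski's inequality for series of nonnegative functions. -/
theorem lintegral_Lp_tsum_le {α : Type*} [MeasurableSpace α] {μ : Measure α} {p : ℝ}
    (hp : 1 ≤ p) {F : ℕ → α → ℝ≥0∞} (hF : ∀ k, AEMeasurable (F k) μ) :
    (∫⁻ a, (∑' k, F k a) ^ p ∂μ) ^ (1 / p) ≤ ∑' k, (∫⁻ a, F k a ^ p ∂μ) ^ (1 / p) := by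
  have hp0 : 0 < p := by linarith
  have h1 : Filter.Tendsto (fun n => ∫⁻ a, (∑ k ∈ Finset.range n, F k a) ^ p ∂μ) Filter.atTop
      (nhds (∫⁻ a, (∑' k, F k a) ^ p ∂μ)) := by
    refine lintegral_tendsto_of_tendsto_of_monotone
      (fun n => (Finset.aemeasurable_fun_sum _ fun k _ => hF k).pow_const p) ?_ ?_
    · refine Filter.Eventually.of_forall fun a m n hmn => ?_
      exact ENNReal.rpow_le_rpow (Finset.sum_le_sum_of_subset (Finset.range_mono hmn)) hp0.le
    · refine Filter.Eventually.of_forall fun a => ?_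
      exact (ENNReal.continuous_rpow_const.tendsto _).comp ENNReal.summable.hasSum.tendsto_sum_nat
  refine le_of_tendsto ((ENNReal.continuous_rpow_const.tendsto _).comp h1)
    (Filter.Eventually.of_forall fun n => ?_)
  exact (lintegral_Lp_sum_range_le hp hF n).trans (ENNReal.sum_le_tsum _)

/-- The forward average of `F` over intervals of length `s`. -/
def fwdAvg (s : ℝ) (F : ℝ → ℝ≥0∞) (x : ℝ) : ℝ≥0∞ :=
  (ENNReal.ofReal s)⁻¹ * ∫⁻ u in Set.Ioc 0 s, F (x + u)

theorem measurable_fwdAvg {s : ℝ} {F : ℝ → ℝ≥0∞} (hF : Measurable F) :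
    Measurable (fwdAvg s F) := by
  refine Measurable.const_mul ?_ _
  exact Measurable.lintegral_prod_right' (f := fun q : ℝ × ℝ => F (q.1 + q.2))
    (hF.comp (measurable_fst.add measurable_snd))

/-- Cauchy–Schwarz against the constant `1` on an interval of length `s`. -/
theorem fwdAvg_sq_le {s : ℝ} (hs : 0 < s) {F : ℝ → ℝ≥0∞} (hF : Measurable F) (x : ℝ) :
    fwdAvg s F x ^ (2 : ℝ) ≤ fwdAvg s (fun y => F y ^ (2 : ℝ)) x := by
  have hs0 : ENNReal.ofReal s ≠ 0 := by simpa using hs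
  have h := ENNReal.lintegral_mul_le_Lp_mul_Lq (volume.restrict (Set.Ioc 0 s))
    (Real.HolderConjugate.two_two) (f := fun u => F (x + u)) (g := fun _ => 1)
    (hF.comp (measurable_const_add x)).aemeasurable aemeasurable_const
  simp only [Pi.mul_apply, mul_one, ENNReal.one_rpow, lintegral_const, MeasurableSet.univ,
    Measure.restrict_apply, Set.univ_inter, Real.volume_Ioc, sub_zero, one_mul] at h
  have h2 := ENNReal.rpow_le_rpow h (zero_le_two)
  rw [ENNReal.mul_rpow_of_nonneg _ _ zero_le_two, ← ENNReal.rpow_mul, ← ENNReal.rpow_mul] at h2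
  norm_num at h2
  unfold fwdAvg
  rw [ENNReal.mul_rpow_of_nonneg _ _ zero_le_two]
  have h2' : (∫⁻ u in Set.Ioc 0 s, F (x + u)) ^ (2 : ℝ) ≤
      (∫⁻ u in Set.Ioc 0 s, F (x + u) ^ (2 : ℝ)) * ENNReal.ofReal s := by
    simpa using h2
  calc _ ≤ (ENNReal.ofReal s)⁻¹ ^ (2 : ℝ) *
        ((∫⁻ u in Set.Ioc 0 s, F (x + u) ^ (2 : ℝ)) * ENNReal.ofReal s) := by gcongr
    _ = (ENNReal.ofReal s)⁻¹ * ((ENNReal.ofReal s)⁻¹ * ENNReal.ofReal s) *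
        ∫⁻ u in Set.Ioc 0 s, F (x + u) ^ (2 : ℝ) := by
        rw [show (2 : ℝ) = ((2 : ℕ) : ℝ) by norm_num, ENNReal.rpow_natCast]; ring
    _ = _ := by rw [ENNReal.inv_mul_cancel hs0 ENNReal.ofReal_ne_top, mul_one]

theorem lintegral_fwdAvg {s : ℝ} (hs : 0 < s) {F : ℝ → ℝ≥0∞} (hF : Measurable F) :
    ∫⁻ x, fwdAvg s F x = ∫⁻ x, F x := by
  have hs0 : ENNReal.ofReal s ≠ 0 := by simpa using hs
  have hm : Measurable (fun q : ℝ × ℝ => F (q.1 + q.2)) :=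
    hF.comp (measurable_fst.add measurable_snd)
  unfold fwdAvg
  rw [lintegral_const_mul _ hm.lintegral_prod_right', lintegral_lintegral_swap hm.aemeasurable]
  simp only [lintegral_add_right_eq_self F, lintegral_const, MeasurableSet.univ,
    Measure.restrict_apply, Set.univ_inter, Real.volume_Ioc, sub_zero]
  rw [mul_comm (∫⁻ x, F x), ← mul_assoc, ENNReal.inv_mul_cancel hs0 ENNReal.ofReal_ne_top, one_mul]

/-- Averaging over intervals of length `s` maps `L²` into `Lᵖ`, with norm `s^(1/p - 1/2)`. -/
theorem fwdAvg_Lp_le {s p : ℝ} (hs : 0 < s) (hp : 2 < p) {F : ℝ → ℝ≥0∞} (hF : Measurable F) :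
    (∫⁻ x, fwdAvg s F x ^ p) ^ (1 / p) ≤
      ENNReal.ofReal (s ^ (1 / p - 1 / 2)) * (∫⁻ x, F x ^ (2 : ℝ)) ^ (1 / 2 : ℝ) := by
  set A := ∫⁻ x, F x ^ (2 : ℝ) with hA
  have hp0 : 0 < p := by linarith
  have hs0 : ENNReal.ofReal s ≠ 0 := by simpa using hs
  -- Interpolation between the uniform bound `h1` and the `L²` bound `h2`: the power `p` of the
  -- average is split as `p - 2` and `2`.
  have h1 : ∀ x, fwdAvg s F x ^ (2 : ℝ) ≤ (ENNReal.ofReal s)⁻¹ * A := fun x => by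
    refine (fwdAvg_sq_le hs hF x).trans ?_
    unfold fwdAvg
    gcongr
    refine (setLIntegral_le_lintegral _ _).trans ?_
    rw [lintegral_add_left_eq_self (fun y => F y ^ (2 : ℝ)) x]
  have h2 : ∫⁻ x, fwdAvg s F x ^ (2 : ℝ) ≤ A := by
    refine (lintegral_mono (fwdAvg_sq_le hs hF)).trans ?_
    rw [lintegral_fwdAvg hs (hF.pow_const _)]
  have h3 : ∫⁻ x, fwdAvg s F x ^ p ≤ ((ENNReal.ofReal s)⁻¹ * A) ^ ((p - 2) / 2) * A := by
    calc ∫⁻ x, fwdAvg s F x ^ p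
        ≤ ∫⁻ x, ((ENNReal.ofReal s)⁻¹ * A) ^ ((p - 2) / 2) * fwdAvg s F x ^ (2 : ℝ) := by
          refine lintegral_mono fun x => ?_
          have : fwdAvg s F x ^ p = (fwdAvg s F x ^ (2 : ℝ)) ^ ((p - 2) / 2) *
              fwdAvg s F x ^ (2 : ℝ) := by
            rw [← ENNReal.rpow_mul, ← ENNReal.rpow_add_of_nonneg _ _ (by linarith) (by norm_num)]
            congr 1; ring
          rw [this]
          gcongr
          exact h1 x
      _ = ((ENNReal.ofReal s)⁻¹ * A) ^ ((p - 2) / 2) * ∫⁻ x, fwdAvg s F x ^ (2 : ℝ) :=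
          lintegral_const_mul _ ((measurable_fwdAvg hF).pow_const _)
      _ ≤ _ := by gcongr
  refine (ENNReal.rpow_le_rpow h3 (by positivity)).trans (le_of_eq ?_)
  have h4 : ((ENNReal.ofReal s)⁻¹ * A) ^ ((p - 2) / 2) * A =
      (ENNReal.ofReal s)⁻¹ ^ ((p - 2) / 2) * A ^ (p / 2) := by
    rw [ENNReal.mul_rpow_of_nonneg _ _ (by linarith), mul_assoc]
    congr 1
    nth_rewrite 2 [← ENNReal.rpow_one A]
    rw [← ENNReal.rpow_add_of_nonneg _ _ (by linarith) zero_le_one]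
    congr 1; ring
  rw [h4, ENNReal.mul_rpow_of_nonneg _ _ (by positivity), ← ENNReal.rpow_mul, ← ENNReal.rpow_mul,
    ← ENNReal.ofReal_inv_of_pos hs, ENNReal.ofReal_rpow_of_pos (inv_pos.2 hs),
    Real.inv_rpow hs.le, ← Real.rpow_neg hs.le]
  rw [show -((p - 2) / 2 * (1 / p)) = 1 / p - 1 / 2 by field_simp; ring,
    show p / 2 * (1 / p) = 1 / 2 by field_simp]

/-! ### Increments in `Lʳ` -/

/-- The `Lʳ` norm of the increment `f (· + h) - f`. -/
def incr {E : Type*} [NormedAddCommGroup E] (r : ℝ) (f : ℝ → E) (h : ℝ) : ℝ≥0∞ :=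
  (∫⁻ x, ‖f (x + h) - f x‖ₑ ^ r) ^ (1 / r)

theorem eLpNorm_increment {E : Type*} [NormedAddCommGroup E] {r : ℝ} (hr : 0 < r) (f : ℝ → E)
    (h : ℝ) : eLpNorm (fun x => f (x + h) - f x) (ENNReal.ofReal r) volume = incr r f h := by
  rw [eLpNorm_eq_lintegral_rpow_enorm_toReal (by simpa using hr) ENNReal.ofReal_ne_top,
    ENNReal.toReal_ofReal hr.le]
  rfl

theorem besovNorm_eq_incr {E : Type*} [NormedAddCommGroup E] {s r q : ℝ} (hr : 0 < r)
    (f : ℝ → E) : besovNorm s r q f =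
      (∫⁻ h : ℝ, ENNReal.ofReal (|h| ^ (-1 - s * q)) * incr r f h ^ q) ^ (1 / q) := by
  simp only [besovNorm, eLpNorm_increment hr]

section Increment

variable {E : Type*} [NormedAddCommGroup E]

theorem incr_congr_ae {r : ℝ} {f g : ℝ → E} (hfg : f =ᵐ[volume] g) (h : ℝ) :
    incr r f h = incr r g h := by
  unfold incr
  congr 1
  refine lintegral_congr_ae ?_
  have h1 : ∀ᵐ x, f (x + h) = g (x + h) :=
    (measurePreserving_add_right volume h).quasiMeasurePreserving.ae hfg
  filter_upwards [hfg, h1] with x hx hx'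
  rw [hx, hx']

theorem incr_neg (r : ℝ) (f : ℝ → E) (h : ℝ) : incr r f (-h) = incr r f h := by
  unfold incr
  congr 1
  rw [← lintegral_add_right_eq_self _ h]
  simp only [add_neg_cancel_right]
  refine lintegral_congr fun x => ?_
  rw [← enorm_neg, neg_sub]

theorem incr_abs (r : ℝ) (f : ℝ → E) (h : ℝ) : incr r f |h| = incr r f h := by
  rcases abs_choice h with h' | h' <;> rw [h']
  exact incr_neg r f h

theorem stronglyMeasurable_increment {f : ℝ → E} (hf : StronglyMeasurable f) :
    StronglyMeasurable (fun q : ℝ × ℝ => f (q.2 + q.1) - f q.2) :=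
  (hf.comp_measurable (measurable_snd.add measurable_fst)).sub (hf.comp_measurable measurable_snd)

theorem measurable_incr {r : ℝ} {f : ℝ → E} (hf : StronglyMeasurable f) :
    Measurable (incr r f) := by
  unfold incr
  exact ((stronglyMeasurable_increment hf).enorm.pow_const r).lintegral_prod_right'.pow_const _

/-- Changing `f` on a null set changes `incr r f h` for no `h`, so a strongly measurable
representative gives genuine measurability in `h`. -/
theorem measurable_incr_of_ae {r : ℝ} {f : ℝ → E} (hf : AEStronglyMeasurable f volume) :
    Measurable (incr r f) := by
  have : incr r f = incr r (hf.mk f) := funext fun h => incr_congr_ae hf.ae_eq_mk h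
  rw [this]
  exact measurable_incr hf.stronglyMeasurable_mk

theorem intervalIntegrable_comp_add {f : ℝ → E} (hf : LocallyIntegrable f volume) (x a b : ℝ) :
    IntervalIntegrable (fun u => f (x + u)) volume a b := by
  have h : IntervalIntegrable f volume (x + a) (x + b) :=
    intervalIntegrable_iff.mpr
      ((hf.integrableOn_isCompact isCompact_uIcc).mono_set Set.uIoc_subset_uIcc)
  simpa using h.comp_add_left x

variable [NormedSpace ℝ E]

/-- The forward mean of `f` over `(x, x + t)`. -/
def fwdMean (f : ℝ → E) (t x : ℝ) : E := t⁻¹ • ∫ u in (0 : ℝ)..t, f (x + u)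

theorem enorm_fwdMean_le {f : ℝ → E} {t : ℝ} (ht : 0 < t) (x : ℝ) :
    ‖fwdMean f t x‖ₑ ≤ fwdAvg t (fun y => ‖f y‖ₑ) x := by
  unfold fwdMean fwdAvg
  rw [enorm_smul, intervalIntegral.integral_of_le ht.le, Real.enorm_eq_ofReal (by positivity),
    ENNReal.ofReal_inv_of_pos ht]
  gcongr
  exact enorm_integral_le_lintegral_enorm _

theorem fwdMean_add_sub {f : ℝ → E} (hf : LocallyIntegrable f volume) (t h x : ℝ) :
    fwdMean f t (x + h) - fwdMean f t x = fwdMean (fun y => f (y + h) - f y) t x := by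
  unfold fwdMean
  rw [← smul_sub, ← intervalIntegral.integral_sub (intervalIntegrable_comp_add hf _ _ _)
    (intervalIntegrable_comp_add hf _ _ _)]
  simp only [add_right_comm x h]

/-- The mean over `(x, x + 2s)` is the midpoint of the means over `(x, x + s)` and `(x + s, x +
2s)`. Halving the interval thus costs half an averaged increment of step `s`. -/
theorem fwdMean_two_mul {f : ℝ → E} (hf : LocallyIntegrable f volume) (s : ℝ)
    (x : ℝ) : fwdMean f (2 * s) x - fwdMean f s x =
      (2⁻¹ : ℝ) • fwdMean (fun y => f (y + s) - f y) s x := by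
  rw [← fwdMean_add_sub hf]
  unfold fwdMean
  have h1 : ∫ u in (0 : ℝ)..s, f (x + s + u) = ∫ u in s..2 * s, f (x + u) := by
    have := intervalIntegral.integral_comp_add_left (a := 0) (b := s) (fun u => f (x + u)) s
    simp only [add_zero, ← add_assoc] at this
    rw [this, two_mul]
  have h2 : ∫ u in (0 : ℝ)..2 * s, f (x + u) =
      (∫ u in (0 : ℝ)..s, f (x + u)) + ∫ u in s..2 * s, f (x + u) :=
    (intervalIntegral.integral_add_adjacent_intervals (intervalIntegrable_comp_add hf _ _ _)
      (intervalIntegrable_comp_add hf _ _ _)).symm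
  rw [h1, h2, mul_inv]
  module

variable [CompleteSpace E]

/-- Lebesgue differentiation. -/
theorem ae_tendsto_fwdMean {f : ℝ → E} (hf : LocallyIntegrable f volume) :
    ∀ᵐ x, Filter.Tendsto (fun t => fwdMean f t x) (nhdsWithin 0 {0}ᶜ) (nhds (f x)) := by
  filter_upwards [_root_.LocallyIntegrable.ae_hasDerivAt_integral hf] with x hx
  have h := hasDerivAt_iff_tendsto_slope_zero.1 (hx x)
  refine h.congr fun t => ?_
  simp [fwdMean, intervalIntegral.integral_comp_add_left]

/-- Telescoping the means over dyadically shrinking intervals. -/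
theorem ae_enorm_fwdMean_sub_le {f : ℝ → E} (hf : LocallyIntegrable f volume) {h : ℝ}
    (hh : 0 < h) : ∀ᵐ x, ‖fwdMean f h x - f x‖ₑ ≤
      ∑' k : ℕ, 2⁻¹ * fwdAvg (h * 2⁻¹ ^ (k + 1))
        (fun y => ‖f (y + h * 2⁻¹ ^ (k + 1)) - f y‖ₑ) x := by
  filter_upwards [ae_tendsto_fwdMean hf] with x hx
  have hpos : ∀ k : ℕ, 0 < h * 2⁻¹ ^ k := fun k => by positivity
  have ht : Filter.Tendsto (fun k : ℕ => fwdMean f (h * 2⁻¹ ^ k) x) Filter.atTop (nhds (f x)) := by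
    refine hx.comp (tendsto_nhdsWithin_iff.2 ⟨?_,
      Filter.Eventually.of_forall fun k => (hpos k).ne'⟩)
    have := (tendsto_pow_atTop_nhds_zero_of_lt_one (r := (2⁻¹ : ℝ)) (by norm_num)
      (by norm_num)).const_mul h
    simpa using this
  have := edist_le_tsum_of_edist_le_of_tendsto₀ (f := fun k : ℕ => fwdMean f (h * 2⁻¹ ^ k) x)
    (fun k => 2⁻¹ * fwdAvg (h * 2⁻¹ ^ (k + 1))
        (fun y => ‖f (y + h * 2⁻¹ ^ (k + 1)) - f y‖ₑ) x) (fun k => ?_) ht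
  · simpa [edist_eq_enorm_sub] using this
  · rw [edist_eq_enorm_sub, show h * 2⁻¹ ^ k = 2 * (h * 2⁻¹ ^ (k + 1)) by rw [pow_succ]; ring,
      fwdMean_two_mul hf, enorm_smul]
    gcongr
    · rw [Real.enorm_eq_ofReal (by norm_num), ENNReal.ofReal_inv_of_pos (by norm_num)]
      simp
    · exact enorm_fwdMean_le (hpos _) x

end Increment

/-! ### The Sobolev-type embedding of `Ḣ^{1/2}` into `Ḃ^{1/p}_{p,2}` -/

theorem lintegral_comp_mul_right_pos {c : ℝ} (hc : 0 < c) {G : ℝ → ℝ≥0∞} (hG : Measurable G) :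
    ∫⁻ h, G (h * c) = ENNReal.ofReal c⁻¹ * ∫⁻ h, G h := by
  rw [← lintegral_map hG (measurable_mul_const c), Real.map_volume_mul_right hc.ne',
    lintegral_smul_measure, abs_of_pos (inv_pos.2 hc), smul_eq_mul]

theorem besovNorm_congr_ae {E : Type*} [NormedAddCommGroup E] {s r q : ℝ} (hr : 0 < r)
    {f g : ℝ → E} (hfg : f =ᵐ[volume] g) :
    besovNorm s r q f = besovNorm s r q g := by
  simp only [besovNorm_eq_incr hr, incr_congr_ae hfg]

section Embedding

variable {E : Type*} [NormedAddCommGroup E] [NormedSpace ℝ E] [CompleteSpace E]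

/-- With `M` the mean over length `h`, the increment of `f` is the increment of `M f`, plus `M f -
f` at `x`, minus `M f - f` at `x + h`. The first is an average of increments of step `h`; the other
two telescope into averages of increments of step `h 2^(-k)`, `k ≥ 1`. `fwdAvg_Lp_le` converts each
average from `L²` to `L^p`. -/
theorem incr_le_tsum {p : ℝ} (hp : 2 < p) {f : ℝ → E} (hf : LocallyIntegrable f volume)
    (hfm : StronglyMeasurable f) {h : ℝ} (hh : 0 < h) :
    incr p f h ≤ ∑' k : ℕ, ENNReal.ofReal ((h * 2⁻¹ ^ k) ^ (1 / p - 1 / 2)) *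
      incr 2 f (h * 2⁻¹ ^ k) := by
  have hp1 : 1 ≤ p := by linarith
  have hp0 : 0 < p := by linarith
  set N : ℕ → ℝ → ℝ≥0∞ := fun k => fwdAvg (h * 2⁻¹ ^ k) (fun y => ‖f (y + h * 2⁻¹ ^ k) - f y‖ₑ)
    with hN
  have hpos : ∀ k : ℕ, 0 < h * 2⁻¹ ^ k := fun k => by positivity
  have hincm : ∀ t, Measurable fun y => ‖f (y + t) - f y‖ₑ := fun t =>
    ((hfm.comp_measurable (measurable_add_const t)).sub hfm).enorm
  have hNm : ∀ k, Measurable (N k) := fun k => measurable_fwdAvg (hincm _)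
  have hNp : ∀ k, (∫⁻ x, N k x ^ p) ^ (1 / p) ≤
      ENNReal.ofReal ((h * 2⁻¹ ^ k) ^ (1 / p - 1 / 2)) * incr 2 f (h * 2⁻¹ ^ k) :=
    fun k => fwdAvg_Lp_le (hpos k) hp (hincm _)
  set T : ℝ → ℝ≥0∞ := fun x => ∑' k : ℕ, 2⁻¹ * N (k + 1) x with hT
  have hTm : Measurable T := Measurable.tsum fun k => (hNm _).const_mul _
  have hTp : (∫⁻ x, T x ^ p) ^ (1 / p) ≤ 2⁻¹ * ∑' k : ℕ,
      ENNReal.ofReal ((h * 2⁻¹ ^ (k + 1)) ^ (1 / p - 1 / 2)) * incr 2 f (h * 2⁻¹ ^ (k + 1)) := by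
    refine (lintegral_Lp_tsum_le hp1 fun k => ((hNm _).const_mul _).aemeasurable).trans ?_
    rw [← ENNReal.tsum_mul_left]
    refine ENNReal.tsum_le_tsum fun k => ?_
    simp only [ENNReal.mul_rpow_of_nonneg _ _ hp0.le]
    rw [lintegral_const_mul _ ((hNm _).pow_const _),
      ENNReal.mul_rpow_of_nonneg _ _ (by positivity), ← ENNReal.rpow_mul,
      mul_one_div_cancel hp0.ne', ENNReal.rpow_one]
    gcongr
    exact hNp _
  have hmean := ae_enorm_fwdMean_sub_le hf hh
  have hmean' : ∀ᵐ x, ‖fwdMean f h (x + h) - f (x + h)‖ₑ ≤ T (x + h) :=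
    (measurePreserving_add_right volume h).quasiMeasurePreserving.ae hmean
  have hpt : ∀ᵐ x, ‖f (x + h) - f x‖ₑ ≤ ((N 0 + T) + fun x => T (x + h)) x := by
    filter_upwards [hmean, hmean'] with x hx hx'
    have h0 : ‖fwdMean f h (x + h) - fwdMean f h x‖ₑ ≤ N 0 x := by
      rw [fwdMean_add_sub hf]
      simpa [hN] using enorm_fwdMean_le hh x
    have e : f (x + h) - f x = (fwdMean f h (x + h) - fwdMean f h x) +
        (fwdMean f h x - f x) + (-(fwdMean f h (x + h) - f (x + h))) := by abel
    rw [e]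
    refine (enorm_add_le _ _).trans (add_le_add ((enorm_add_le _ _).trans (add_le_add h0 hx)) ?_)
    rwa [enorm_neg]
  have hTs : ∫⁻ x, T (x + h) ^ p = ∫⁻ x, T x ^ p :=
    lintegral_add_right_eq_self (fun x => T x ^ p) h
  calc incr p f h ≤ (∫⁻ x, (((N 0 + T) + fun x => T (x + h)) x) ^ p) ^ (1 / p) := by
        unfold incr
        gcongr ?_ ^ (1 / p)
        refine lintegral_mono_ae ?_
        filter_upwards [hpt] with x hx
        gcongr
    _ ≤ ((∫⁻ x, N 0 x ^ p) ^ (1 / p) + (∫⁻ x, T x ^ p) ^ (1 / p)) +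
        (∫⁻ x, T x ^ p) ^ (1 / p) := by
        refine (ENNReal.lintegral_Lp_add_le ((hNm 0).add hTm).aemeasurable
          (hTm.comp (measurable_add_const h)).aemeasurable hp1).trans ?_
        refine add_le_add ?_ (le_of_eq (congrArg (· ^ (1 / p)) hTs))
        exact ENNReal.lintegral_Lp_add_le (hNm 0).aemeasurable hTm.aemeasurable hp1
    _ ≤ _ := by
        -- The two telescoped tails carry the coefficient `1/2` each and together make up the terms
        -- `k ≥ 1`.
        rw [tsum_eq_zero_add' ENNReal.summable, add_assoc]
        refine add_le_add (hNp 0) ((add_le_add hTp hTp).trans (le_of_eq ?_))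
        rw [← add_mul, ENNReal.inv_two_add_inv_two, one_mul]

/-- The constant of the embedding of `Ḣ^{1/2}` into `Ḃ^{1/p}_{p,2}`. -/
def embConst (p : ℝ) : ℝ≥0 := (∑' k : ℕ, ((2⁻¹ : ℝ≥0) ^ (1 / p)) ^ k)

theorem coe_embConst {p : ℝ} (hp : 0 < p) :
    (embConst p : ℝ≥0∞) = ∑' k : ℕ, ENNReal.ofReal (((2⁻¹ : ℝ) ^ k) ^ (1 / p)) := by
  have h1 : (2⁻¹ : ℝ≥0) ^ (1 / p) < 1 :=
    NNReal.rpow_lt_one (by rw [← NNReal.coe_lt_coe]; norm_num) (by positivity)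
  rw [embConst, ENNReal.coe_tsum (NNReal.summable_geometric h1)]
  refine tsum_congr fun k => ?_
  rw [ENNReal.ofReal, ENNReal.coe_inj]
  apply NNReal.eq
  rw [Real.coe_toNNReal _ (by positivity)]
  push_cast
  rw [← Real.rpow_natCast, ← Real.rpow_natCast, ← Real.rpow_mul (by norm_num),
    ← Real.rpow_mul (by norm_num), mul_comm]

theorem one_le_embConst {p : ℝ} (hp : 0 < p) : (1 : ℝ≥0∞) ≤ embConst p := by
  rw [coe_embConst hp]
  refine le_trans (le_of_eq ?_) (ENNReal.le_tsum 0)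
  simp

/-- Take the weighted `L²` norm in `h` of `incr_le_tsum` and use Minkowski. The weight
`|h|^(-1-2/p)` times the square of `|h|^(1/p-1/2)` is `|h|^(-2)`, so after the substitution `h ↦ h
2^(-k)` every term is a multiple of the `Ḣ^{1/2}` norm. The Jacobian and the rescaled weight leave
the factor `2^(-k/p)`, which is summable. -/
theorem besovNorm_le_hHalfNorm {p : ℝ} (hp : 2 < p) {f : ℝ → E}
    (hf : LocallyIntegrable f volume) :
    besovNorm (1 / p) p 2 f ≤ embConst p * hHalfNorm f := by
  have hp0 : 0 < p := by linarith
  wlog hfm : StronglyMeasurable f generalizing f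
  · have hm := hf.aestronglyMeasurable
    have := this (hf.congr hm.ae_eq_mk) hm.stronglyMeasurable_mk
    rwa [← besovNorm_congr_ae hp0 hm.ae_eq_mk, hHalfNorm,
      ← besovNorm_congr_ae two_pos hm.ae_eq_mk] at this
  rw [hHalfNorm, besovNorm_eq_incr hp0, besovNorm_eq_incr two_pos, coe_embConst hp0]
  set a : ℝ := -1 - 1 / p * 2 with ha
  set W : ℝ → ℝ≥0∞ := fun t => ENNReal.ofReal (|t| ^ (1 / p - 1 / 2)) * incr 2 f t with hW
  have hWm : Measurable W := by
    have := measurable_incr (r := 2) hfm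
    fun_prop
  have h0 : ∀ h : ℝ, h ≠ 0 → incr p f h ≤ ∑' k : ℕ, W (h * 2⁻¹ ^ k) := fun h hh => by
    rw [← incr_abs]
    refine (incr_le_tsum hp hf hfm (abs_pos.2 hh)).trans (le_of_eq (tsum_congr fun k => ?_))
    have : |h| * 2⁻¹ ^ k = |h * 2⁻¹ ^ k| := by
      rw [abs_mul, abs_of_pos (a := (2⁻¹ : ℝ) ^ k) (by positivity)]
    rw [hW, this, incr_abs]
  have hsq : ∀ t : ℝ, ENNReal.ofReal (|t| ^ (a / 2)) ^ (2 : ℝ) = ENNReal.ofReal (|t| ^ a) := by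
    intro t
    rw [ENNReal.ofReal_rpow_of_nonneg (by positivity) zero_le_two, ← Real.rpow_mul (abs_nonneg t)]
    congr 2; ring
  have hm1 : ∀ k : ℕ, Measurable fun h : ℝ =>
      ENNReal.ofReal (|h| ^ (a / 2)) * W (h * 2⁻¹ ^ k) := fun k => by
    have := hWm.comp (measurable_mul_const ((2⁻¹ : ℝ) ^ k))
    have h2 : Measurable fun h : ℝ => ENNReal.ofReal (|h| ^ (a / 2)) := by fun_prop
    exact h2.mul this
  have hG : Measurable fun h : ℝ => ENNReal.ofReal (|h| ^ a) * W h ^ (2 : ℝ) := by fun_prop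
  have hk : ∀ k : ℕ, (∫⁻ h : ℝ, (ENNReal.ofReal (|h| ^ (a / 2)) * W (h * 2⁻¹ ^ k)) ^ (2 : ℝ)) ^
      (1 / 2 : ℝ) = ENNReal.ofReal (((2⁻¹ : ℝ) ^ k) ^ (1 / p)) *
        (∫⁻ h : ℝ, ENNReal.ofReal (|h| ^ (-1 - 1 / 2 * 2 : ℝ)) * incr 2 f h ^ (2 : ℝ)) ^
          (1 / 2 : ℝ) := by
    intro k
    set c : ℝ := 2⁻¹ ^ k with hc
    have hcpos : 0 < c := by positivity
    have e1 : ∀ h : ℝ, (ENNReal.ofReal (|h| ^ (a / 2)) * W (h * c)) ^ (2 : ℝ) =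
        ENNReal.ofReal (c ^ (-a)) * (ENNReal.ofReal (|h * c| ^ a) * W (h * c) ^ (2 : ℝ)) := by
      intro h
      rw [ENNReal.mul_rpow_of_nonneg _ _ zero_le_two, hsq, ← mul_assoc,
        ← ENNReal.ofReal_mul (by positivity), abs_mul, abs_of_pos hcpos,
        Real.mul_rpow (abs_nonneg h) hcpos.le, mul_left_comm, ← Real.rpow_add hcpos]
      simp
    have e2 : ∀ h : ℝ, h ≠ 0 → ENNReal.ofReal (|h| ^ a) * W h ^ (2 : ℝ) =
        ENNReal.ofReal (|h| ^ (-1 - 1 / 2 * 2 : ℝ)) * incr 2 f h ^ (2 : ℝ) := by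
      intro h hh
      rw [hW, ENNReal.mul_rpow_of_nonneg _ _ zero_le_two, ← mul_assoc,
        ENNReal.ofReal_rpow_of_nonneg (by positivity) zero_le_two, ← ENNReal.ofReal_mul
        (by positivity), ← Real.rpow_mul (abs_nonneg h), ← Real.rpow_add (abs_pos.2 hh)]
      congr 3
      rw [ha]; ring
    have hG' : Measurable fun h : ℝ => ENNReal.ofReal (|h * c| ^ a) * W (h * c) ^ (2 : ℝ) :=
      hG.comp (measurable_mul_const c)
    rw [lintegral_congr e1, lintegral_const_mul _ hG', lintegral_comp_mul_right_pos hcpos hG]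
    have e3 : ∫⁻ h : ℝ, ENNReal.ofReal (|h| ^ a) * W h ^ (2 : ℝ) =
        ∫⁻ h : ℝ, ENNReal.ofReal (|h| ^ (-1 - 1 / 2 * 2 : ℝ)) * incr 2 f h ^ (2 : ℝ) := by
      refine lintegral_congr_ae ?_
      filter_upwards [Measure.ae_ne volume (0 : ℝ)] with h hh using e2 h hh
    rw [e3, ← mul_assoc, ← ENNReal.ofReal_mul (by positivity),
      ENNReal.mul_rpow_of_nonneg _ _ (by positivity),
      ENNReal.ofReal_rpow_of_nonneg (by positivity) (by positivity)]
    congr 2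
    rw [← Real.rpow_neg_one c, ← Real.rpow_add hcpos, ← Real.rpow_mul hcpos.le]
    congr 1
    rw [ha]; ring
  calc (∫⁻ h : ℝ, ENNReal.ofReal (|h| ^ a) * incr p f h ^ (2 : ℝ)) ^ (1 / 2 : ℝ)
      ≤ (∫⁻ h : ℝ, (∑' k : ℕ, ENNReal.ofReal (|h| ^ (a / 2)) * W (h * 2⁻¹ ^ k)) ^ (2 : ℝ)) ^
          (1 / 2 : ℝ) := by
        gcongr ?_ ^ (1 / 2 : ℝ)
        refine lintegral_mono_ae ?_
        filter_upwards [Measure.ae_ne volume (0 : ℝ)] with h hh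
        rw [ENNReal.tsum_mul_left, ENNReal.mul_rpow_of_nonneg _ _ zero_le_two, hsq]
        gcongr
        exact h0 h hh
    _ ≤ ∑' k : ℕ, (∫⁻ h : ℝ, (ENNReal.ofReal (|h| ^ (a / 2)) * W (h * 2⁻¹ ^ k)) ^ (2 : ℝ)) ^
          (1 / 2 : ℝ) := lintegral_Lp_tsum_le one_le_two fun k => (hm1 k).aemeasurable
    _ = _ := by
        rw [tsum_congr hk, ENNReal.tsum_mul_right]

end Embedding

/-! ### The Gagliardo energy -/

/-- The square of the `Ḣ^{1/2}` norm. -/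
def energy {E : Type*} [NormedAddCommGroup E] (f : ℝ → E) : ℝ≥0∞ :=
  ∫⁻ h : ℝ, ENNReal.ofReal (|h| ^ (-2 : ℝ)) * ∫⁻ x, ‖f (x + h) - f x‖ₑ ^ (2 : ℝ)

/-- The integral of `(1 + |x|)^(-2)`. -/
def decayMass : ℝ≥0∞ := ∫⁻ x : ℝ, ENNReal.ofReal ((1 + |x|) ^ (-2 : ℝ))

theorem decayMass_lt_top : decayMass < ∞ := by
  have := finite_integral_one_add_norm (E := ℝ) (μ := volume) (r := 2) (by simp)
  simpa [decayMass] using this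

section Energy

variable {E : Type*} [NormedAddCommGroup E]

theorem incr_two_sq (f : ℝ → E) (h : ℝ) :
    incr 2 f h ^ (2 : ℝ) = ∫⁻ x, ‖f (x + h) - f x‖ₑ ^ (2 : ℝ) := by
  rw [incr, ← ENNReal.rpow_mul]; simp

theorem lintegral_incr_sq (f : ℝ → E) :
    ∫⁻ h : ℝ, ENNReal.ofReal (|h| ^ (-2 : ℝ)) * incr 2 f h ^ (2 : ℝ) = energy f := by
  simp only [incr_two_sq]
  rfl

theorem hHalfNorm_eq (f : ℝ → E) : hHalfNorm f = energy f ^ (1 / 2 : ℝ) := by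
  rw [hHalfNorm, besovNorm_eq_incr two_pos, energy]
  simp only [incr_two_sq]
  norm_num

theorem hHalfNorm_lt_top_iff (f : ℝ → E) : hHalfNorm f < ∞ ↔ energy f < ∞ := by
  rw [hHalfNorm_eq]
  exact ENNReal.rpow_lt_top_iff_of_pos (by norm_num)

theorem energy_mono {F : Type*} [NormedAddCommGroup F] {f : ℝ → E} {g : ℝ → F}
    (h : ∀ x y, ‖f x - f y‖ₑ ≤ ‖g x - g y‖ₑ) : energy f ≤ energy g := by
  unfold energy
  gcongr with t x
  exact h _ _

theorem energy_congr_ae {f g : ℝ → E} (h : f =ᵐ[volume] g) : energy f = energy g := by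
  simp only [energy, ← incr_two_sq, incr_congr_ae h]

theorem enorm_add_rpow_two_le (a b : E) :
    ‖a + b‖ₑ ^ (2 : ℝ) ≤ 2 * ‖a‖ₑ ^ (2 : ℝ) + 2 * ‖b‖ₑ ^ (2 : ℝ) := by
  refine (ENNReal.rpow_le_rpow (enorm_add_le a b) zero_le_two).trans ?_
  have := ENNReal.rpow_add_le_mul_rpow_add_rpow ‖a‖ₑ ‖b‖ₑ (p := 2) one_le_two
  rw [← mul_add]
  refine this.trans (le_of_eq ?_)
  norm_num

theorem lintegral_energy_kernel {f : ℝ → E} (hf : StronglyMeasurable f) :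
    ∫⁻ x, ∫⁻ h : ℝ, ENNReal.ofReal (|h| ^ (-2 : ℝ)) * ‖f (x + h) - f x‖ₑ ^ (2 : ℝ) = energy f := by
  have hm : Measurable fun q : ℝ × ℝ => ‖f (q.2 + q.1) - f q.2‖ₑ ^ (2 : ℝ) :=
    (stronglyMeasurable_increment hf).enorm.pow_const _
  have hm2 : Measurable fun q : ℝ × ℝ =>
      ENNReal.ofReal (|q.1| ^ (-2 : ℝ)) * ‖f (q.2 + q.1) - f q.2‖ₑ ^ (2 : ℝ) := by
    have : Measurable fun q : ℝ × ℝ => ENNReal.ofReal (|q.1| ^ (-2 : ℝ)) := by fun_prop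
    exact this.mul hm
  rw [← lintegral_lintegral_swap (f := fun h x =>
    ENNReal.ofReal (|h| ^ (-2 : ℝ)) * ‖f (x + h) - f x‖ₑ ^ (2 : ℝ)) hm2.aemeasurable]
  unfold energy
  refine lintegral_congr fun h => ?_
  rw [lintegral_const_mul' _ _ ENNReal.ofReal_ne_top]

/-- A function in `Ḣ^{1/2}` is square integrable against `(1 + |x|)^(-2)`. -/
theorem lintegral_sq_decay_lt_top {f : ℝ → E} (hf : AEStronglyMeasurable f volume)
    (he : energy f < ∞) :
    ∫⁻ x, ENNReal.ofReal ((1 + |x|) ^ (-2 : ℝ)) * ‖f x‖ₑ ^ (2 : ℝ) < ∞ := by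
  wlog hfm : StronglyMeasurable f generalizing f
  · have := this hf.stronglyMeasurable_mk.aestronglyMeasurable
      (by rwa [← energy_congr_ae hf.ae_eq_mk]) hf.stronglyMeasurable_mk
    refine lt_of_eq_of_lt (lintegral_congr_ae ?_) this
    filter_upwards [hf.ae_eq_mk] with x hx
    rw [hx]
  have hm : Measurable fun q : ℝ × ℝ =>
      ENNReal.ofReal (|q.2| ^ (-2 : ℝ)) * ‖f (q.1 + q.2) - f q.1‖ₑ ^ (2 : ℝ) := by
    have h1 : Measurable fun q : ℝ × ℝ => ENNReal.ofReal (|q.2| ^ (-2 : ℝ)) := by fun_prop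
    exact h1.mul (((hfm.comp_measurable (measurable_fst.add measurable_snd)).sub
      (hfm.comp_measurable measurable_fst)).enorm.pow_const _)
  have hae := ae_lt_top hm.lintegral_prod_right'
    (by rw [lintegral_energy_kernel hfm]; exact he.ne)
  -- A base point with finite energy density: `f - f a` is square integrable against `|x - a|^(-2)`,
  -- which dominates `(1 + |x|)^(-2)` up to a constant, and the constant `f a` is harmless.
  obtain ⟨a, ha⟩ := hae.exists
  have hK : ∀ x : ℝ, x ≠ a → ENNReal.ofReal ((1 + |x|) ^ (-2 : ℝ)) ≤
      ENNReal.ofReal ((1 + |a|) ^ (2 : ℝ)) * ENNReal.ofReal (|x - a| ^ (-2 : ℝ)) := by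
    intro x hx
    have hd : 0 < |x - a| := abs_pos.2 (sub_ne_zero.2 hx)
    rw [← ENNReal.ofReal_mul (by positivity)]
    refine ENNReal.ofReal_le_ofReal ?_
    rw [Real.rpow_neg (by positivity), Real.rpow_neg (by positivity), ← div_eq_mul_inv,
      inv_eq_one_div, div_le_div_iff₀ (by positivity) (by positivity), one_mul,
      ← Real.mul_rpow (by positivity) (by positivity)]
    refine Real.rpow_le_rpow (by positivity) ?_ zero_le_two
    have := abs_sub x a
    nlinarith [mul_nonneg (abs_nonneg x) (abs_nonneg a)]
  set K := ENNReal.ofReal ((1 + |a|) ^ (2 : ℝ)) with hKdef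
  have hmain : ∀ x : ℝ, x ≠ a → ENNReal.ofReal ((1 + |x|) ^ (-2 : ℝ)) * ‖f x‖ₑ ^ (2 : ℝ) ≤
      2 * K * (ENNReal.ofReal (|x - a| ^ (-2 : ℝ)) * ‖f (a + (x - a)) - f a‖ₑ ^ (2 : ℝ)) +
      (2 * ‖f a‖ₑ ^ (2 : ℝ)) * ENNReal.ofReal ((1 + |x|) ^ (-2 : ℝ)) := by
    intro x hx
    have h1 := enorm_add_rpow_two_le (f x - f a) (f a)
    rw [sub_add_cancel] at h1
    rw [add_sub_cancel]
    calc _ ≤ ENNReal.ofReal ((1 + |x|) ^ (-2 : ℝ)) *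
          (2 * ‖f x - f a‖ₑ ^ (2 : ℝ) + 2 * ‖f a‖ₑ ^ (2 : ℝ)) := by gcongr
      _ = 2 * ENNReal.ofReal ((1 + |x|) ^ (-2 : ℝ)) * ‖f x - f a‖ₑ ^ (2 : ℝ) +
          (2 * ‖f a‖ₑ ^ (2 : ℝ)) * ENNReal.ofReal ((1 + |x|) ^ (-2 : ℝ)) := by ring
      _ ≤ 2 * (K * ENNReal.ofReal (|x - a| ^ (-2 : ℝ))) * ‖f x - f a‖ₑ ^ (2 : ℝ) +
          (2 * ‖f a‖ₑ ^ (2 : ℝ)) * ENNReal.ofReal ((1 + |x|) ^ (-2 : ℝ)) := by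
          gcongr; exact hK x hx
      _ = _ := by ring
  have hle := lintegral_mono_ae (μ := volume)
    ((Measure.ae_ne volume a).mono hmain)
  refine hle.trans_lt ?_
  have hm3 : Measurable fun x : ℝ => (2 * ‖f a‖ₑ ^ (2 : ℝ)) *
      ENNReal.ofReal ((1 + |x|) ^ (-2 : ℝ)) := by fun_prop
  rw [lintegral_add_right _ hm3, lintegral_const_mul' _ _ (by finiteness),
    lintegral_const_mul' _ _ (by finiteness), lintegral_sub_right_eq_self (fun x : ℝ =>
      ENNReal.ofReal (|x| ^ (-2 : ℝ)) * ‖f (a + x) - f a‖ₑ ^ (2 : ℝ)) a]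
  have := decayMass_lt_top
  unfold decayMass at this
  exact ENNReal.add_lt_top.2 ⟨ENNReal.mul_lt_top (by finiteness) ha,
    ENNReal.mul_lt_top (by finiteness) this⟩

theorem incr_add_le {f : ℝ → E} (hf : StronglyMeasurable f) (s t : ℝ) :
    incr 2 f (s + t) ≤ incr 2 f s + incr 2 f t := by
  have hm : ∀ t, Measurable fun y => ‖f (y + t) - f y‖ₑ := fun t =>
    ((hf.comp_measurable (measurable_add_const t)).sub hf).enorm
  have e : incr 2 f t = (∫⁻ x, ‖f (x + s + t) - f (x + s)‖ₑ ^ (2 : ℝ)) ^ (1 / 2 : ℝ) := by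
    rw [incr, ← lintegral_add_right_eq_self _ s]
  rw [e]
  refine le_trans ?_ (ENNReal.lintegral_Lp_add_le (hm s).aemeasurable
    ((hm t).comp (measurable_add_const s)).aemeasurable one_le_two)
  unfold incr
  gcongr with x
  simp only [Pi.add_apply]
  refine le_trans (le_of_eq ?_) (enorm_add_le _ _)
  congr 1
  rw [← add_assoc]; abel

/-- Finite energy gives finiteness only for almost every step, but every `h` is a sum `t + (h - t)`
of two good steps and `incr` is subadditive. -/
theorem incr_two_lt_top {f : ℝ → E} (hf : StronglyMeasurable f) (he : energy f < ∞) (h : ℝ) :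
    incr 2 f h < ∞ := by
  have hm : Measurable fun h : ℝ => ENNReal.ofReal (|h| ^ (-2 : ℝ)) * incr 2 f h ^ (2 : ℝ) := by
    have := measurable_incr (r := 2) hf
    fun_prop
  have h1 : ∀ᵐ h : ℝ, incr 2 f h < ∞ := by
    have := ae_lt_top hm (by simp only [incr_two_sq]; exact he.ne)
    filter_upwards [this, Measure.ae_ne volume (0 : ℝ)] with h hh h0
    by_contra hc
    rw [not_lt, top_le_iff] at hc
    rw [hc, ENNReal.top_rpow_of_pos two_pos, ENNReal.mul_top] at hh
    · exact lt_irrefl _ hh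
    · exact (ENNReal.ofReal_pos.2 (Real.rpow_pos_of_pos (abs_pos.2 h0) _)).ne'
  have h2 : ∀ᵐ t : ℝ, incr 2 f (h - t) < ∞ :=
    (Measure.measurePreserving_sub_left volume h).quasiMeasurePreserving.ae h1
  obtain ⟨t, ht, ht'⟩ := (h1.and h2).exists
  have := incr_add_le hf t (h - t)
  rw [add_sub_cancel] at this
  exact this.trans_lt (ENNReal.add_lt_top.2 ⟨ht, ht'⟩)

theorem energy_add_lt_top {f g : ℝ → E} (hf : energy f < ∞) (hg : energy g < ∞)
    (hfm : AEStronglyMeasurable f volume) : energy (fun x => f x + g x) < ∞ := by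
  have key : energy (fun x => f x + g x) ≤ 2 * energy f + 2 * energy g := by
    have hm : ∀ h, AEMeasurable (fun x => ‖f (x + h) - f x‖ₑ ^ (2 : ℝ)) := fun h =>
      ((hfm.comp_quasiMeasurePreserving
        (measurePreserving_add_right volume h).quasiMeasurePreserving).sub hfm).enorm.pow_const _
    have hm2 : Measurable fun h : ℝ => 2 * (ENNReal.ofReal (|h| ^ (-2 : ℝ)) *
        ∫⁻ x, ‖f (x + h) - f x‖ₑ ^ (2 : ℝ)) := by
      simp only [← incr_two_sq]
      have := measurable_incr_of_ae (r := 2) hfm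
      fun_prop
    unfold energy
    rw [← lintegral_const_mul' _ _ (by finiteness), ← lintegral_const_mul' _ _ (by finiteness),
      ← lintegral_add_left hm2]
    refine lintegral_mono fun h => ?_
    calc _ ≤ ENNReal.ofReal (|h| ^ (-2 : ℝ)) * ∫⁻ x, (2 * ‖f (x + h) - f x‖ₑ ^ (2 : ℝ) +
          2 * ‖g (x + h) - g x‖ₑ ^ (2 : ℝ)) := by
          gcongr with x
          refine le_trans (le_of_eq ?_) (enorm_add_rpow_two_le _ _)
          rw [add_sub_add_comm]
      _ = _ := by
          rw [lintegral_add_left' ((hm h).const_mul _), lintegral_const_mul' _ _ (by finiteness),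
            lintegral_const_mul' _ _ (by finiteness)]
          ring
  exact key.trans_lt (ENNReal.add_lt_top.2 ⟨ENNReal.mul_lt_top (by finiteness) hf,
    ENNReal.mul_lt_top (by finiteness) hg⟩)

end Energy

/-! ### Lipschitz functions with bounded support -/

/-- `ψ` vanishes off `[-R, R]`, is bounded by `M` and Lipschitz with constant `L`. -/
structure BoundedLip {F : Type*} [NormedAddCommGroup F] (R L M : ℝ) (ψ : ℝ → F) : Prop where
  one_le : 1 ≤ R
  lip_nonneg : 0 ≤ L
  bound_nonneg : 0 ≤ M
  eq_zero : ∀ x, R < |x| → ψ x = 0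
  norm_le : ∀ x, ‖ψ x‖ ≤ M
  lip : ∀ x y, ‖ψ x - ψ y‖ ≤ L * |x - y|

open scoped ContDiff in
theorem exists_boundedLip {F : Type*} [NormedAddCommGroup F] [NormedSpace ℝ F] {ψ : ℝ → F}
    (h : ContDiff ℝ ∞ ψ) (hc : HasCompactSupport ψ) : ∃ R L M, BoundedLip R L M ψ := by
  obtain ⟨L, hL⟩ := h.lipschitzWith_of_hasCompactSupport hc (by simp)
  obtain ⟨M, hM⟩ := h.continuous.bounded_above_of_compact_support hc
  obtain ⟨R, hR⟩ := hc.isCompact.isBounded.exists_norm_le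
  refine ⟨max R 1, L, M, le_max_right _ _, L.2, (norm_nonneg _).trans (hM 0), fun x hx => ?_, hM,
    fun x y => ?_⟩
  · by_contra h0
    have := hR x (subset_tsupport _ h0)
    rw [Real.norm_eq_abs] at this
    exact absurd ((le_max_left R 1).trans_lt hx) (not_lt.2 this)
  · simpa [dist_eq_norm] using hL.dist_le_mul x y

section BoundedLip

variable {F : Type*} [NormedAddCommGroup F] {R L M : ℝ} {ψ : ℝ → F}

theorem BoundedLip.continuous (h : BoundedLip R L M ψ) : Continuous ψ := by
  have : LipschitzWith ⟨L, h.lip_nonneg⟩ ψ :=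
    LipschitzWith.of_dist_le_mul fun x y => by
      rw [dist_eq_norm, Real.dist_eq]; exact h.lip x y
  exact this.continuous

theorem BoundedLip.hasCompactSupport (h : BoundedLip R L M ψ) : HasCompactSupport ψ :=
  HasCompactSupport.intro (isCompact_closedBall (0 : ℝ) R) fun x hx => by
    refine h.eq_zero x ?_
    simpa using hx

/-- By symmetry `x` may be taken in `[-R, R]`, since otherwise both values vanish. Then `1 + |y|` is
at most `(1 + R)(1 + |x - y|)`; the Lipschitz bound handles the summand `1` and the sup bound the
summand `|x - y|`. -/
theorem BoundedLip.decay (h : BoundedLip R L M ψ) (x y : ℝ) :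
    (1 + |x|) * (1 + |y|) * ‖ψ x - ψ y‖ ≤ (1 + R) ^ 2 * (L + 2 * M) * |x - y| := by
  have hR := h.one_le
  wlog hx : |x| ≤ R generalizing x y
  · by_cases hy : |y| ≤ R
    · have := this y x hy
      rw [norm_sub_rev, abs_sub_comm, mul_comm (1 + |x|)]
      exact this
    · rw [h.eq_zero x (not_le.1 hx), h.eq_zero y (not_le.1 hy)]
      have := h.lip_nonneg
      have := h.bound_nonneg
      simp only [sub_self, norm_zero, mul_zero]
      positivity
  have h1 := h.lip x y
  have h2 : ‖ψ x - ψ y‖ ≤ 2 * M := by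
    have := norm_sub_le (ψ x) (ψ y)
    linarith [h.norm_le x, h.norm_le y]
  have h3 : 1 + |y| ≤ (1 + R) * (1 + |x - y|) := by
    have : |y| ≤ |x| + |x - y| := by
      have := abs_sub x (x - y)
      simpa using this
    nlinarith [abs_nonneg (x - y)]
  have h4 : (1 + |x - y|) * ‖ψ x - ψ y‖ ≤ (L + 2 * M) * |x - y| := by
    nlinarith [abs_nonneg (x - y)]
  calc (1 + |x|) * (1 + |y|) * ‖ψ x - ψ y‖
      ≤ (1 + R) * ((1 + R) * (1 + |x - y|)) * ‖ψ x - ψ y‖ := by gcongr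
    _ = (1 + R) ^ 2 * ((1 + |x - y|) * ‖ψ x - ψ y‖) := by ring
    _ ≤ (1 + R) ^ 2 * ((L + 2 * M) * |x - y|) := by gcongr
    _ = _ := by ring

/-- The square of `BoundedLip.decay`. The singular factor `|t|^(-2)` is absorbed, and what is left
is a product of integrable weights in `x + t` and in `x`. -/
theorem BoundedLip.increment_sq_le (h : BoundedLip R L M ψ) (t x : ℝ) :
    ENNReal.ofReal (|t| ^ (-2 : ℝ)) * ‖ψ (x + t) - ψ x‖ₑ ^ (2 : ℝ) ≤
      ENNReal.ofReal ((1 + R) ^ 2 * (L + 2 * M)) ^ (2 : ℝ) *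
        (ENNReal.ofReal ((1 + |x + t|) ^ (-2 : ℝ)) * ENNReal.ofReal ((1 + |x|) ^ (-2 : ℝ))) := by
  rcases eq_or_ne t 0 with rfl | ht
  · simp
  have hC : 0 ≤ (1 + R) ^ 2 * (L + 2 * M) := by
    have := h.lip_nonneg
    have := h.bound_nonneg
    positivity
  have ht' : 0 < |t| := abs_pos.2 ht
  rw [← ofReal_norm, ENNReal.ofReal_rpow_of_nonneg (norm_nonneg _) zero_le_two,
    ENNReal.ofReal_rpow_of_nonneg hC zero_le_two, ← ENNReal.ofReal_mul (by positivity),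
    ← ENNReal.ofReal_mul (by positivity), ← ENNReal.ofReal_mul (by positivity)]
  refine ENNReal.ofReal_le_ofReal ?_
  have hd := h.decay (x + t) x
  rw [add_sub_cancel_left] at hd
  rw [Real.rpow_neg ht'.le, Real.rpow_neg (by positivity), Real.rpow_neg (by positivity),
    ← mul_inv, ← Real.mul_rpow (by positivity) (by positivity), inv_mul_eq_div, ← div_eq_mul_inv,
    div_le_div_iff₀ (by positivity) (by positivity), ← Real.mul_rpow (by positivity)
    (by positivity), ← Real.mul_rpow hC (by positivity)]
  refine Real.rpow_le_rpow (by positivity) ?_ zero_le_two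
  linarith

theorem lintegral_decay_prod (f : ℝ → ℝ≥0∞) (hf : Measurable f) :
    ∫⁻ t : ℝ, ∫⁻ x : ℝ, ENNReal.ofReal ((1 + |x + t|) ^ (-2 : ℝ)) * f x =
      decayMass * ∫⁻ x, f x := by
  have hm : Measurable fun q : ℝ × ℝ =>
      ENNReal.ofReal ((1 + |q.2 + q.1|) ^ (-2 : ℝ)) * f q.2 := by fun_prop
  rw [lintegral_lintegral_swap hm.aemeasurable, ← lintegral_const_mul _ hf]
  refine lintegral_congr fun x => ?_
  rw [lintegral_mul_const _ (by fun_prop),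
    lintegral_add_left_eq_self (fun y : ℝ => ENNReal.ofReal ((1 + |y|) ^ (-2 : ℝ))) x]
  rfl

theorem BoundedLip.energy_le (h : BoundedLip R L M ψ) :
    energy ψ ≤ ENNReal.ofReal ((1 + R) ^ 2 * (L + 2 * M)) ^ (2 : ℝ) * decayMass ^ (2 : ℝ) := by
  have e : decayMass ^ (2 : ℝ) = decayMass * ∫⁻ x : ℝ, ENNReal.ofReal ((1 + |x|) ^ (-2 : ℝ)) := by
    rw [← decayMass, show (2 : ℝ) = ((2 : ℕ) : ℝ) by norm_num, ENNReal.rpow_natCast, sq]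
  rw [e, ← lintegral_decay_prod _ (by fun_prop), ← lintegral_const_mul' _ _ (by finiteness)]
  refine lintegral_mono fun t => ?_
  rw [← lintegral_const_mul' _ _ ENNReal.ofReal_ne_top, ← lintegral_const_mul' _ _ (by finiteness)]
  exact lintegral_mono fun x => h.increment_sq_le t x

theorem BoundedLip.hHalfNorm_le (h : BoundedLip R L M ψ) :
    hHalfNorm ψ ≤ ENNReal.ofReal ((1 + R) ^ 2 * (L + 2 * M)) * decayMass := by
  rw [hHalfNorm_eq]
  refine (ENNReal.rpow_le_rpow h.energy_le (by norm_num)).trans (le_of_eq ?_)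
  rw [← ENNReal.mul_rpow_of_nonneg _ _ zero_le_two, ← ENNReal.rpow_mul]
  simp

theorem BoundedLip.energy_lt_top (h : BoundedLip R L M ψ) : energy ψ < ∞ := by
  have := decayMass_lt_top
  exact h.energy_le.trans_lt (by finiteness)

end BoundedLip

/-- Multiplication by a Lipschitz function with bounded support preserves `Ḣ^{1/2}`. -/
theorem BoundedLip.energy_mul_lt_top {R L M : ℝ} {ψ u : ℝ → ℝ} (h : BoundedLip R L M ψ)
    (hu : AEStronglyMeasurable u volume) (he : energy u < ∞) :
    energy (fun x => ψ x * u x) < ∞ := by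
  wlog hum : StronglyMeasurable u generalizing u
  · have := this hu.stronglyMeasurable_mk.aestronglyMeasurable
      (by rwa [← energy_congr_ae hu.ae_eq_mk]) hu.stronglyMeasurable_mk
    refine lt_of_eq_of_lt (energy_congr_ae ?_) this
    filter_upwards [hu.ae_eq_mk] with x hx
    rw [hx]
  set C := ENNReal.ofReal ((1 + R) ^ 2 * (L + 2 * M)) ^ (2 : ℝ) with hC
  set B := ENNReal.ofReal M ^ (2 : ℝ) with hB
  have hpt : ∀ t x, ENNReal.ofReal (|t| ^ (-2 : ℝ)) *
      ‖ψ (x + t) * u (x + t) - ψ x * u x‖ₑ ^ (2 : ℝ) ≤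
      2 * B * (ENNReal.ofReal (|t| ^ (-2 : ℝ)) * ‖u (x + t) - u x‖ₑ ^ (2 : ℝ)) +
      2 * C * (ENNReal.ofReal ((1 + |x + t|) ^ (-2 : ℝ)) *
        (ENNReal.ofReal ((1 + |x|) ^ (-2 : ℝ)) * ‖u x‖ₑ ^ (2 : ℝ))) := by
    intro t x
    -- Discrete Leibniz rule. The first part is controlled by the energy of `u`; in the second, the
    -- decay of the increments of `ψ` leaves only the weighted `L²` norm of `u`.
    have e : ψ (x + t) * u (x + t) - ψ x * u x =
        ψ (x + t) * (u (x + t) - u x) + (ψ (x + t) - ψ x) * u x := by ring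
    have hψ : ‖ψ (x + t)‖ₑ ≤ ENNReal.ofReal M := by
      rw [← ofReal_norm]
      exact ENNReal.ofReal_le_ofReal (h.norm_le _)
    calc _ ≤ ENNReal.ofReal (|t| ^ (-2 : ℝ)) * (2 * (B * ‖u (x + t) - u x‖ₑ ^ (2 : ℝ)) +
          2 * (‖ψ (x + t) - ψ x‖ₑ ^ (2 : ℝ) * ‖u x‖ₑ ^ (2 : ℝ))) := by
          gcongr
          rw [e]
          refine (enorm_add_rpow_two_le _ _).trans ?_
          rw [enorm_mul, enorm_mul, ENNReal.mul_rpow_of_nonneg _ _ zero_le_two,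
            ENNReal.mul_rpow_of_nonneg _ _ zero_le_two]
          gcongr
          exact ENNReal.rpow_le_rpow hψ zero_le_two
      _ = 2 * B * (ENNReal.ofReal (|t| ^ (-2 : ℝ)) * ‖u (x + t) - u x‖ₑ ^ (2 : ℝ)) +
          2 * ((ENNReal.ofReal (|t| ^ (-2 : ℝ)) * ‖ψ (x + t) - ψ x‖ₑ ^ (2 : ℝ)) *
            ‖u x‖ₑ ^ (2 : ℝ)) := by ring
      _ ≤ 2 * B * (ENNReal.ofReal (|t| ^ (-2 : ℝ)) * ‖u (x + t) - u x‖ₑ ^ (2 : ℝ)) +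
          2 * ((C * (ENNReal.ofReal ((1 + |x + t|) ^ (-2 : ℝ)) *
            ENNReal.ofReal ((1 + |x|) ^ (-2 : ℝ)))) * ‖u x‖ₑ ^ (2 : ℝ)) := by
          gcongr _ + 2 * (?_ * _)
          exact h.increment_sq_le t x
      _ = _ := by ring
  have hdec := lintegral_sq_decay_lt_top hu he
  have hm1 : Measurable fun t : ℝ => 2 * B * (ENNReal.ofReal (|t| ^ (-2 : ℝ)) *
      incr 2 u t ^ (2 : ℝ)) := by
    have := measurable_incr (r := 2) hum
    fun_prop
  have hume := hum.enorm
  have hm2 : ∀ t, Measurable fun x : ℝ =>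
      2 * B * (ENNReal.ofReal (|t| ^ (-2 : ℝ)) * ‖u (x + t) - u x‖ₑ ^ (2 : ℝ)) := fun t => by
    have := ((hum.comp_measurable (measurable_add_const t)).sub hum).enorm
    simp only [Function.comp_def] at this
    exact ((this.pow_const _).const_mul _).const_mul _
  have hfin : 2 * B * energy u + 2 * C * (decayMass * ∫⁻ x : ℝ,
      ENNReal.ofReal ((1 + |x|) ^ (-2 : ℝ)) * ‖u x‖ₑ ^ (2 : ℝ)) < ∞ := by
    have := decayMass_lt_top
    finiteness
  refine lt_of_le_of_lt ?_ hfin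
  have hB2 : 2 * B ≠ ∞ := by finiteness
  have hC2 : 2 * C ≠ ∞ := by finiteness
  rw [energy, energy, ← lintegral_decay_prod _ (by fun_prop), ← lintegral_const_mul' _ _ hB2,
    ← lintegral_const_mul' _ _ hC2, ← lintegral_add_left (by simpa only [incr_two_sq] using hm1)]
  refine lintegral_mono fun t => ?_
  rw [← lintegral_const_mul' _ _ ENNReal.ofReal_ne_top, ← lintegral_const_mul' _ _
    ENNReal.ofReal_ne_top, ← lintegral_const_mul' _ _ hB2, ← lintegral_const_mul' _ _ hC2,
    ← lintegral_add_left (hm2 t)]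
  exact lintegral_mono (hpt t)

/-- A Lipschitz function with bounded support times a function in `Ḣ^{1/2}` lies in `L²`. -/
theorem BoundedLip.memLp_mul {R L M : ℝ} {ψ u : ℝ → ℝ} (h : BoundedLip R L M ψ)
    (hu : AEStronglyMeasurable u volume) (he : energy u < ∞) :
    MemLp (fun x => ψ x * u x) 2 volume := by
  refine ⟨h.continuous.aestronglyMeasurable.mul hu, ?_⟩
  rw [eLpNorm_lt_top_iff_lintegral_rpow_enorm_lt_top two_ne_zero ENNReal.ofNat_ne_top]
  have hdec := lintegral_sq_decay_lt_top hu he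
  have hpt : ∀ x, ‖ψ x * u x‖ₑ ^ (2 : ℝ) ≤ ENNReal.ofReal ((M * (1 + R)) ^ (2 : ℝ)) *
      (ENNReal.ofReal ((1 + |x|) ^ (-2 : ℝ)) * ‖u x‖ₑ ^ (2 : ℝ)) := by
    intro x
    have hM := h.bound_nonneg
    have hR := h.one_le
    rw [enorm_mul, ENNReal.mul_rpow_of_nonneg _ _ zero_le_two, ← mul_assoc]
    gcongr
    by_cases hx : |x| ≤ R
    · rw [← ofReal_norm, ENNReal.ofReal_rpow_of_nonneg (norm_nonneg _) zero_le_two,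
        ← ENNReal.ofReal_mul (by positivity)]
      refine ENNReal.ofReal_le_ofReal ?_
      rw [Real.rpow_neg (by positivity), ← div_eq_mul_inv, ← Real.div_rpow (by positivity)
        (by positivity)]
      refine Real.rpow_le_rpow (norm_nonneg _) ?_ zero_le_two
      rw [le_div_iff₀ (by positivity)]
      exact mul_le_mul (h.norm_le x) (by linarith) (by positivity) hM
    · simp [h.eq_zero x (not_le.1 hx)]
  simp only [ENNReal.toReal_ofNat]
  refine (lintegral_mono hpt).trans_lt ?_
  rw [lintegral_const_mul' _ _ ENNReal.ofReal_ne_top]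
  finiteness

/-! ### Weighted integrability of functions of finite energy. -/

theorem lintegral_unit_le_incr {E : Type*} [NormedAddCommGroup E] {f : ℝ → E}
    (hf : StronglyMeasurable f) (h : ℝ) :
    ∫⁻ x in Set.Icc (0 : ℝ) 1, ‖f (x + h) - f x‖ₑ ≤ incr 4 f h := by
  have hm : Measurable fun y => ‖f (y + h) - f y‖ₑ :=
    ((hf.comp_measurable (measurable_add_const h)).sub hf).enorm
  have hpq : (4 : ℝ).HolderConjugate (4 / 3) := by
    rw [Real.holderConjugate_iff]; norm_num
  have := ENNReal.lintegral_mul_le_Lp_mul_Lq (volume.restrict (Set.Icc (0 : ℝ) 1)) hpq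
    (f := fun x => ‖f (x + h) - f x‖ₑ) (g := fun _ => 1) hm.aemeasurable aemeasurable_const
  simp only [Pi.mul_apply, mul_one, ENNReal.one_rpow, lintegral_const, MeasurableSet.univ,
    Measure.restrict_apply, Set.univ_inter, Real.volume_Icc, sub_zero, ENNReal.ofReal_one] at this
  refine this.trans ?_
  unfold incr
  gcongr
  exact Measure.restrict_le_self

/-- A function in `Ḣ^{1/2}` is integrable against `(1 + |x|)^(-3/2)`. -/
theorem lintegral_decay_lt_top {E : Type*} [NormedAddCommGroup E] [NormedSpace ℝ E]
    [CompleteSpace E] {f : ℝ → E} (hf : LocallyIntegrable f volume) (he : energy f < ∞) :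
    ∫⁻ x, ENNReal.ofReal ((1 + |x|) ^ (-(3 / 2) : ℝ)) * ‖f x‖ₑ < ∞ := by
  wlog hfm : StronglyMeasurable f generalizing f
  · have hm := hf.aestronglyMeasurable
    have := this (hf.congr hm.ae_eq_mk) (by rwa [← energy_congr_ae hm.ae_eq_mk])
      hm.stronglyMeasurable_mk
    refine lt_of_eq_of_lt (lintegral_congr_ae ?_) this
    filter_upwards [hm.ae_eq_mk] with x hx
    rw [hx]
  have hw : ∫⁻ x : ℝ, ENNReal.ofReal ((1 + |x|) ^ (-(3 / 2) : ℝ)) < ∞ := by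
    have := finite_integral_one_add_norm (E := ℝ) (μ := volume) (r := 3 / 2)
      (by simp; norm_num)
    simpa using this
  -- Cauchy–Schwarz from the weighted `L²` bound would just miss, by a logarithm. The exponent `4`
  -- is chosen because the Besov weight `|h|^(-1-2/4)` is then exactly `|h|^(-3/2)`.
  have hB : besovNorm (1 / 4) 4 2 f < ∞ := by
    have h1 := besovNorm_le_hHalfNorm (p := 4) (by norm_num) hf
    refine h1.trans_lt (ENNReal.mul_lt_top ENNReal.coe_lt_top ?_)
    rwa [hHalfNorm_lt_top_iff]
  rw [besovNorm_eq_incr (by norm_num), ENNReal.rpow_lt_top_iff_of_pos (by norm_num)] at hB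
  have hJ : ∫⁻ h : ℝ, ENNReal.ofReal ((1 + |h|) ^ (-(3 / 2) : ℝ)) *
      ∫⁻ x in Set.Icc (0 : ℝ) 1, ‖f (x + h) - f x‖ₑ < ∞ := by
    have hpt : ∀ h : ℝ, h ≠ 0 → ENNReal.ofReal ((1 + |h|) ^ (-(3 / 2) : ℝ)) *
        ∫⁻ x in Set.Icc (0 : ℝ) 1, ‖f (x + h) - f x‖ₑ ≤
        ENNReal.ofReal ((1 + |h|) ^ (-(3 / 2) : ℝ)) +
          ENNReal.ofReal (|h| ^ (-1 - 1 / 4 * 2 : ℝ)) * incr 4 f h ^ (2 : ℝ) := by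
      intro h hh
      have hh' : 0 < |h| := abs_pos.2 hh
      have ha : incr 4 f h ≤ 1 + incr 4 f h ^ (2 : ℝ) := by
        rcases le_total (incr 4 f h) 1 with h1 | h1
        · exact h1.trans le_self_add
        · refine le_trans ?_ le_add_self
          calc incr 4 f h = incr 4 f h ^ (1 : ℝ) := (ENNReal.rpow_one _).symm
            _ ≤ _ := ENNReal.rpow_le_rpow_of_exponent_le h1 one_le_two
      calc _ ≤ ENNReal.ofReal ((1 + |h|) ^ (-(3 / 2) : ℝ)) * (1 + incr 4 f h ^ (2 : ℝ)) := by
            gcongr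
            exact (lintegral_unit_le_incr hfm h).trans ha
        _ = ENNReal.ofReal ((1 + |h|) ^ (-(3 / 2) : ℝ)) +
            ENNReal.ofReal ((1 + |h|) ^ (-(3 / 2) : ℝ)) * incr 4 f h ^ (2 : ℝ) := by ring
        _ ≤ _ := by
            gcongr
            rw [show (-1 - 1 / 4 * 2 : ℝ) = -(3 / 2) by norm_num]
            exact Real.rpow_le_rpow_of_nonpos hh' (by linarith) (by norm_num)
    refine (lintegral_mono_ae ((Measure.ae_ne volume (0 : ℝ)).mono hpt)).trans_lt ?_
    rw [lintegral_add_left (by fun_prop)]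
    exact ENNReal.add_lt_top.2 ⟨hw, hB⟩
  have hm : Measurable fun q : ℝ × ℝ => ENNReal.ofReal ((1 + |q.2|) ^ (-(3 / 2) : ℝ)) *
      ‖f (q.1 + q.2) - f q.1‖ₑ := by
    have h1 : Measurable fun q : ℝ × ℝ => ENNReal.ofReal ((1 + |q.2|) ^ (-(3 / 2) : ℝ)) := by
      fun_prop
    exact h1.mul ((hfm.comp_measurable (measurable_fst.add measurable_snd)).sub
      (hfm.comp_measurable measurable_fst)).enorm
  have hJ' : ∫⁻ x in Set.Icc (0 : ℝ) 1, ∫⁻ h : ℝ,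
      ENNReal.ofReal ((1 + |h|) ^ (-(3 / 2) : ℝ)) * ‖f (x + h) - f x‖ₑ < ∞ := by
    rw [lintegral_lintegral_swap hm.aemeasurable]
    refine lt_of_eq_of_lt (lintegral_congr fun h => ?_) hJ
    rw [lintegral_const_mul' _ _ ENNReal.ofReal_ne_top]
  have hne : (ae (volume.restrict (Set.Icc (0 : ℝ) 1))).NeBot := by
    rw [ae_restrict_neBot]; simp
  -- Again a base point, now in `[0, 1]`, at which the weighted integral of `f (a + h) - f a` is
  -- finite; moving the weight from `a` to the origin costs the constant `K`.
  obtain ⟨a, ha⟩ := (ae_lt_top hm.lintegral_prod_right' hJ'.ne).exists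
  set K := ENNReal.ofReal ((1 + |a|) ^ (3 / 2 : ℝ)) with hKdef
  have hK : ∀ x : ℝ, ENNReal.ofReal ((1 + |x|) ^ (-(3 / 2) : ℝ)) ≤
      K * ENNReal.ofReal ((1 + |x - a|) ^ (-(3 / 2) : ℝ)) := by
    intro x
    rw [hKdef, ← ENNReal.ofReal_mul (by positivity)]
    refine ENNReal.ofReal_le_ofReal ?_
    rw [Real.rpow_neg (by positivity), Real.rpow_neg (by positivity), ← div_eq_mul_inv,
      inv_eq_one_div, div_le_div_iff₀ (by positivity) (by positivity), one_mul,
      ← Real.mul_rpow (by positivity) (by positivity)]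
    refine Real.rpow_le_rpow (by positivity) ?_ (by norm_num)
    have := abs_sub x a
    nlinarith [mul_nonneg (abs_nonneg x) (abs_nonneg a)]
  have hmain : ∀ x : ℝ, ENNReal.ofReal ((1 + |x|) ^ (-(3 / 2) : ℝ)) * ‖f x‖ₑ ≤
      K * (ENNReal.ofReal ((1 + |x - a|) ^ (-(3 / 2) : ℝ)) * ‖f (a + (x - a)) - f a‖ₑ) +
      ‖f a‖ₑ * ENNReal.ofReal ((1 + |x|) ^ (-(3 / 2) : ℝ)) := by
    intro x
    have h1 := enorm_add_le (f x - f a) (f a)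
    rw [sub_add_cancel] at h1
    rw [add_sub_cancel]
    calc _ ≤ ENNReal.ofReal ((1 + |x|) ^ (-(3 / 2) : ℝ)) * (‖f x - f a‖ₑ + ‖f a‖ₑ) := by gcongr
      _ = ENNReal.ofReal ((1 + |x|) ^ (-(3 / 2) : ℝ)) * ‖f x - f a‖ₑ +
          ‖f a‖ₑ * ENNReal.ofReal ((1 + |x|) ^ (-(3 / 2) : ℝ)) := by ring
      _ ≤ (K * ENNReal.ofReal ((1 + |x - a|) ^ (-(3 / 2) : ℝ))) * ‖f x - f a‖ₑ +
          ‖f a‖ₑ * ENNReal.ofReal ((1 + |x|) ^ (-(3 / 2) : ℝ)) := by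
          gcongr; exact hK x
      _ = _ := by ring
  refine (lintegral_mono hmain).trans_lt ?_
  rw [lintegral_add_right _ (by fun_prop), lintegral_const_mul' _ _ ENNReal.ofReal_ne_top,
    lintegral_const_mul' _ _ enorm_ne_top, lintegral_sub_right_eq_self (fun x : ℝ =>
      ENNReal.ofReal ((1 + |x|) ^ (-(3 / 2) : ℝ)) * ‖f (a + x) - f a‖ₑ) a]
  exact ENNReal.add_lt_top.2 ⟨ENNReal.mul_lt_top ENNReal.ofReal_lt_top ha,
    ENNReal.mul_lt_top enorm_lt_top hw⟩

/-! ### The kernel of the operator and its truncations -/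

/-- The measure `|h|^(-3/2) dh`. -/
def quarterKer : Measure ℝ :=
  volume.withDensity fun h => ENNReal.ofReal (|h| ^ (-(3 / 2) : ℝ))

instance : SFinite quarterKer := by unfold quarterKer; infer_instance

theorem quarterKer_absolutelyContinuous : quarterKer ≪ volume :=
  withDensity_absolutelyContinuous _ _

theorem setLIntegral_quarterKer {S : Set ℝ} (hS : MeasurableSet S) (f : ℝ → ℝ≥0∞) :
    ∫⁻ h in S, f h ∂quarterKer = ∫⁻ h in S, ENNReal.ofReal (|h| ^ (-(3 / 2) : ℝ)) * f h := by
  unfold quarterKer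
  rw [restrict_withDensity hS, lintegral_withDensity_eq_lintegral_mul_non_measurable]
  · rfl
  · fun_prop
  · exact Filter.Eventually.of_forall fun _ => ENNReal.ofReal_lt_top

theorem lintegral_quarterKer (f : ℝ → ℝ≥0∞) :
    ∫⁻ h, f h ∂quarterKer = ∫⁻ h, ENNReal.ofReal (|h| ^ (-(3 / 2) : ℝ)) * f h := by
  simpa using setLIntegral_quarterKer MeasurableSet.univ f

/-- The two half-lines contribute `2 r^(-1/2)` each. In the `L²` bound this tail supplies the
missing half power between `|h|^(-3/2)` and `|h|^(-2)`. -/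
theorem quarterKer_tail_le {r : ℝ} (hr : 0 < r) :
    quarterKer {l | r ≤ |l|} ≤ ENNReal.ofReal (4 * r ^ (-(1 / 2) : ℝ)) := by
  have hIoi : ∫⁻ l in Set.Ioi r, ENNReal.ofReal (|l| ^ (-(3 / 2) : ℝ)) =
      ENNReal.ofReal (2 * r ^ (-(1 / 2) : ℝ)) := by
    have h1 := integral_Ioi_rpow_of_lt (a := -(3 / 2)) (by norm_num) hr
    have h2 := integrableOn_Ioi_rpow_of_lt (a := -(3 / 2)) (by norm_num) hr
    have h3 : ∫⁻ l in Set.Ioi r, ENNReal.ofReal (|l| ^ (-(3 / 2) : ℝ)) =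
        ∫⁻ l in Set.Ioi r, ENNReal.ofReal (l ^ (-(3 / 2) : ℝ)) := by
      refine setLIntegral_congr_fun measurableSet_Ioi fun l hl => ?_
      rw [abs_of_pos (hr.trans hl)]
    rw [h3, ← ofReal_integral_eq_lintegral_ofReal h2, h1]
    · congr 1
      rw [show (-(3 / 2) + 1 : ℝ) = -(1 / 2) by norm_num]; ring
    · filter_upwards [self_mem_ae_restrict measurableSet_Ioi] with l hl
      exact Real.rpow_nonneg (hr.trans hl).le _
  have hIio : ∫⁻ l in Set.Iio (-r), ENNReal.ofReal (|l| ^ (-(3 / 2) : ℝ)) =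
      ENNReal.ofReal (2 * r ^ (-(1 / 2) : ℝ)) := by
    rw [← hIoi, ← lintegral_indicator measurableSet_Ioi, ← lintegral_indicator measurableSet_Iio,
      ← lintegral_neg_eq_self]
    refine lintegral_congr fun l => ?_
    by_cases hl : r < l
    · rw [Set.indicator_of_mem (by simpa using hl), Set.indicator_of_mem (by simpa using hl),
        abs_neg]
    · rw [Set.indicator_of_notMem (by simpa using hl), Set.indicator_of_notMem (by simpa using hl)]
  have hset : {l : ℝ | r ≤ |l|} =ᵐ[volume] (Set.Ioi r ∪ Set.Iio (-r) : Set ℝ) := by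
    filter_upwards [Measure.ae_ne volume r, Measure.ae_ne volume (-r)] with l h1 h2
    refine propext ⟨fun hl => ?_, fun hl => ?_⟩
    · rcases le_abs.1 (show r ≤ |l| from hl) with h | h
      · exact Or.inl (lt_of_le_of_ne h (Ne.symm h1))
      · exact Or.inr (lt_of_le_of_ne (by linarith) h2)
    · rcases hl with h | h
      · exact (le_of_lt h).trans (le_abs_self l)
      · exact (by linarith [show l < -r from h] : r ≤ -l).trans (neg_le_abs l)
  rw [measure_congr (quarterKer_absolutelyContinuous.ae_eq hset)]
  refine (measure_union_le _ _).trans (le_of_eq ?_)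
  unfold quarterKer
  rw [withDensity_apply _ measurableSet_Ioi, withDensity_apply _ measurableSet_Iio, hIoi, hIio,
    ← ENNReal.ofReal_add (by positivity) (by positivity)]
  congr 1; ring

/-- A symmetric measurable set of increments, away from `0` and `∞`. -/
structure IsTruncation (S : Set ℝ) (a b : ℝ) : Prop where
  measurableSet : MeasurableSet S
  symm : ∀ h, h ∈ S → -h ∈ S
  pos : 0 < a
  lt_abs : ∀ h ∈ S, a ≤ |h|
  abs_lt : ∀ h ∈ S, |h| ≤ b

/-- The truncation of the kernel of `Λ`. -/
def truncKer (S : Set ℝ) : Measure ℝ := quarterKer.restrict S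

instance (S : Set ℝ) : SFinite (truncKer S) := by unfold truncKer; infer_instance

theorem truncKer_absolutelyContinuous (S : Set ℝ) : truncKer S ≪ volume :=
  Measure.restrict_le_self.absolutelyContinuous.trans quarterKer_absolutelyContinuous

section Truncation

variable {S : Set ℝ} {a b : ℝ}

/-- Away from `0` the kernel is bounded. Hence `u x` and `u (x + h)` may be integrated separately
for any locally integrable `u`. -/
theorem IsTruncation.truncKer_le (hS : IsTruncation S a b) :
    truncKer S ≤ ENNReal.ofReal (a ^ (-(3 / 2) : ℝ)) • volume.restrict (Set.Icc (-b) b) := by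
  unfold truncKer quarterKer
  rw [restrict_withDensity hS.measurableSet, ← withDensity_const]
  have hsub : S ⊆ Set.Icc (-b) b := fun h hh => Set.mem_Icc.2 (_root_.abs_le.1 (hS.abs_lt h hh))
  calc _ ≤ (volume.restrict S).withDensity fun _ => ENNReal.ofReal (a ^ (-(3 / 2) : ℝ)) := by
        refine withDensity_mono ?_
        filter_upwards [self_mem_ae_restrict hS.measurableSet] with h hh
        exact ENNReal.ofReal_le_ofReal
          (Real.rpow_le_rpow_of_nonpos hS.pos (hS.lt_abs h hh) (by norm_num))
    _ ≤ _ := by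
        rw [withDensity_const, withDensity_const]
        gcongr

theorem IsTruncation.isFiniteMeasure (hS : IsTruncation S a b) :
    IsFiniteMeasure (truncKer S) := by
  have : IsFiniteMeasure
      (ENNReal.ofReal (a ^ (-(3 / 2) : ℝ)) • volume.restrict (Set.Icc (-b) b)) :=
    (volume.restrict (Set.Icc (-b) b)).smul_finite ENNReal.ofReal_ne_top
  exact isFiniteMeasure_of_le _ hS.truncKer_le

theorem IsTruncation.integrable_comp_add (hS : IsTruncation S a b) {E : Type*}
    [NormedAddCommGroup E] {u : ℝ → E} (hu : LocallyIntegrable u volume) (x : ℝ) :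
    Integrable (fun h => u (x + h)) (truncKer S) := by
  have h1 : IntegrableOn (fun h => u (x + h)) (Set.Icc (-b) b) volume := by
    have := (hu.integrableOn_isCompact (isCompact_Icc (a := x + -b) (b := x + b)))
    have hmp := measurePreserving_add_left volume x
    have := (hmp.integrableOn_comp_preimage (Homeomorph.addLeft x).measurableEmbedding).2 this
    simpa [Function.comp_def, Set.preimage_const_add_Icc] using this
  exact (h1.smul_measure ENNReal.ofReal_ne_top).mono_measure hS.truncKer_le

/-- Evenness of the kernel; both the passage to second differences and the symmetry of the truncated
operator rest on it. -/
theorem IsTruncation.map_neg (hS : IsTruncation S a b) :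
    MeasurePreserving (fun h : ℝ => -h) (truncKer S) (truncKer S) := by
  refine ⟨measurable_neg, ?_⟩
  ext s hs
  rw [Measure.map_apply measurable_neg hs]
  unfold truncKer
  rw [Measure.restrict_apply hs, Measure.restrict_apply (measurable_neg hs)]
  unfold quarterKer
  rw [withDensity_apply _ (hs.inter hS.measurableSet),
    withDensity_apply _ ((measurable_neg hs).inter hS.measurableSet),
    ← lintegral_indicator (hs.inter hS.measurableSet),
    ← lintegral_indicator ((measurable_neg hs).inter hS.measurableSet), ← lintegral_neg_eq_self]
  refine lintegral_congr fun l => ?_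
  have hiff : -l ∈ (fun h : ℝ => -h) ⁻¹' s ∩ S ↔ l ∈ s ∩ S := by
    simp only [Set.mem_inter_iff, Set.mem_preimage, neg_neg]
    exact and_congr_right fun _ => ⟨fun h => by simpa using hS.symm _ h, hS.symm l⟩
  by_cases hl : l ∈ s ∩ S
  · rw [Set.indicator_of_mem hl, Set.indicator_of_mem (hiff.2 hl), abs_neg]
  · rw [Set.indicator_of_notMem hl, Set.indicator_of_notMem (fun h => hl (hiff.1 h))]

end Truncation

/-- The operator `u ↦ ∫ (u(x) - u(x + h)) dν(h)`. -/
def incLap (ν : Measure ℝ) (u : ℝ → ℝ) (x : ℝ) : ℝ := ∫ h, (u x - u (x + h)) ∂ν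

theorem quarterLapTest_eq_incLap (φ : ℝ → ℝ) (x : ℝ) :
    quarterLapTest φ x = incLap quarterKer φ x := by
  unfold quarterLapTest incLap quarterKer
  rw [integral_withDensity_eq_integral_toReal_smul (by fun_prop)
    (Filter.Eventually.of_forall fun _ => ENNReal.ofReal_lt_top),
    ← integral_add_left_eq_self _ x]
  refine integral_congr_ae (Filter.Eventually.of_forall fun h => ?_)
  simp only
  rw [ENNReal.toReal_ofReal (by positivity), smul_eq_mul, show x - (x + h) = -h by ring, abs_neg,
    Real.rpow_neg (abs_nonneg h), div_eq_inv_mul]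

theorem incLap_congr_ae {ν : Measure ℝ} (hν : ν ≪ volume) {u u' : ℝ → ℝ}
    (h : u =ᵐ[volume] u') : incLap ν u =ᵐ[volume] incLap ν u' := by
  filter_upwards [h] with x hx
  refine integral_congr_ae ?_
  have h1 : ∀ᵐ t, u (x + t) = u' (x + t) :=
    (measurePreserving_add_left volume x).quasiMeasurePreserving.ae h
  filter_upwards [hν.ae_le h1] with t ht
  rw [hx, ht]

theorem aestronglyMeasurable_incLap {ν : Measure ℝ} [SFinite ν] (hν : ν ≪ volume) {u : ℝ → ℝ}
    (hu : AEStronglyMeasurable u volume) : AEStronglyMeasurable (incLap ν u) volume := by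
  refine AEStronglyMeasurable.congr ?_ (incLap_congr_ae hν hu.ae_eq_mk).symm
  have hm := hu.stronglyMeasurable_mk
  have : StronglyMeasurable fun q : ℝ × ℝ => hu.mk u q.1 - hu.mk u (q.1 + q.2) :=
    (hm.comp_measurable measurable_fst).sub
      (hm.comp_measurable (measurable_fst.add measurable_snd))
  exact this.integral_prod_right'.aestronglyMeasurable

/-! ### The `L²` bound for the truncated operators -/

theorem ENNReal.mul_le_rpow_two_add (a b : ℝ≥0∞) : a * b ≤ a ^ (2 : ℝ) + b ^ (2 : ℝ) := by
  have e : ∀ c : ℝ≥0∞, c ^ (2 : ℝ) = c * c := fun c => by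
    rw [show (2 : ℝ) = ((2 : ℕ) : ℝ) by norm_num, ENNReal.rpow_natCast, sq]
  rw [e, e]
  rcases le_total a b with h | h
  · exact (mul_le_mul_left h b).trans le_add_self
  · exact (mul_le_mul_right h a).trans le_self_add

/-- The square is written as a double integral over `(h, l)`, and Fubini moves the `x` integral
inside. Absolute values are taken only afterwards, so cancellation in `∫ w h x * w l x` is kept. -/
theorem lintegral_sq_integral_le {X H : Type*} [MeasurableSpace X] [MeasurableSpace H]
    {μ : Measure X} [SFinite μ] {ν : Measure H} [IsFiniteMeasure ν] {w : H → X → ℝ}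
    (hw : Measurable (Function.uncurry w))
    (hfin : ∫⁻ h, ∫⁻ x, ‖w h x‖ₑ ^ (2 : ℝ) ∂μ ∂ν < ∞) :
    ∫⁻ x, ‖∫ h, w h x ∂ν‖ₑ ^ (2 : ℝ) ∂μ ≤ ∫⁻ h, ∫⁻ l, ‖∫ x, w h x * w l x ∂μ‖ₑ ∂ν ∂ν := by
  set Z : X → H × H → ℝ := fun x q => w q.1 x * w q.2 x with hZ
  have hw1 : Measurable fun z : X × H × H => w z.2.1 z.1 :=
    hw.comp ((measurable_fst.comp measurable_snd).prodMk measurable_fst)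
  have hw2 : Measurable fun z : X × H × H => w z.2.2 z.1 :=
    hw.comp ((measurable_snd.comp measurable_snd).prodMk measurable_fst)
  have hZm : Measurable (Function.uncurry Z) := hw1.mul hw2
  have hws : Measurable fun q : X × H => ‖w q.2 q.1‖ₑ ^ (2 : ℝ) :=
    (hw.comp measurable_swap).enorm.pow_const _
  have hswap : ∫⁻ x, ∫⁻ h, ‖w h x‖ₑ ^ (2 : ℝ) ∂ν ∂μ < ∞ := by
    rwa [lintegral_lintegral_swap hws.aemeasurable]
  have hZi : Integrable (Function.uncurry Z) (μ.prod (ν.prod ν)) := by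
    refine ⟨hZm.aestronglyMeasurable, ?_⟩
    rw [HasFiniteIntegral]
    have hle : ∀ z : X × H × H, ‖Function.uncurry Z z‖ₑ ≤
        ‖w z.2.1 z.1‖ₑ ^ (2 : ℝ) + ‖w z.2.2 z.1‖ₑ ^ (2 : ℝ) := fun z => by
      simp only [Function.uncurry, hZ, enorm_mul]
      exact ENNReal.mul_le_rpow_two_add _ _
    refine (lintegral_mono hle).trans_lt ?_
    rw [lintegral_add_left (hw1.enorm.pow_const _),
      lintegral_prod _ (hw1.enorm.pow_const _).aemeasurable,
      lintegral_prod _ (hw2.enorm.pow_const _).aemeasurable]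
    have e1 : ∀ x, ∫⁻ q : H × H, ‖w q.1 x‖ₑ ^ (2 : ℝ) ∂(ν.prod ν) =
        (∫⁻ h, ‖w h x‖ₑ ^ (2 : ℝ) ∂ν) * ν Set.univ := fun x => by
      have hm : Measurable fun h => ‖w h x‖ₑ ^ (2 : ℝ) :=
        hws.comp (measurable_const.prodMk measurable_id)
      rw [lintegral_prod (fun q : H × H => ‖w q.1 x‖ₑ ^ (2 : ℝ))
        (hm.comp measurable_fst).aemeasurable]
      simp only [lintegral_const]
      rw [lintegral_mul_const _ hm]
    have e2 : ∀ x, ∫⁻ q : H × H, ‖w q.2 x‖ₑ ^ (2 : ℝ) ∂(ν.prod ν) =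
        (∫⁻ h, ‖w h x‖ₑ ^ (2 : ℝ) ∂ν) * ν Set.univ := fun x => by
      have hm : Measurable fun h => ‖w h x‖ₑ ^ (2 : ℝ) :=
        hws.comp (measurable_const.prodMk measurable_id)
      rw [lintegral_prod (fun q : H × H => ‖w q.2 x‖ₑ ^ (2 : ℝ))
        (hm.comp measurable_snd).aemeasurable]
      simp only [lintegral_const]
    simp only [e1, e2]
    rw [lintegral_mul_const _ hws.lintegral_prod_right']
    have := measure_lt_top ν Set.univ
    finiteness
  have hG : ∀ x, ∫ q, Z x q ∂(ν.prod ν) = (∫ h, w h x ∂ν) ^ 2 := fun x => by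
    rw [sq]
    exact integral_prod_mul (fun h => w h x) (fun h => w h x)
  have hGi : Integrable (fun x => (∫ h, w h x ∂ν) ^ 2) μ := by
    simpa only [Function.uncurry, hG] using hZi.integral_prod_left
  have e1 : ∀ x, ‖∫ h, w h x ∂ν‖ₑ ^ (2 : ℝ) = ENNReal.ofReal ((∫ h, w h x ∂ν) ^ 2) := fun x => by
    rw [← ofReal_norm, ENNReal.ofReal_rpow_of_nonneg (norm_nonneg _) zero_le_two,
      Real.norm_eq_abs]
    congr 1
    rw [Real.rpow_two, sq_abs]
  simp only [e1]
  rw [← ofReal_integral_eq_lintegral_ofReal hGi (Filter.Eventually.of_forall fun x => sq_nonneg _)]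
  simp only [← hG]
  rw [integral_integral_swap hZi]
  have hm : StronglyMeasurable fun q : H × H => ∫ x, Z x q ∂μ :=
    hZm.stronglyMeasurable.integral_prod_left'
  calc _ ≤ ‖∫ q, ∫ x, Z x q ∂μ ∂(ν.prod ν)‖ₑ := Real.ofReal_le_enorm _
    _ ≤ ∫⁻ q, ‖∫ x, Z x q ∂μ‖ₑ ∂(ν.prod ν) := enorm_integral_le_lintegral_enorm _
    _ = _ := lintegral_prod _ hm.enorm.aemeasurable

section SecondDifference

variable {u : ℝ → ℝ}

theorem memLp_increment (hu : StronglyMeasurable u) (he : energy u < ∞) (h : ℝ) :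
    MemLp (fun x => u (x + h) - u x) 2 volume := by
  refine ⟨((hu.comp_measurable (measurable_add_const h)).sub hu).aestronglyMeasurable, ?_⟩
  have := eLpNorm_increment (r := 2) two_pos u h
  rw [ENNReal.ofReal_ofNat] at this
  rw [this]
  exact incr_two_lt_top hu he h

theorem lintegral_increment_shift (u : ℝ → ℝ) (h c : ℝ) :
    ∫⁻ x, ‖u (x + c + h) - u (x + c)‖ₑ ^ (2 : ℝ) = incr 2 u h ^ (2 : ℝ) := by
  rw [incr_two_sq]
  exact lintegral_add_right_eq_self (fun x => ‖u (x + h) - u x‖ₑ ^ (2 : ℝ)) c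

/-- Summation by parts for second differences. -/
theorem enorm_integral_secondDiff_le (hu : StronglyMeasurable u) (he : energy u < ∞) (h l : ℝ) :
    ‖∫ x, (2 * u x - u (x + h) - u (x - h)) * (2 * u x - u (x + l) - u (x - l))‖ₑ ≤
      6 * incr 2 u h ^ (2 : ℝ) := by
  set d : ℝ → ℝ := fun x => u (x + h) - u x with hd
  set W : ℝ → ℝ := fun x => 2 * u x - u (x + l) - u (x - l) with hW
  have hdL : MemLp d 2 volume := memLp_increment hu he h
  have hshift : ∀ c, MemLp (fun x => d (x + c)) 2 volume := fun c =>
    hdL.comp_measurePreserving (measurePreserving_add_right volume c)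
  have hWL : MemLp W 2 volume := by
    have h1 := memLp_increment hu he l
    have h2 := h1.comp_measurePreserving (measurePreserving_add_right volume (-l))
    refine (h2.sub h1).ae_eq (Filter.Eventually.of_forall fun x => ?_)
    simp only [hW, Pi.sub_apply, Function.comp, neg_add_cancel_right]
    ring_nf
  have hWs : MemLp (fun x => W (x + h)) 2 volume :=
    hWL.comp_measurePreserving (measurePreserving_add_right volume h)
  have e1 : ∫ x, (2 * u x - u (x + h) - u (x - h)) * W x =
      ∫ x, (d (x + -h) * W x - d x * W x) := by
    congr 1; funext x
    simp only [hd, neg_add_cancel_right]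
    ring_nf
  -- Translation moves the outer difference of step `h` from `d` onto `W`.
  have e2 : ∫ x, d (x + -h) * W x = ∫ x, d x * W (x + h) := by
    rw [← integral_add_right_eq_self _ h]
    simp only [add_neg_cancel_right]
  have i1 : Integrable (fun x => d (x + -h) * W x) volume := (hshift _).integrable_mul hWL
  have i2 : Integrable (fun x => d x * W x) volume := hdL.integrable_mul hWL
  have i3 : Integrable (fun x => d x * W (x + h)) volume := hdL.integrable_mul hWs
  rw [e1, integral_sub i1 i2, e2, ← integral_sub i3 i2]
  refine (enorm_integral_le_lintegral_enorm _).trans ?_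
  have hm : ∀ c, Measurable fun x => ‖d (x + c)‖ₑ ^ (2 : ℝ) := fun c =>
    (((hu.comp_measurable (measurable_add_const h)).sub hu).comp_measurable
      (measurable_add_const c)).enorm.pow_const _
  have hpt : ∀ x, ‖d x * W (x + h) - d x * W x‖ₑ ≤ 4 * ‖d (x + 0)‖ₑ ^ (2 : ℝ) +
      ‖d (x + l)‖ₑ ^ (2 : ℝ) + ‖d (x + -l)‖ₑ ^ (2 : ℝ) := by
    intro x
    -- The increment of `W` of step `h` involves `u` only through `d` at `x` and `x ± l`. The bound
    -- is therefore free of `l`, and the weights `4 + 1 + 1` give the constant `6`.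
    have e : d x * W (x + h) - d x * W x =
        2 * (d x * d x) - d x * d (x + l) - d x * d (x + -l) := by
      simp only [hd, hW]
      ring_nf
    have hsq : ∀ c : ℝ≥0∞, c * c = c ^ (2 : ℝ) := fun c => by
      rw [show (2 : ℝ) = ((2 : ℕ) : ℝ) by norm_num, ENNReal.rpow_natCast, sq]
    have h1 := ENNReal.mul_le_rpow_two_add ‖d x‖ₑ ‖d (x + l)‖ₑ
    have h2 := ENNReal.mul_le_rpow_two_add ‖d x‖ₑ ‖d (x + -l)‖ₑ
    rw [e, add_zero]
    calc _ ≤ ‖2 * (d x * d x)‖ₑ + ‖d x * d (x + l)‖ₑ + ‖d x * d (x + -l)‖ₑ :=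
          enorm_sub_le.trans (add_le_add enorm_sub_le le_rfl)
      _ ≤ 2 * ‖d x‖ₑ ^ (2 : ℝ) + (‖d x‖ₑ ^ (2 : ℝ) + ‖d (x + l)‖ₑ ^ (2 : ℝ)) +
          (‖d x‖ₑ ^ (2 : ℝ) + ‖d (x + -l)‖ₑ ^ (2 : ℝ)) := by
          rw [enorm_mul, enorm_mul, enorm_mul, enorm_mul, hsq]
          have : ‖(2 : ℝ)‖ₑ = 2 := by
            rw [Real.enorm_eq_ofReal zero_le_two, ENNReal.ofReal_ofNat]
          rw [this]
          gcongr
      _ = _ := by ring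
  refine (lintegral_mono hpt).trans (le_of_eq ?_)
  rw [lintegral_add_right _ (hm _), lintegral_add_right _ (hm _), lintegral_const_mul _ (hm 0)]
  simp only [hd]
  rw [lintegral_increment_shift, lintegral_increment_shift, lintegral_increment_shift]
  ring

theorem lintegral_secondDiff_sq_le (hu : StronglyMeasurable u) (h : ℝ) :
    ∫⁻ x, ‖2 * u x - u (x + h) - u (x - h)‖ₑ ^ (2 : ℝ) ≤ 4 * incr 2 u h ^ (2 : ℝ) := by
  have hm : Measurable fun x => ‖u (x + -h + h) - u (x + -h)‖ₑ ^ (2 : ℝ) :=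
    (((hu.comp_measurable (measurable_add_const h)).sub hu).comp_measurable
      (measurable_add_const (-h))).enorm.pow_const _
  have hpt : ∀ x, ‖2 * u x - u (x + h) - u (x - h)‖ₑ ^ (2 : ℝ) ≤
      2 * ‖u (x + -h + h) - u (x + -h)‖ₑ ^ (2 : ℝ) + 2 * ‖u (x + h) - u x‖ₑ ^ (2 : ℝ) := by
    intro x
    have e : 2 * u x - u (x + h) - u (x - h) =
        (u (x + -h + h) - u (x + -h)) + -(u (x + h) - u x) := by
      rw [neg_add_cancel_right]; ring_nf
    rw [e]
    refine (enorm_add_rpow_two_le _ _).trans (le_of_eq ?_)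
    rw [enorm_neg]
  refine (lintegral_mono hpt).trans (le_of_eq ?_)
  rw [lintegral_add_left (hm.const_mul _), lintegral_const_mul' _ _ (by finiteness),
    lintegral_const_mul' _ _ (by finiteness), lintegral_increment_shift, ← incr_two_sq]
  ring

end SecondDifference

/-- Averaging over `h` and `-h` turns first differences into second differences, to which summation
by parts applies. -/
theorem IsTruncation.two_mul_incLap {S : Set ℝ} {a b : ℝ} (hS : IsTruncation S a b) {u : ℝ → ℝ}
    (hu : LocallyIntegrable u volume) (x : ℝ) :
    ∫ h, (2 * u x - u (x + h) - u (x - h)) ∂(truncKer S) = 2 * incLap (truncKer S) u x := by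
  have := hS.isFiniteMeasure
  have i1 : Integrable (fun h => u x - u (x + h)) (truncKer S) :=
    (integrable_const _).sub (hS.integrable_comp_add hu x)
  have hme : MeasurableEmbedding fun h : ℝ => -h := (Homeomorph.neg ℝ).measurableEmbedding
  have i2 : Integrable (fun h => u x - u (x + -h)) (truncKer S) :=
    (hS.map_neg.integrable_comp_emb hme).2 i1
  have e2 : ∫ h, (u x - u (x + -h)) ∂(truncKer S) = incLap (truncKer S) u x :=
    hS.map_neg.integral_comp hme fun h => u x - u (x + h)
  have e : ∀ h, 2 * u x - u (x + h) - u (x - h) = (u x - u (x + h)) + (u x - u (x + -h)) :=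
    fun h => by rw [← sub_eq_add_neg]; ring
  simp only [e]
  rw [integral_add i1 i2, e2, two_mul]
  rfl

/-- The `L²` norm of the truncated operator is controlled by the `Ḣ^{1/2}` norm. -/
theorem IsTruncation.lintegral_incLap_sq_le {S : Set ℝ} {a b : ℝ} (hS : IsTruncation S a b)
    {u : ℝ → ℝ} (hu : LocallyIntegrable u volume) (he : energy u < ∞) :
    ∫⁻ x, ‖incLap (truncKer S) u x‖ₑ ^ (2 : ℝ) ≤
      48 * ∫⁻ h in S, ENNReal.ofReal (|h| ^ (-2 : ℝ)) * incr 2 u h ^ (2 : ℝ) := by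
  wlog hum : StronglyMeasurable u generalizing u
  · have hm := hu.aestronglyMeasurable
    have := this (hu.congr hm.ae_eq_mk) (by rwa [← energy_congr_ae hm.ae_eq_mk])
      hm.stronglyMeasurable_mk
    simp only [← incr_congr_ae hm.ae_eq_mk] at this
    refine le_trans (le_of_eq (lintegral_congr_ae ?_)) this
    filter_upwards [incLap_congr_ae (truncKer_absolutelyContinuous S) hm.ae_eq_mk] with x hx
    rw [hx]
  have := hS.isFiniteMeasure
  have hinc := measurable_incr (r := 2) hum
  have hne : ∀ h ∈ S, 0 < |h| := fun h hh => hS.pos.trans_le (hS.lt_abs h hh)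
  set w : ℝ → ℝ → ℝ := fun h x => 2 * u x - u (x + h) - u (x - h) with hw
  have hwm : Measurable (Function.uncurry w) := by
    have := hum.measurable
    simp only [Function.uncurry_def, hw]
    fun_prop
  have hfin : ∫⁻ h, ∫⁻ x, ‖w h x‖ₑ ^ (2 : ℝ) ∂volume ∂(truncKer S) < ∞ := by
    refine (lintegral_mono fun h => lintegral_secondDiff_sq_le hum h).trans_lt ?_
    rw [truncKer, setLIntegral_quarterKer hS.measurableSet]
    have hb : ∀ h ∈ S, ENNReal.ofReal (|h| ^ (-(3 / 2) : ℝ)) * (4 * incr 2 u h ^ (2 : ℝ)) ≤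
        (4 * ENNReal.ofReal (b ^ (1 / 2 : ℝ))) *
          (ENNReal.ofReal (|h| ^ (-2 : ℝ)) * incr 2 u h ^ (2 : ℝ)) := by
      intro h hh
      have : ENNReal.ofReal (|h| ^ (-(3 / 2) : ℝ)) ≤
          ENNReal.ofReal (b ^ (1 / 2 : ℝ)) * ENNReal.ofReal (|h| ^ (-2 : ℝ)) := by
        have hb0 : 0 ≤ b := (abs_nonneg h).trans (hS.abs_lt h hh)
        rw [← ENNReal.ofReal_mul (by positivity)]
        refine ENNReal.ofReal_le_ofReal ?_
        rw [show (-(3 / 2) : ℝ) = 1 / 2 + -2 by norm_num, Real.rpow_add (hne h hh)]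
        gcongr
        exact hS.abs_lt h hh
      calc _ ≤ (ENNReal.ofReal (b ^ (1 / 2 : ℝ)) * ENNReal.ofReal (|h| ^ (-2 : ℝ))) *
            (4 * incr 2 u h ^ (2 : ℝ)) := by gcongr
        _ = _ := by ring
    refine (setLIntegral_mono' hS.measurableSet hb).trans_lt ?_
    refine (setLIntegral_le_lintegral _ _).trans_lt ?_
    rw [lintegral_const_mul' _ _ (by finiteness)]
    refine ENNReal.mul_lt_top (by finiteness) ?_
    rwa [lintegral_incr_sq]
  -- Almost orthogonality: the pair `(h, l)` is charged to the smaller of the two steps. Integrating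
  -- out the larger one yields `6 · 4 |h|^(-1/2)`, which together with `|h|^(-3/2)` is `24
  -- |h|^(-2)`. The two orderings of `|h|` and `|l|` give `48`.
  set A : ℝ → ℝ → ℝ≥0∞ := fun h l =>
    {q : ℝ × ℝ | |q.1| ≤ |q.2|}.indicator (fun q => 6 * incr 2 u q.1 ^ (2 : ℝ)) (h, l) with hA
  have hAm : Measurable (Function.uncurry A) := by
    have h1 : MeasurableSet {q : ℝ × ℝ | |q.1| ≤ |q.2|} :=
      measurableSet_le (by fun_prop) (by fun_prop)
    have h2 : Measurable fun q : ℝ × ℝ => 6 * incr 2 u q.1 ^ (2 : ℝ) := by fun_prop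
    exact h2.indicator h1
  have hle : ∀ h l, ‖∫ x, w h x * w l x‖ₑ ≤ A h l + A l h := by
    intro h l
    rcases le_total |h| |l| with h1 | h1
    · refine le_trans ?_ le_self_add
      simp only [hA]
      rw [Set.indicator_of_mem (by exact h1)]
      exact enorm_integral_secondDiff_le hum he h l
    · refine le_trans ?_ le_add_self
      simp only [hA]
      rw [Set.indicator_of_mem (by exact h1)]
      simp only [mul_comm (w h _)]
      exact enorm_integral_secondDiff_le hum he l h
  have hAl : ∀ h ∈ S, ∫⁻ l, A h l ∂(truncKer S) ≤
      24 * (ENNReal.ofReal (|h| ^ (-(1 / 2) : ℝ)) * incr 2 u h ^ (2 : ℝ)) := by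
    intro h hh
    have hms : MeasurableSet {l : ℝ | |h| ≤ |l|} := measurableSet_le (by fun_prop) (by fun_prop)
    have e : ∀ l, A h l = {l : ℝ | |h| ≤ |l|}.indicator
        (fun _ => 6 * incr 2 u h ^ (2 : ℝ)) l := fun l => by
      simp only [hA, Set.indicator, Set.mem_ofPred_eq]
    simp only [e]
    rw [lintegral_indicator_const hms]
    calc _ ≤ 6 * incr 2 u h ^ (2 : ℝ) * ENNReal.ofReal (4 * |h| ^ (-(1 / 2) : ℝ)) := by
          gcongr
          exact (Measure.restrict_le_self _).trans (quarterKer_tail_le (hne h hh))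
      _ = _ := by
          rw [ENNReal.ofReal_mul (by norm_num), ENNReal.ofReal_ofNat]
          ring
  have hswap : ∫⁻ h, ∫⁻ l, A l h ∂(truncKer S) ∂(truncKer S) =
      ∫⁻ h, ∫⁻ l, A h l ∂(truncKer S) ∂(truncKer S) :=
    lintegral_lintegral_swap (hAm.comp measurable_swap).aemeasurable
  have hA1 : ∫⁻ h, ∫⁻ l, A h l ∂(truncKer S) ∂(truncKer S) ≤
      24 * ∫⁻ h in S, ENNReal.ofReal (|h| ^ (-2 : ℝ)) * incr 2 u h ^ (2 : ℝ) := by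
    have e : ∫⁻ h, ∫⁻ l, A h l ∂(truncKer S) ∂(truncKer S) =
        ∫⁻ h in S, ENNReal.ofReal (|h| ^ (-(3 / 2) : ℝ)) * ∫⁻ l, A h l ∂(truncKer S) :=
      setLIntegral_quarterKer hS.measurableSet _
    rw [e, ← lintegral_const_mul' _ _ (by finiteness)]
    refine setLIntegral_mono' hS.measurableSet fun h hh => ?_
    calc _ ≤ ENNReal.ofReal (|h| ^ (-(3 / 2) : ℝ)) *
          (24 * (ENNReal.ofReal (|h| ^ (-(1 / 2) : ℝ)) * incr 2 u h ^ (2 : ℝ))) := by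
          gcongr
          exact hAl h hh
      _ = 24 * ((ENNReal.ofReal (|h| ^ (-(3 / 2) : ℝ)) * ENNReal.ofReal (|h| ^ (-(1 / 2) : ℝ))) *
          incr 2 u h ^ (2 : ℝ)) := by ring
      _ = _ := by
          rw [← ENNReal.ofReal_mul (by positivity), ← Real.rpow_add (hne h hh)]
          norm_num
  calc ∫⁻ x, ‖incLap (truncKer S) u x‖ₑ ^ (2 : ℝ)
      ≤ ∫⁻ x, ‖∫ h, w h x ∂(truncKer S)‖ₑ ^ (2 : ℝ) := by
        gcongr with x
        simp only [hw]
        rw [hS.two_mul_incLap hu, ← ofReal_norm, ← ofReal_norm]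
        refine ENNReal.ofReal_le_ofReal ?_
        rw [norm_mul, Real.norm_ofNat]
        linarith [norm_nonneg (incLap (truncKer S) u x)]
    _ ≤ ∫⁻ h, ∫⁻ l, ‖∫ x, w h x * w l x‖ₑ ∂(truncKer S) ∂(truncKer S) :=
        lintegral_sq_integral_le hwm hfin
    _ ≤ ∫⁻ h, ∫⁻ l, (A h l + A l h) ∂(truncKer S) ∂(truncKer S) :=
        lintegral_mono fun h => lintegral_mono fun l => hle h l
    _ = (∫⁻ h, ∫⁻ l, A h l ∂(truncKer S) ∂(truncKer S)) +
          ∫⁻ h, ∫⁻ l, A l h ∂(truncKer S) ∂(truncKer S) := by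
        have hm : Measurable fun h => ∫⁻ l, A h l ∂(truncKer S) := hAm.lintegral_prod_right'
        rw [← lintegral_add_left hm]
        refine lintegral_congr fun h => ?_
        exact lintegral_add_left (hAm.comp (measurable_const.prodMk measurable_id)) _
    _ ≤ _ := by
        rw [hswap]
        refine (add_le_add hA1 hA1).trans (le_of_eq ?_)
        ring

/-! ### Exhausting the increments -/

/-- The increments of size between `1/(N+1)` and `N+1`. -/
def truncSet (N : ℕ) : Set ℝ := {h | 1 / ((N : ℝ) + 1) ≤ |h| ∧ |h| ≤ N + 1}

theorem measurableSet_truncSet (N : ℕ) : MeasurableSet (truncSet N) :=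
  have h1 : MeasurableSet {h : ℝ | 1 / ((N : ℝ) + 1) ≤ |h|} :=
    measurableSet_le (by fun_prop) (by fun_prop)
  have h2 : MeasurableSet {h : ℝ | |h| ≤ (N : ℝ) + 1} :=
    measurableSet_le (by fun_prop) (by fun_prop)
  h1.inter h2

theorem isTruncation_truncSet (N : ℕ) :
    IsTruncation (truncSet N) (1 / ((N : ℝ) + 1)) (N + 1) where
  measurableSet := measurableSet_truncSet N
  symm h hh := by simpa only [truncSet, Set.mem_ofPred_eq, abs_neg] using hh
  pos := by positivity
  lt_abs h hh := hh.1
  abs_lt h hh := hh.2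

theorem monotone_truncSet : Monotone truncSet := by
  intro N M hNM h hh
  have hc : (N : ℝ) ≤ M := Nat.cast_le.2 hNM
  refine ⟨le_trans ?_ hh.1, hh.2.trans (by linarith)⟩
  exact one_div_le_one_div_of_le (by positivity) (by linarith)

theorem iUnion_truncSet : ⋃ N, truncSet N = {0}ᶜ := by
  ext h
  simp only [Set.mem_iUnion, Set.mem_compl_iff, Set.mem_singleton_iff]
  constructor
  · rintro ⟨N, hN, -⟩ rfl
    have : (0 : ℝ) < 1 / ((N : ℝ) + 1) := by positivity
    rw [abs_zero] at hN
    linarith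
  · intro h0
    have hp : 0 < |h| := abs_pos.2 h0
    obtain ⟨N, hN⟩ := exists_nat_ge (max |h| |h|⁻¹)
    refine ⟨N, ?_, ?_⟩
    · rw [one_div]
      refine inv_le_of_inv_le₀ hp ?_
      linarith [le_max_right |h| |h|⁻¹]
    · linarith [le_max_left |h| |h|⁻¹]

/-- The truncations of `Λ`. -/
def truncLap (N : ℕ) : (ℝ → ℝ) → ℝ → ℝ := incLap (truncKer (truncSet N))

/-- The energy is the total mass of a finite measure in `h`, and the complements of the truncations
decrease to the null set `{0}`. -/
theorem tendsto_energy_tail {u : ℝ → ℝ}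
    (he : energy u < ∞) : Filter.Tendsto (fun N : ℕ => ∫⁻ h in (truncSet N)ᶜ,
      ENNReal.ofReal (|h| ^ (-2 : ℝ)) * incr 2 u h ^ (2 : ℝ)) Filter.atTop (nhds 0) := by
  set ρ : Measure ℝ := volume.withDensity fun h : ℝ =>
    ENNReal.ofReal (|h| ^ (-2 : ℝ)) * incr 2 u h ^ (2 : ℝ) with hρ
  have hfin : ρ Set.univ < ∞ := by
    rw [hρ, withDensity_apply _ MeasurableSet.univ, setLIntegral_univ]
    rwa [lintegral_incr_sq]
  have h1 := tendsto_measure_iInter_atTop (μ := ρ) (s := fun N => (truncSet N)ᶜ)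
    (fun N => (measurableSet_truncSet N).compl.nullMeasurableSet)
    (fun N M hNM => Set.compl_subset_compl.2 (monotone_truncSet hNM))
    ⟨0, ((measure_mono (Set.subset_univ _)).trans_lt hfin).ne⟩
  have h0 : ρ (⋂ N, (truncSet N)ᶜ) = 0 := by
    rw [← Set.compl_iUnion, iUnion_truncSet, compl_compl]
    exact withDensity_absolutelyContinuous _ _ (by simp)
  rw [h0] at h1
  refine h1.congr fun N => ?_
  exact withDensity_apply _ (measurableSet_truncSet N).compl

theorem eLpNorm_two_le_of_sq {f : ℝ → ℝ} {B : ℝ≥0∞} (h : ∫⁻ x, ‖f x‖ₑ ^ (2 : ℝ) ≤ B) :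
    eLpNorm f 2 volume ≤ B ^ (1 / 2 : ℝ) := by
  rw [eLpNorm_eq_lintegral_rpow_enorm_toReal two_ne_zero ENNReal.ofNat_ne_top]
  simp only [ENNReal.toReal_ofNat]
  gcongr

theorem truncLap_sub {u : ℝ → ℝ} (hu : LocallyIntegrable u volume) {N M : ℕ} (h : N ≤ M) (x : ℝ) :
    truncLap M u x - truncLap N u x = incLap (truncKer (truncSet M \ truncSet N)) u x := by
  have := (isTruncation_truncSet M).isFiniteMeasure
  have i1 : Integrable (fun h => u x - u (x + h)) (truncKer (truncSet M)) :=
    (integrable_const _).sub ((isTruncation_truncSet M).integrable_comp_add hu x)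
  unfold truncLap incLap truncKer
  rw [setIntegral_sdiff (measurableSet_truncSet N) i1 (monotone_truncSet h)]

theorem isTruncation_sdiff {N M : ℕ} :
    IsTruncation (truncSet M \ truncSet N) (1 / ((M : ℝ) + 1)) (M + 1) where
  measurableSet := (measurableSet_truncSet M).diff (measurableSet_truncSet N)
  symm h hh := ⟨(isTruncation_truncSet M).symm h hh.1, fun hc => hh.2 (by
    simpa using (isTruncation_truncSet N).symm _ hc)⟩
  pos := by positivity
  lt_abs h hh := hh.1.1
  abs_lt h hh := hh.1.2

theorem memLp_truncLap {u : ℝ → ℝ} (hu : LocallyIntegrable u volume) (he : energy u < ∞) (N : ℕ) :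
    MemLp (truncLap N u) 2 volume := by
  refine ⟨aestronglyMeasurable_incLap (truncKer_absolutelyContinuous _) hu.aestronglyMeasurable, ?_⟩
  refine (eLpNorm_two_le_of_sq
    ((isTruncation_truncSet N).lintegral_incLap_sq_le hu he)).trans_lt ?_
  have : ∫⁻ h in truncSet N, ENNReal.ofReal (|h| ^ (-2 : ℝ)) * incr 2 u h ^ (2 : ℝ) < ∞ := by
    refine (setLIntegral_le_lintegral _ _).trans_lt ?_
    rwa [lintegral_incr_sq]
  finiteness

/-- The truncations of `Λ u` converge in `L²` when `u ∈ Ḣ^{1/2}`. -/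
theorem exists_tendsto_truncLap {u : ℝ → ℝ} (hu : LocallyIntegrable u volume)
    (he : energy u < ∞) : ∃ g : ℝ → ℝ, MemLp g 2 volume ∧
      Filter.Tendsto (fun N => eLpNorm (truncLap N u - g) 2 volume) Filter.atTop (nhds 0) := by
  set T : ℕ → ℝ≥0∞ := fun N => (48 * ∫⁻ h in (truncSet N)ᶜ,
      ENNReal.ofReal (|h| ^ (-2 : ℝ)) * incr 2 u h ^ (2 : ℝ)) ^ (1 / 2 : ℝ) with hT
  have hT0 : Filter.Tendsto T Filter.atTop (nhds 0) := by
    have h1 := ENNReal.Tendsto.const_mul (a := 48)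
      (tendsto_energy_tail he) (Or.inr (by finiteness))
    have h2 := (ENNReal.continuous_rpow_const (y := 1 / 2)).tendsto _ |>.comp h1
    simpa [Function.comp_def, hT] using h2
  -- The difference of two truncations is again a truncated operator, over steps outside `truncSet
  -- N`. The `L²` bound thus makes the sequence Cauchy.
  have hdiff : ∀ N M, N ≤ M → eLpNorm (truncLap M u - truncLap N u) 2 volume ≤ T N := by
    intro N M hNM
    have e : truncLap M u - truncLap N u = incLap (truncKer (truncSet M \ truncSet N)) u :=
      funext fun x => truncLap_sub hu hNM x
    rw [e]
    refine eLpNorm_two_le_of_sq ((isTruncation_sdiff.lintegral_incLap_sq_le hu he).trans ?_)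
    gcongr
    exact Set.sdiff_subset_compl _ _
  set F : ℕ → Lp ℝ 2 (volume : Measure ℝ) := fun N => (memLp_truncLap hu he N).toLp _ with hF
  have hF1 : ∀ N M, N ≤ M → edist (F M) (F N) ≤ T N := fun N M hNM => by
    rw [hF, Lp.edist_toLp_toLp]
    exact hdiff N M hNM
  have hcauchy : CauchySeq F := by
    rw [EMetric.cauchySeq_iff']
    intro ε hε
    obtain ⟨N, hN⟩ := (hT0.eventually (gt_mem_nhds hε)).exists
    exact ⟨N, fun n hn => (hF1 N n hn).trans_lt hN⟩
  obtain ⟨G, hG⟩ := cauchySeq_tendsto_of_complete hcauchy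
  refine ⟨G, Lp.memLp G, ?_⟩
  have h3 := tendsto_iff_edist_tendsto_0.1 hG
  refine h3.congr fun N => ?_
  rw [Lp.edist_def]
  refine eLpNorm_congr_ae ?_
  filter_upwards [(memLp_truncLap hu he N).coeFn_toLp] with x hx
  simp only [Pi.sub_apply, hF, hx]

/-! ### Decay of `Λ ψ` -/

/-- The integral of `min(|h|, 1)` against the kernel of `Λ`. -/
def kerMass : ℝ≥0∞ := ∫⁻ h, ENNReal.ofReal (min |h| 1) ∂quarterKer

theorem lintegral_of_even {f : ℝ → ℝ≥0∞} (hf : ∀ x, f (-x) = f x) :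
    ∫⁻ x, f x = 2 * ∫⁻ x in Set.Ioi 0, f x := by
  have h1 : ∫⁻ x in Set.Iic (0 : ℝ), f x = ∫⁻ x in Set.Ioi 0, f x := by
    rw [setLIntegral_congr Iio_ae_eq_Iic.symm, ← lintegral_indicator measurableSet_Iio,
      ← lintegral_indicator measurableSet_Ioi, ← lintegral_neg_eq_self]
    refine lintegral_congr fun x => ?_
    by_cases hx : 0 < x
    · rw [Set.indicator_of_mem (by simpa using hx),
        Set.indicator_of_mem (show x ∈ Set.Ioi (0 : ℝ) from hx), hf]
    · rw [Set.indicator_of_notMem (by simpa using hx), Set.indicator_of_notMem (by simpa using hx)]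
  rw [← lintegral_add_compl f measurableSet_Iic, Set.compl_Iic, h1, two_mul]

theorem kerMass_lt_top : kerMass < ∞ := by
  unfold kerMass
  rw [lintegral_quarterKer, lintegral_of_even (fun x => by simp only [abs_neg])]
  refine ENNReal.mul_lt_top (by finiteness) ?_
  rw [← Set.Ioc_union_Ioi_eq_Ioi (zero_le_one' ℝ)]
  refine (lintegral_union_le _ _ _).trans_lt (ENNReal.add_lt_top.2 ⟨?_, ?_⟩)
  · have h1 : IntegrableOn (fun x : ℝ => x ^ (-(1 / 2) : ℝ)) (Set.Ioc 0 1) volume := by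
      have := intervalIntegral.intervalIntegrable_rpow' (a := 0) (b := 1) (r := -(1 / 2))
        (by norm_num)
      rwa [intervalIntegrable_iff_integrableOn_Ioc_of_le zero_le_one] at this
    refine lt_of_le_of_lt (setLIntegral_mono' measurableSet_Ioc fun x hx => ?_) h1.2
    rw [abs_of_pos hx.1, ← ENNReal.ofReal_mul (Real.rpow_nonneg hx.1.le _), ← ofReal_norm,
      Real.norm_of_nonneg (Real.rpow_nonneg hx.1.le _), min_eq_left hx.2]
    refine ENNReal.ofReal_le_ofReal (le_of_eq ?_)
    nth_rewrite 2 [← Real.rpow_one x]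
    rw [← Real.rpow_add hx.1]
    norm_num
  · have h1 := integrableOn_Ioi_rpow_of_lt (a := -(3 / 2)) (by norm_num) (zero_lt_one' ℝ)
    refine lt_of_le_of_lt (setLIntegral_mono' measurableSet_Ioi fun x hx => ?_) h1.2
    have hx0 : 0 < x := zero_lt_one.trans hx
    rw [abs_of_pos hx0, ← ENNReal.ofReal_mul (Real.rpow_nonneg hx0.le _), ← ofReal_norm,
      Real.norm_of_nonneg (Real.rpow_nonneg hx0.le _), min_eq_right (le_of_lt hx), mul_one]

theorem BoundedLip.lintegral_increment_le {R L M : ℝ} {ψ : ℝ → ℝ} (h : BoundedLip R L M ψ)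
    (x : ℝ) : ∫⁻ t, ‖ψ x - ψ (x + t)‖ₑ ∂quarterKer ≤ ENNReal.ofReal (L + 2 * M) * kerMass := by
  unfold kerMass
  rw [← lintegral_const_mul' _ _ ENNReal.ofReal_ne_top]
  refine lintegral_mono fun t => ?_
  have hL := h.lip_nonneg
  have hM := h.bound_nonneg
  rw [← ofReal_norm, ← ENNReal.ofReal_mul (by positivity)]
  refine ENNReal.ofReal_le_ofReal ?_
  have h1 := h.lip x (x + t)
  rw [sub_add_cancel_left, abs_neg] at h1
  have h2 := (norm_sub_le (ψ x) (ψ (x + t))).trans (add_le_add (h.norm_le _) (h.norm_le _))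
  have := abs_nonneg t
  rcases le_total |t| 1 with ht | ht
  · rw [min_eq_left ht]; nlinarith
  · rw [min_eq_right ht]; linarith

/-- At distance more than `2R`, `u x` vanishes and only steps with `|x + t| ≤ R` contribute; these
have `|t| ≥ |x| / 2`. -/
theorem lintegral_increment_far_le {R x : ℝ} {u : ℝ → ℝ} (hu : ∀ y, R < |y| → u y = 0)
    (hx : 2 * R < |x|) (hx0 : 0 < |x|) : ∫⁻ t, ‖u x - u (x + t)‖ₑ ∂quarterKer ≤
      ENNReal.ofReal ((|x| / 2) ^ (-(3 / 2) : ℝ)) * ∫⁻ y, ‖u y‖ₑ := by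
  rw [lintegral_quarterKer, ← lintegral_add_left_eq_self (fun y => ‖u y‖ₑ) x,
    ← lintegral_const_mul' _ _ ENNReal.ofReal_ne_top]
  refine lintegral_mono fun t => ?_
  rw [hu x (by rcases le_total 0 R with h | h <;> linarith), zero_sub, enorm_neg]
  by_cases hy : R < |x + t|
  · simp [hu _ hy]
  · refine mul_le_mul_left (ENNReal.ofReal_le_ofReal ?_) _
    refine Real.rpow_le_rpow_of_nonpos (z := -(3 / 2)) (by positivity) ?_ (by norm_num)
    have := abs_sub (x + t) t
    rw [add_sub_cancel_right] at this
    linarith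

/-- On `|x| ≤ 2R` the integral is bounded and `(1 + 2R)^(3/2)` compensates the weight. Beyond that,
the far estimate applies together with `|x| / 2 ≥ (1 + |x|) / 4`. The bound dominates `Λ ψ` and all
its truncations at once. -/
theorem BoundedLip.exists_lintegral_le {R L M : ℝ} {ψ : ℝ → ℝ} (h : BoundedLip R L M ψ) :
    ∃ C : ℝ, 0 ≤ C ∧ ∀ x, ∫⁻ t, ‖ψ x - ψ (x + t)‖ₑ ∂quarterKer ≤
      ENNReal.ofReal (C * (1 + |x|) ^ (-(3 / 2) : ℝ)) := by
  have hR := h.one_le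
  have hint : ∫⁻ y, ‖ψ y‖ₑ < ∞ :=
    (h.continuous.integrable_of_hasCompactSupport h.hasCompactSupport).2
  set I := (∫⁻ y, ‖ψ y‖ₑ).toReal with hI
  set K := (ENNReal.ofReal (L + 2 * M) * kerMass).toReal with hK
  have hKt : ENNReal.ofReal (L + 2 * M) * kerMass ≠ ∞ := by
    have := kerMass_lt_top
    finiteness
  refine ⟨K * (1 + 2 * R) ^ (3 / 2 : ℝ) + (1 / 4) ^ (-(3 / 2) : ℝ) * I, by positivity,
    fun x => ?_⟩
  rw [add_mul]
  by_cases hx : |x| ≤ 2 * R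
  · refine (h.lintegral_increment_le x).trans ?_
    rw [← ENNReal.ofReal_toReal hKt]
    refine ENNReal.ofReal_le_ofReal ?_
    refine le_add_of_le_of_nonneg ?_ (by positivity)
    rw [mul_assoc]
    refine le_mul_of_one_le_right (by positivity) ?_
    rw [Real.rpow_neg (by positivity), ← div_eq_mul_inv, ← Real.div_rpow (by positivity)
      (by positivity)]
    exact Real.one_le_rpow ((one_le_div (by positivity)).2 (by linarith)) (by norm_num)
  · rw [not_le] at hx
    have hx0 : 0 < |x| := by linarith
    refine (lintegral_increment_far_le h.eq_zero hx hx0).trans ?_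
    rw [← ENNReal.ofReal_toReal hint.ne, ← ENNReal.ofReal_mul (by positivity)]
    refine ENNReal.ofReal_le_ofReal ?_
    refine le_add_of_nonneg_of_le (by positivity) ?_
    rw [mul_right_comm, ← Real.mul_rpow (by norm_num) (by positivity)]
    refine mul_le_mul_of_nonneg_right ?_ (by positivity)
    exact Real.rpow_le_rpow_of_nonpos (by positivity) (by linarith) (by norm_num)

theorem enorm_incLap_le (ν : Measure ℝ) (u : ℝ → ℝ) (x : ℝ) :
    ‖incLap ν u x‖ₑ ≤ ∫⁻ t, ‖u x - u (x + t)‖ₑ ∂ν := enorm_integral_le_lintegral_enorm _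

theorem enorm_truncLap_le (N : ℕ) (u : ℝ → ℝ) (x : ℝ) :
    ‖truncLap N u x‖ₑ ≤ ∫⁻ t, ‖u x - u (x + t)‖ₑ ∂quarterKer :=
  (enorm_incLap_le _ u x).trans (lintegral_mono' Measure.restrict_le_self le_rfl)

theorem quarterKer_zero : quarterKer {0} = 0 := quarterKer_absolutelyContinuous (by simp)

theorem tendsto_integral_truncKer {E : Type*} [NormedAddCommGroup E] [NormedSpace ℝ E]
    {f : ℝ → E} (hf : Integrable f quarterKer) :
    Filter.Tendsto (fun N => ∫ h, f h ∂(truncKer (truncSet N))) Filter.atTop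
      (nhds (∫ h, f h ∂quarterKer)) := by
  have := tendsto_setIntegral_of_monotone (μ := quarterKer) (f := f) measurableSet_truncSet
    monotone_truncSet (by rw [iUnion_truncSet]; exact hf.integrableOn)
  rw [iUnion_truncSet] at this
  have e : ∫ h in ({0}ᶜ : Set ℝ), f h ∂quarterKer = ∫ h, f h ∂quarterKer := by
    rw [← setIntegral_univ (μ := quarterKer)]
    exact setIntegral_congr_set (ae_eq_univ.2 (by rw [compl_compl]; exact quarterKer_zero))
  rwa [e] at this

theorem tendsto_truncLap_of_lintegral_lt_top {u : ℝ → ℝ} (hu : AEStronglyMeasurable u volume)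
    {x : ℝ} (hx : ∫⁻ t, ‖u x - u (x + t)‖ₑ ∂quarterKer < ∞) :
    Filter.Tendsto (fun N => truncLap N u x) Filter.atTop (nhds (incLap quarterKer u x)) := by
  refine tendsto_integral_truncKer ⟨?_, hx⟩
  have h1 : AEStronglyMeasurable (fun t => u (x + t)) volume :=
    hu.comp_measurePreserving (measurePreserving_add_left volume x)
  exact (aestronglyMeasurable_const.sub h1).mono_ac quarterKer_absolutelyContinuous

/-! ### Pairings with the truncated operators -/

/-- Pairings of a function of moderate growth with `Λ ψ`, for a test function `ψ`. -/
theorem BoundedLip.tendsto_integral_mul_truncLap {R L M : ℝ} {ψ a : ℝ → ℝ}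
    (h : BoundedLip R L M ψ) (ha : AEStronglyMeasurable a volume)
    (hw : ∫⁻ x, ENNReal.ofReal ((1 + |x|) ^ (-(3 / 2) : ℝ)) * ‖a x‖ₑ < ∞) :
    Integrable (fun x => a x * quarterLapTest ψ x) volume ∧
    (∀ N, Integrable (fun x => a x * truncLap N ψ x) volume) ∧
    Filter.Tendsto (fun N => ∫ x, a x * truncLap N ψ x) Filter.atTop
      (nhds (∫ x, a x * quarterLapTest ψ x)) := by
  obtain ⟨C, hC0, hC⟩ := h.exists_lintegral_le
  have hlim : ∀ x, Filter.Tendsto (fun N => truncLap N ψ x) Filter.atTop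
      (nhds (quarterLapTest ψ x)) := fun x => by
    rw [quarterLapTest_eq_incLap]
    exact tendsto_truncLap_of_lintegral_lt_top h.continuous.aestronglyMeasurable
      ((hC x).trans_lt ENNReal.ofReal_lt_top)
  have hgi : Integrable (fun x => a x * (C * (1 + |x|) ^ (-(3 / 2) : ℝ))) volume := by
    have hwm : Measurable fun x : ℝ => C * (1 + |x|) ^ (-(3 / 2) : ℝ) := by fun_prop
    refine ⟨ha.mul hwm.aestronglyMeasurable, ?_⟩
    rw [HasFiniteIntegral]
    have e : ∀ x : ℝ, ‖a x * (C * (1 + |x|) ^ (-(3 / 2) : ℝ))‖ₑ =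
        ENNReal.ofReal C * (ENNReal.ofReal ((1 + |x|) ^ (-(3 / 2) : ℝ)) * ‖a x‖ₑ) := fun x => by
      rw [enorm_mul, enorm_mul, Real.enorm_eq_ofReal hC0,
        Real.enorm_eq_ofReal (r := (1 + |x|) ^ _) (by positivity)]
      ring
    simp only [e]
    rw [lintegral_const_mul' _ _ ENNReal.ofReal_ne_top]
    finiteness
  have hb : ∀ x, ∀ r : ℝ, ‖r‖ₑ ≤ ∫⁻ t, ‖ψ x - ψ (x + t)‖ₑ ∂quarterKer →
      ‖a x * r‖ ≤ ‖a x * (C * (1 + |x|) ^ (-(3 / 2) : ℝ))‖ := fun x r hr => by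
    rw [norm_mul, norm_mul]
    gcongr
    have := hr.trans (hC x)
    rw [← ofReal_norm] at this
    rw [Real.norm_of_nonneg (r := C * _) (by positivity)]
    exact (ENNReal.ofReal_le_ofReal_iff (by positivity)).1 this
  have hm : ∀ N, AEStronglyMeasurable (fun x => a x * truncLap N ψ x) volume := fun N =>
    ha.mul (aestronglyMeasurable_incLap (truncKer_absolutelyContinuous _)
      h.continuous.aestronglyMeasurable)
  refine ⟨?_, fun N => ?_, ?_⟩
  · refine hgi.mono (ha.mul ?_) (Filter.Eventually.of_forall fun x => hb x _ ?_)
    · rw [funext (quarterLapTest_eq_incLap ψ)]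
      exact aestronglyMeasurable_incLap quarterKer_absolutelyContinuous
        h.continuous.aestronglyMeasurable
    · rw [quarterLapTest_eq_incLap]
      exact enorm_incLap_le _ _ _
  · exact hgi.mono (hm N) (Filter.Eventually.of_forall fun x => hb x _ (enorm_truncLap_le _ _ _))
  · refine tendsto_integral_of_dominated_convergence _ hm hgi.norm (fun N =>
      Filter.Eventually.of_forall fun x => hb x _ (enorm_truncLap_le _ _ _))
      (Filter.Eventually.of_forall fun x => (hlim x).const_mul _)

theorem tendsto_integral_mul_of_tendsto_eLpNorm {a g : ℝ → ℝ} {f : ℕ → ℝ → ℝ}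
    (ha : MemLp a 2 volume) (hf : ∀ N, MemLp (f N) 2 volume) (hg : MemLp g 2 volume)
    (h : Filter.Tendsto (fun N => eLpNorm (f N - g) 2 volume) Filter.atTop (nhds 0)) :
    Filter.Tendsto (fun N => ∫ x, a x * f N x) Filter.atTop (nhds (∫ x, a x * g x)) := by
  have h1 : Filter.Tendsto (fun N => (hf N).toLp (f N)) Filter.atTop (nhds (hg.toLp g)) := by
    rw [tendsto_iff_edist_tendsto_0]
    simpa only [Lp.edist_toLp_toLp] using h
  have e : ∀ f (hf : MemLp f 2 (volume : Measure ℝ)),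
      inner ℝ (ha.toLp a) (hf.toLp f) = ∫ x, a x * f x := fun f hf => by
    rw [L2.inner_def]
    refine integral_congr_ae ?_
    filter_upwards [ha.coeFn_toLp, hf.coeFn_toLp] with x hx hx'
    rw [hx, hx']
    simp [mul_comm]
  have := (tendsto_const_nhds (x := ha.toLp a)).inner (𝕜 := ℝ) h1
  simpa only [e] using this

/-! ### `Λ u` is a function for `u ∈ Ḣ^{1/2}` -/

theorem ae_truncKer_mem {S : Set ℝ} (hS : MeasurableSet S) :
    ∀ᵐ q ∂((volume : Measure ℝ).prod (truncKer S)), q.2 ∈ S :=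
  Measure.quasiMeasurePreserving_snd.ae (ae_restrict_mem hS)

/-- The map `(x, h) ↦ (x + h, -h)` preserves the product measure and exchanges the cross terms `u x
* φ (x + h)` and `φ x * u (x + h)`; the diagonal terms agree already. -/
theorem IsTruncation.integral_mul_incLap_comm {S : Set ℝ} {a b : ℝ} (hS : IsTruncation S a b)
    {R L M : ℝ} {φ u : ℝ → ℝ} (hφ : BoundedLip R L M φ) (hu : LocallyIntegrable u volume) :
    ∫ x, u x * incLap (truncKer S) φ x = ∫ x, φ x * incLap (truncKer S) u x := by
  have hfinS := hS.isFiniteMeasure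
  set π := (volume : Measure ℝ).prod (truncKer S) with hπ
  have hT : MeasurePreserving (fun q : ℝ × ℝ => (q.1 + q.2, q.2)) π π :=
    measurePreserving_add_prod volume (truncKer S)
  have hneg : MeasurePreserving (fun q : ℝ × ℝ => (q.1, -q.2)) π π :=
    (MeasurePreserving.id volume).prod hS.map_neg
  have hσ : MeasurePreserving (fun q : ℝ × ℝ => (q.1 + q.2, -q.2)) π π := hneg.comp hT
  have hφu : Integrable (fun x => φ x * u x) volume :=
    hu.integrable_smul_left_of_hasCompactSupport hφ.continuous hφ.hasCompactSupport
  have i1 : Integrable (fun q : ℝ × ℝ => φ q.1 * u q.1) π := hφu.comp_fst _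
  -- Since `φ` lives on `[-R, R]` and `|h| ≤ b`, only these values of `u` matter, and there `u` is
  -- integrable.
  set U : ℝ → ℝ := (Set.Icc (-(R + b)) (R + b)).indicator u with hU
  have hUi : Integrable U volume :=
    (hu.integrableOn_isCompact isCompact_Icc).integrable_indicator measurableSet_Icc
  have hUi2 : Integrable (fun q : ℝ × ℝ => U (q.1 + q.2)) π :=
    (hT.integrable_comp (hUi.comp_fst _).aestronglyMeasurable).2 (hUi.comp_fst (truncKer S))
  have i2 : Integrable (fun q : ℝ × ℝ => φ q.1 * u (q.1 + q.2)) π := by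
    refine (hUi2.bdd_mul (f := fun q => φ q.1) (c := M)
      (hφ.continuous.comp continuous_fst).aestronglyMeasurable
      (Filter.Eventually.of_forall fun q => hφ.norm_le _)).congr ?_
    filter_upwards [ae_truncKer_mem hS.measurableSet] with q hq
    by_cases h1 : R < |q.1|
    · simp [hφ.eq_zero _ h1]
    · rw [hU, Set.indicator_of_mem]
      have := hS.abs_lt _ hq
      exact Set.mem_Icc.2 (_root_.abs_le.1 ((abs_add_le q.1 q.2).trans (by linarith)))
  have i3 : Integrable (fun q : ℝ × ℝ => u q.1 * φ (q.1 + q.2)) π := by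
    refine ((hσ.integrable_comp i2.aestronglyMeasurable).2 i2).congr
      (Filter.Eventually.of_forall fun q => ?_)
    simp [mul_comm]
  have e3 : ∫ q, u q.1 * φ (q.1 + q.2) ∂π = ∫ q, φ q.1 * u (q.1 + q.2) ∂π := by
    have := integral_map hσ.measurable.aemeasurable (μ := π)
      (f := fun q : ℝ × ℝ => φ q.1 * u (q.1 + q.2)) (by rw [hσ.map_eq]; exact i2.1)
    rw [hσ.map_eq] at this
    rw [this]
    refine integral_congr_ae (Filter.Eventually.of_forall fun q => ?_)
    simp [mul_comm]
  have i1' : Integrable (fun q : ℝ × ℝ => u q.1 * φ q.1) π := by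
    simpa only [mul_comm] using i1
  have eL : ∫ x, u x * incLap (truncKer S) φ x =
      ∫ q, (u q.1 * φ q.1 - u q.1 * φ (q.1 + q.2)) ∂π := by
    have i : Integrable (fun q : ℝ × ℝ => u q.1 * φ q.1 - u q.1 * φ (q.1 + q.2)) π := i1'.sub i3
    rw [hπ, integral_prod _ i]
    refine integral_congr_ae (Filter.Eventually.of_forall fun x => ?_)
    simp only [incLap, ← integral_const_mul, mul_sub]
  have eR : ∫ x, φ x * incLap (truncKer S) u x =
      ∫ q, (φ q.1 * u q.1 - φ q.1 * u (q.1 + q.2)) ∂π := by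
    have i : Integrable (fun q : ℝ × ℝ => φ q.1 * u q.1 - φ q.1 * u (q.1 + q.2)) π := i1.sub i2
    rw [hπ, integral_prod _ i]
    refine integral_congr_ae (Filter.Eventually.of_forall fun x => ?_)
    simp only [incLap, ← integral_const_mul, mul_sub]
  rw [eL, eR, integral_sub i1' i3, integral_sub i1 i2, e3]
  simp only [mul_comm]

/-- The symmetry of the truncated operators passes to the limit: on the test function side by
dominated convergence, on the side of `u` by `L²` convergence. -/
theorem hasQuarterLap_of_tendsto {u g : ℝ → ℝ} (hu : LocallyIntegrable u volume)
    (he : energy u < ∞) (hg : MemLp g 2 volume)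
    (h : Filter.Tendsto (fun N => eLpNorm (truncLap N u - g) 2 volume) Filter.atTop (nhds 0)) :
    HasQuarterLap u g := by
  have hdec := lintegral_decay_lt_top hu he
  refine ⟨?_, hg.locallyIntegrable one_le_two, fun φ hφ hc => ?_⟩
  · have hwm : Measurable fun x : ℝ => (1 + |x|) ^ (-(3 / 2) : ℝ) := by fun_prop
    refine ⟨hu.aestronglyMeasurable.mul hwm.aestronglyMeasurable, ?_⟩
    rw [HasFiniteIntegral]
    refine lt_of_eq_of_lt (lintegral_congr fun x => ?_) hdec
    rw [enorm_mul, Real.enorm_eq_ofReal (r := (1 + |x|) ^ _) (by positivity), mul_comm]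
  · obtain ⟨R, L, M, hb⟩ := exists_boundedLip hφ hc
    have h1 := (hb.tendsto_integral_mul_truncLap hu.aestronglyMeasurable hdec).2.2
    have h2 := tendsto_integral_mul_of_tendsto_eLpNorm
      (hb.continuous.memLp_of_hasCompactSupport hc) (memLp_truncLap hu he) hg h
    refine tendsto_nhds_unique h1 (h2.congr fun N => ?_)
    exact ((isTruncation_truncSet N).integral_mul_incLap_comm hb hu).symm

theorem exists_hasQuarterLap {u : ℝ → ℝ} (hu : LocallyIntegrable u volume)
    (he : energy u < ∞) : ∃ g, HasQuarterLap u g := by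
  obtain ⟨g, hg, hlim⟩ := exists_tendsto_truncLap hu he
  exact ⟨g, hasQuarterLap_of_tendsto hu he hg hlim⟩

theorem hasQuarterLap_quarterLap {u : ℝ → ℝ} (h : ∃ g, HasQuarterLap u g) :
    HasQuarterLap u (quarterLap u) := by
  unfold quarterLap
  rw [dif_pos h]
  exact h.choose_spec

/-- The representative picked by `quarterLap` agrees almost everywhere with the `L²` limit of the
truncations, because a distribution has only one representing function. -/
theorem memLp_quarterLap {u : ℝ → ℝ} (hu : LocallyIntegrable u volume) (he : energy u < ∞) :
    MemLp (quarterLap u) 2 volume ∧ Filter.Tendsto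
      (fun N => eLpNorm (truncLap N u - quarterLap u) 2 volume) Filter.atTop (nhds 0) := by
  obtain ⟨g, hg, hlim⟩ := exists_tendsto_truncLap hu he
  have hq := hasQuarterLap_of_tendsto hu he hg hlim
  have hae : quarterLap u =ᵐ[volume] g := (hasQuarterLap_quarterLap ⟨g, hq⟩).unique hq
  refine ⟨hg.ae_eq hae.symm, hlim.congr fun N => eLpNorm_congr_ae ?_⟩
  filter_upwards [hae] with x hx
  simp only [Pi.sub_apply, hx]

/-- Pairings of a square integrable function with `Λ u`, for `u ∈ Ḣ^{1/2}`. -/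
theorem tendsto_integral_mul_truncLap_of_memLp {u a : ℝ → ℝ} (hu : LocallyIntegrable u volume)
    (he : energy u < ∞) (ha : MemLp a 2 volume) :
    Integrable (fun x => a x * quarterLap u x) volume ∧
    (∀ N, Integrable (fun x => a x * truncLap N u x) volume) ∧
    Filter.Tendsto (fun N => ∫ x, a x * truncLap N u x) Filter.atTop
      (nhds (∫ x, a x * quarterLap u x)) := by
  obtain ⟨h1, h2⟩ := memLp_quarterLap hu he
  exact ⟨ha.integrable_mul h1, fun N => ha.integrable_mul (memLp_truncLap hu he N),
    tendsto_integral_mul_of_tendsto_eLpNorm ha (memLp_truncLap hu he) h1 h2⟩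

/-- Pairings of a bounded function with `Λ u`, for `u ∈ Ḣ^{1/2}` with bounded support. -/
theorem tendsto_integral_mul_truncLap_of_bounded {u a : ℝ → ℝ} (hu : LocallyIntegrable u volume)
    (he : energy u < ∞) {R : ℝ} (hR : 1 ≤ R) (hsupp : ∀ y, R < |y| → u y = 0)
    (ha : MemLp a ∞ volume) :
    Integrable (fun x => a x * quarterLap u x) volume ∧
    (∀ N, Integrable (fun x => a x * truncLap N u x) volume) ∧
    Filter.Tendsto (fun N => ∫ x, a x * truncLap N u x) Filter.atTop
      (nhds (∫ x, a x * quarterLap u x)) := by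
  -- A bounded `a` need not be in `L²`. On `A` it is, and `L²` convergence suffices; off `A` the
  -- function `u` vanishes, so the truncations converge pointwise and are dominated by a multiple of
  -- `|x|^(-3/2)`.
  set A : Set ℝ := Set.Icc (-(2 * R)) (2 * R) with hA
  have hAm : MeasurableSet A := measurableSet_Icc
  have hAc : ∀ x ∈ Aᶜ, 2 * R < |x| := fun x hx => by
    by_contra hc
    exact hx (Set.mem_Icc.2 (_root_.abs_le.1 (not_lt.1 hc)))
  have huI : Integrable u volume := by
    refine (integrableOn_iff_integrable_of_support_subset (s := Set.Icc (-R) R) fun x hx => ?_).1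
      (hu.integrableOn_isCompact isCompact_Icc)
    by_contra hc
    refine hx (hsupp x ?_)
    by_contra hc'
    exact hc (Set.mem_Icc.2 (_root_.abs_le.1 (not_lt.1 hc')))
  have haA : MemLp (A.indicator a) 2 volume := by
    rw [memLp_indicator_iff_restrict hAm]
    exact (ha.restrict A).mono_exponent le_top
  obtain ⟨k1, k2, k3⟩ := tendsto_integral_mul_truncLap_of_memLp hu he haA
  have hind : ∀ f : ℝ → ℝ, (fun x => A.indicator a x * f x) = A.indicator fun x => a x * f x :=
    fun f => by
      funext x
      by_cases hx : x ∈ A <;> simp [hx]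
  have k1' : IntegrableOn (fun x => a x * quarterLap u x) A volume := by
    rwa [hind, integrable_indicator_iff hAm] at k1
  have k2' : ∀ N, IntegrableOn (fun x => a x * truncLap N u x) A volume := fun N => by
    have := k2 N
    rwa [hind, integrable_indicator_iff hAm] at this
  simp only [hind, integral_indicator hAm] at k3
  set I := (∫⁻ y, ‖u y‖ₑ).toReal with hI
  have hfar : ∀ x ∈ Aᶜ, ∫⁻ t, ‖u x - u (x + t)‖ₑ ∂quarterKer ≤
      ENNReal.ofReal ((|x| / 2) ^ (-(3 / 2) : ℝ) * I) := fun x hx => by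
    have hx' := hAc x hx
    rw [ENNReal.ofReal_mul (by positivity), hI, ENNReal.ofReal_toReal huI.2.ne]
    exact lintegral_increment_far_le hsupp hx' (by linarith)
  have hpt : ∀ x ∈ Aᶜ, Filter.Tendsto (fun N => truncLap N u x) Filter.atTop
      (nhds (incLap quarterKer u x)) := fun x hx =>
    tendsto_truncLap_of_lintegral_lt_top hu.aestronglyMeasurable
      ((hfar x hx).trans_lt ENNReal.ofReal_lt_top)
  obtain ⟨hq1, hq2⟩ := memLp_quarterLap hu he
  -- A subsequence of the truncations converges almost everywhere to the `L²` limit, which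
  -- identifies it with the pointwise limit off `A`.
  have hae : ∀ᵐ x ∂(volume.restrict Aᶜ), quarterLap u x = incLap quarterKer u x := by
    obtain ⟨ns, hns, hlim⟩ := (tendstoInMeasure_of_tendsto_eLpNorm two_ne_zero
      (fun N => (memLp_truncLap hu he N).1) hq1.1 hq2).exists_seq_tendsto_ae
    rw [ae_restrict_iff' hAm.compl]
    filter_upwards [hlim] with x hx hxA
    exact tendsto_nhds_unique hx ((hpt x hxA).comp hns.tendsto_atTop)
  set B := (eLpNorm a ∞ volume).toReal with hB
  have hab : ∀ᵐ x ∂(volume.restrict Aᶜ), ‖a x‖ ≤ B := by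
    refine ae_restrict_of_ae ?_
    have hfin := ha.2.ne
    filter_upwards [ae_le_eLpNormEssSup (f := a) (μ := volume)] with x hx
    rw [← eLpNorm_exponent_top] at hx
    rw [hB, ← toReal_enorm]
    exact ENNReal.toReal_mono hfin hx
  have hgi : IntegrableOn (fun x : ℝ => B * ((|x| / 2) ^ (-(3 / 2) : ℝ) * I)) Aᶜ volume := by
    have hw : Integrable (fun x : ℝ => (1 + |x|) ^ (-(3 / 2) : ℝ)) volume := by
      have := integrable_one_add_norm (E := ℝ) (μ := volume) (r := 3 / 2) (by simp; norm_num)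
      simpa using this
    have hm : Measurable fun x : ℝ => B * ((|x| / 2) ^ (-(3 / 2) : ℝ) * I) := by fun_prop
    refine Integrable.mono
      ((hw.const_mul (B * ((1 / 4) ^ (-(3 / 2) : ℝ) * I))).integrableOn (s := Aᶜ))
      hm.aestronglyMeasurable ?_
    filter_upwards [ae_restrict_mem hAm.compl] with x hx
    have hx' := hAc x hx
    have hI0 : 0 ≤ I := ENNReal.toReal_nonneg
    have hB0 : 0 ≤ B := ENNReal.toReal_nonneg
    rw [Real.norm_of_nonneg (by positivity), Real.norm_of_nonneg (by positivity), mul_assoc,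
      mul_right_comm _ I, ← Real.mul_rpow (by norm_num) (by positivity)]
    gcongr B * (?_ * I)
    exact Real.rpow_le_rpow_of_nonpos (by positivity) (by linarith) (by norm_num)
  have hbound : ∀ N, ∀ᵐ x ∂(volume.restrict Aᶜ),
      ‖a x * truncLap N u x‖ ≤ B * ((|x| / 2) ^ (-(3 / 2) : ℝ) * I) := fun N => by
    filter_upwards [hab, ae_restrict_mem hAm.compl] with x hx hxA
    rw [norm_mul]
    have h2 := (enorm_truncLap_le N u x).trans (hfar x hxA)
    rw [← ofReal_norm, ENNReal.ofReal_le_ofReal_iff (by positivity)] at h2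
    exact mul_le_mul hx h2 (norm_nonneg _) ENNReal.toReal_nonneg
  have hm : ∀ N, AEStronglyMeasurable (fun x => a x * truncLap N u x) (volume.restrict Aᶜ) :=
    fun N => (ha.1.mul (memLp_truncLap hu he N).1).restrict
  have hlim : ∀ᵐ x ∂(volume.restrict Aᶜ), Filter.Tendsto (fun N => a x * truncLap N u x)
      Filter.atTop (nhds (a x * quarterLap u x)) := by
    filter_upwards [hae, ae_restrict_mem hAm.compl] with x hx hxA
    rw [hx]
    exact (hpt x hxA).const_mul _
  have l1 : IntegrableOn (fun x => a x * quarterLap u x) Aᶜ volume := by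
    refine hgi.mono' (ha.1.mul hq1.1).restrict ?_
    filter_upwards [hlim, ae_all_iff.2 hbound] with x hx hxb
    exact le_of_tendsto hx.norm (Filter.Eventually.of_forall hxb)
  have l2 : ∀ N, IntegrableOn (fun x => a x * truncLap N u x) Aᶜ volume := fun N =>
    hgi.mono' (hm N) (hbound N)
  have l3 := tendsto_integral_of_dominated_convergence _ hm hgi hbound hlim
  have t1 : Integrable (fun x => a x * quarterLap u x) volume := by
    rw [← integrableOn_univ, ← Set.union_compl_self A]
    exact k1'.union l1
  have t2 : ∀ N, Integrable (fun x => a x * truncLap N u x) volume := fun N => by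
    rw [← integrableOn_univ, ← Set.union_compl_self A]
    exact (k2' N).union (l2 N)
  refine ⟨t1, t2, ?_⟩
  rw [← integral_add_compl hAm t1]
  exact (k3.add l3).congr fun N => integral_add_compl hAm (t2 N)

/-! ### The bilinear form of the multi-commutator -/

theorem MemHHalf.comp_of_abs_sub_le {E : Type*} [NormedAddCommGroup E] {u : ℝ → E}
    (hu : MemHHalf u) {f : E → ℝ} (hf : ∀ a b, |f a - f b| ≤ ‖a - b‖) (h0 : f 0 = 0) :
    LocallyIntegrable (fun x => f (u x)) volume ∧ energy (fun x => f (u x)) < ∞ := by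
  have hlip : LipschitzWith 1 f := LipschitzWith.of_dist_le_mul fun a b => by
    rw [Real.dist_eq, dist_eq_norm, NNReal.coe_one, one_mul]
    exact hf a b
  refine ⟨hu.1.mono (hlip.continuous.comp_aestronglyMeasurable hu.1.aestronglyMeasurable)
    (ae_of_all _ fun x => ?_), ((energy_mono fun x y => ?_).trans_lt
      ((hHalfNorm_lt_top_iff _).1 hu.2))⟩
  · simpa [h0] using hf (u x) 0
  · rw [← ofReal_norm, ← ofReal_norm]
    exact ENNReal.ofReal_le_ofReal (hf _ _)

section Form

variable {m : ℕ}

theorem norm_toLp_mulVec_le (M : Matrix (Fin m) (Fin m) ℝ) (b : Fin m → ℝ) :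
    ‖WithLp.toLp 2 (M *ᵥ b)‖ ≤ ‖M‖ * ‖WithLp.toLp 2 b‖ := by
  have h := Matrix.frobenius_norm_mul M (Matrix.replicateCol (Fin 1) b)
  rw [← Matrix.replicateCol_mulVec] at h
  have e := fun c : Fin m → ℝ => Matrix.frobenius_norm_replicateCol (ι := Fin 1) c
  exact (e _).symm.le.trans (h.trans (mul_le_mul_of_nonneg_left (e b).le (norm_nonneg _)))

theorem abs_dotProduct_le (a b : Fin m → ℝ) :
    |a ⬝ᵥ b| ≤ ‖WithLp.toLp 2 a‖ * ‖WithLp.toLp 2 b‖ := by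
  have := abs_real_inner_le_norm (WithLp.toLp 2 b) (WithLp.toLp 2 a)
  rw [EuclideanSpace.inner_toLp_toLp] at this
  simpa [mul_comm] using this

theorem abs_entry_le (M : Matrix (Fin m) (Fin m) ℝ) (i j : Fin m) : |M i j| ≤ ‖M‖ := by
  rw [Matrix.frobenius_norm_def, ← Real.sqrt_eq_rpow]
  refine Real.abs_le_sqrt ?_
  have h1 : ‖M i j‖ ^ (2 : ℝ) ≤ ∑ j, ‖M i j‖ ^ (2 : ℝ) :=
    Finset.single_le_sum (f := fun j => ‖M i j‖ ^ (2 : ℝ)) (fun j _ => by positivity)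
      (Finset.mem_univ j)
  have h2 : ∑ j, ‖M i j‖ ^ (2 : ℝ) ≤ ∑ i, ∑ j, ‖M i j‖ ^ (2 : ℝ) :=
    Finset.single_le_sum (f := fun i => ∑ j, ‖M i j‖ ^ (2 : ℝ)) (fun j _ => by positivity)
      (Finset.mem_univ i)
  refine le_trans (le_of_eq ?_) (h1.trans h2)
  rw [Real.rpow_two, Real.norm_eq_abs, sq_abs]

theorem MemHHalf.entry {Q : ℝ → Matrix (Fin m) (Fin m) ℝ} (hQ : MemHHalf Q) (i j : Fin m) :
    LocallyIntegrable (fun x => Q x i j) volume ∧ energy (fun x => Q x i j) < ∞ :=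
  hQ.comp_of_abs_sub_le (f := fun M => M i j) (fun A B => abs_entry_le (A - B) i j) rfl

theorem aestronglyMeasurable_coord {X : Type*} [MeasurableSpace X] {μ : Measure X}
    {v : X → EuclideanSpace ℝ (Fin m)} (hv : AEStronglyMeasurable v μ) (i : Fin m) :
    AEStronglyMeasurable (fun x => v x i) μ :=
  (EuclideanSpace.proj (𝕜 := ℝ) i).continuous.comp_aestronglyMeasurable hv

/-- The kernel of the bilinear form. -/
def mcKer (P Q : ℝ → Matrix (Fin m) (Fin m) ℝ) (v φ : ℝ → EuclideanSpace ℝ (Fin m))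
    (q : ℝ × ℝ) : ℝ :=
  (φ q.1 - φ (q.1 + q.2)).ofLp ⬝ᵥ
    (P q.1 *ᵥ ((Q (q.1 + q.2) - Q q.1) *ᵥ (v (q.1 + q.2)).ofLp) +
      (Q (q.1 + q.2) - Q q.1) *ᵥ (P q.1 *ᵥ (v q.1).ofLp))

/-- The bilinear form of the multi-commutator. -/
def mcForm (P Q : ℝ → Matrix (Fin m) (Fin m) ℝ) (v φ : ℝ → EuclideanSpace ℝ (Fin m)) : ℝ :=
  ∫ q, mcKer P Q v φ q ∂((volume : Measure ℝ).prod quarterKer)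

/-- Both summands contain an increment of `φ` and an increment of `Q`, while `P` is evaluated only
at the first point; the Frobenius norm controls the matrix actions. -/
theorem enorm_mcKer_le (P Q : ℝ → Matrix (Fin m) (Fin m) ℝ) (v φ : ℝ → EuclideanSpace ℝ (Fin m))
    (q : ℝ × ℝ) : ‖mcKer P Q v φ q‖ₑ ≤ ‖P q.1‖ₑ * (‖φ (q.1 + q.2) - φ q.1‖ₑ *
      ‖Q (q.1 + q.2) - Q q.1‖ₑ * (‖v (q.1 + q.2)‖ₑ + ‖v q.1‖ₑ)) := by
  have key : |mcKer P Q v φ q| ≤ ‖P q.1‖ * (‖φ (q.1 + q.2) - φ q.1‖ *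
      ‖Q (q.1 + q.2) - Q q.1‖ * (‖v (q.1 + q.2)‖ + ‖v q.1‖)) := by
    unfold mcKer
    set D := Q (q.1 + q.2) - Q q.1
    refine (abs_dotProduct_le _ _).trans ?_
    rw [WithLp.toLp_add]
    have h1 : ‖WithLp.toLp 2 (P q.1 *ᵥ (D *ᵥ (v (q.1 + q.2)).ofLp))‖ ≤
        ‖P q.1‖ * (‖D‖ * ‖v (q.1 + q.2)‖) :=
      (norm_toLp_mulVec_le _ _).trans
        (mul_le_mul_of_nonneg_left (norm_toLp_mulVec_le _ _) (norm_nonneg _))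
    have h2 : ‖WithLp.toLp 2 (D *ᵥ (P q.1 *ᵥ (v q.1).ofLp))‖ ≤
        ‖D‖ * (‖P q.1‖ * ‖v q.1‖) :=
      (norm_toLp_mulVec_le _ _).trans
        (mul_le_mul_of_nonneg_left (norm_toLp_mulVec_le _ _) (norm_nonneg _))
    have h3 := (norm_add_le _ _).trans (add_le_add h1 h2)
    rw [WithLp.toLp_ofLp, norm_sub_rev]
    refine (mul_le_mul_of_nonneg_left h3 (norm_nonneg _)).trans (le_of_eq ?_)
    ring
  simp only [← ofReal_norm]
  rw [← ENNReal.ofReal_add (by positivity) (by positivity), ← ENNReal.ofReal_mul (by positivity),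
    ← ENNReal.ofReal_mul (by positivity), ← ENNReal.ofReal_mul (by positivity)]
  exact ENNReal.ofReal_le_ofReal key

theorem aestronglyMeasurable_add_fst_snd {F : Type*} [TopologicalSpace F] {f : ℝ → F}
    (hf : AEStronglyMeasurable f volume) : AEStronglyMeasurable (fun q : ℝ × ℝ => f (q.1 + q.2))
      ((volume : Measure ℝ).prod quarterKer) :=
  (hf.comp_quasiMeasurePreserving (quasiMeasurePreserving_add volume volume)).mono_ac
    (Measure.AbsolutelyContinuous.rfl.prod quarterKer_absolutelyContinuous)

variable {P Q : ℝ → Matrix (Fin m) (Fin m) ℝ} {v φ : ℝ → EuclideanSpace ℝ (Fin m)}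

theorem aestronglyMeasurable_mcKer (hP : ∀ i j, AEStronglyMeasurable (fun x => P x i j) volume)
    (hQ : ∀ i j, AEStronglyMeasurable (fun x => Q x i j) volume)
    (hv : AEStronglyMeasurable v volume)
    (hφ : AEStronglyMeasurable φ volume) :
    AEStronglyMeasurable (mcKer P Q v φ) ((volume : Measure ℝ).prod quarterKer) := by
  have hP1 := fun i j => (hP i j).comp_fst (ν := quarterKer)
  have hQ1 := fun i j => (hQ i j).comp_fst (ν := quarterKer)
  have hQ2 := fun i j => aestronglyMeasurable_add_fst_snd (hQ i j)
  have hv1 := fun i => (aestronglyMeasurable_coord hv i).comp_fst (ν := quarterKer)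
  have hv2 := fun i => aestronglyMeasurable_add_fst_snd (aestronglyMeasurable_coord hv i)
  have hφ1 := fun i => (aestronglyMeasurable_coord hφ i).comp_fst (ν := quarterKer)
  have hφ2 := fun i => aestronglyMeasurable_add_fst_snd (aestronglyMeasurable_coord hφ i)
  unfold mcKer
  simp only [dotProduct, mulVec, Pi.add_apply, Matrix.sub_apply, WithLp.ofLp_sub, Pi.sub_apply]
  refine Finset.aestronglyMeasurable_fun_sum _ fun i _ => ((hφ1 i).sub (hφ2 i)).mul ?_
  refine AEStronglyMeasurable.add ?_ ?_
  · refine Finset.aestronglyMeasurable_fun_sum _ fun j _ => (hP1 i j).mul ?_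
    exact Finset.aestronglyMeasurable_fun_sum _ fun k _ => ((hQ2 j k).sub (hQ1 j k)).mul (hv2 k)
  · refine Finset.aestronglyMeasurable_fun_sum _ fun j _ => ((hQ2 i j).sub (hQ1 i j)).mul ?_
    exact Finset.aestronglyMeasurable_fun_sum _ fun k _ => (hP1 j k).mul (hv1 k)

end Form

/-- Hölder's inequality with three factors. -/
theorem lintegral_mul_mul_le {X : Type*} [MeasurableSpace X] {μ : Measure X} {p q : ℝ} (hp : 2 < p)
    (hpq : 1 / p + 1 / q = 1 / 2) {f g k : X → ℝ≥0∞} (hf : AEMeasurable f μ)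
    (hg : AEMeasurable g μ) (hk : AEMeasurable k μ) :
    ∫⁻ x, f x * g x * k x ∂μ ≤ (∫⁻ x, f x ^ q ∂μ) ^ (1 / q) * (∫⁻ x, g x ^ p ∂μ) ^ (1 / p) *
      (∫⁻ x, k x ^ (2 : ℝ) ∂μ) ^ (1 / 2 : ℝ) := by
  have h1 := ENNReal.lintegral_mul_le_Lp_mul_Lq μ Real.HolderConjugate.two_two (hf.mul hg) hk
  have h2 := ENNReal.lintegral_Lp_mul_le_Lq_mul_Lr (p := 2) (q := p) (r := q) two_pos hp
    hpq.symm μ hg hf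
  refine h1.trans ?_
  gcongr
  rw [mul_comm f g, mul_comm (_ ^ (1 / q))]
  exact h2

/-! ### The trilinear estimate: Hölder in the position, Cauchy–Schwarz in the step. -/

section Bound

variable {E F G : Type*} [NormedAddCommGroup E] [NormedAddCommGroup F] [NormedAddCommGroup G]

theorem aestronglyMeasurable_comp_add_right {f : ℝ → E} (hf : AEStronglyMeasurable f volume)
    (h : ℝ) : AEStronglyMeasurable (fun x => f (x + h)) volume :=
  hf.comp_measurePreserving (measurePreserving_add_right volume h)

/-- Three-factor Hölder with exponents `q`, `p`, `2`, once for each translate of `k`; both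
translates have the same `L²` norm, whence the `2`. -/
theorem lintegral_increment_mul_le {p q : ℝ} (hp : 2 < p) (hpq : 1 / p + 1 / q = 1 / 2)
    {f : ℝ → E} {g : ℝ → F} {k : ℝ → G} (hf : AEStronglyMeasurable f volume)
    (hg : AEStronglyMeasurable g volume) (hk : AEStronglyMeasurable k volume) (h : ℝ) :
    ∫⁻ x, ‖f (x + h) - f x‖ₑ * ‖g (x + h) - g x‖ₑ * (‖k (x + h)‖ₑ + ‖k x‖ₑ) ≤
      2 * (incr q f h * incr p g h) * eLpNorm k 2 volume := by
  have hf' : AEMeasurable (fun x => ‖f (x + h) - f x‖ₑ) volume :=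
    ((aestronglyMeasurable_comp_add_right hf h).sub hf).enorm
  have hg' : AEMeasurable (fun x => ‖g (x + h) - g x‖ₑ) volume :=
    ((aestronglyMeasurable_comp_add_right hg h).sub hg).enorm
  have hk' := hk.enorm
  have hk'' := (aestronglyMeasurable_comp_add_right hk h).enorm
  have e1 := lintegral_mul_mul_le hp hpq hf' hg' hk''
  have e2 := lintegral_mul_mul_le hp hpq hf' hg' hk'
  have e3 : ∫⁻ x, ‖k (x + h)‖ₑ ^ (2 : ℝ) = ∫⁻ x, ‖k x‖ₑ ^ (2 : ℝ) :=
    lintegral_add_right_eq_self (fun x => ‖k x‖ₑ ^ (2 : ℝ)) h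
  have e4 : eLpNorm k 2 volume = (∫⁻ x, ‖k x‖ₑ ^ (2 : ℝ)) ^ (1 / 2 : ℝ) := by
    rw [eLpNorm_eq_lintegral_rpow_enorm_toReal two_ne_zero ENNReal.ofNat_ne_top]
    simp
  rw [e3] at e1
  have hm : AEMeasurable (fun x => ‖f (x + h) - f x‖ₑ * ‖g (x + h) - g x‖ₑ * ‖k x‖ₑ) volume :=
    (hf'.mul hg').mul hk'
  simp only [mul_add]
  rw [lintegral_add_right' _ hm, e4]
  refine (add_le_add e1 e2).trans (le_of_eq ?_)
  unfold incr
  ring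

/-- Cauchy–Schwarz in `h`: because `1/p + 1/q = 1/2`, the kernel exponent `-3/2` is the mean of the
two Besov exponents `-1 - 2/q` and `-1 - 2/p`. -/
theorem lintegral_incr_mul_incr_le {p q : ℝ} (hp : 2 < p) (hq : 2 < q)
    (hpq : 1 / p + 1 / q = 1 / 2) {f : ℝ → E} {g : ℝ → F} (hf : AEStronglyMeasurable f volume)
    (hg : AEStronglyMeasurable g volume) :
    ∫⁻ h, incr q f h * incr p g h ∂quarterKer ≤
      besovNorm (1 / q) q 2 f * besovNorm (1 / p) p 2 g := by
  have hf' := measurable_incr_of_ae (r := q) hf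
  have hg' := measurable_incr_of_ae (r := p) hg
  rw [besovNorm_eq_incr (by linarith), besovNorm_eq_incr (by linarith), lintegral_quarterKer]
  set a : ℝ := (-1 - 1 / q * 2) / 2 with ha
  set b : ℝ := (-1 - 1 / p * 2) / 2 with hb
  have hsq : ∀ (c : ℝ) (t : ℝ) (X : ℝ≥0∞), (ENNReal.ofReal (|t| ^ (c / 2)) * X) ^ (2 : ℝ) =
      ENNReal.ofReal (|t| ^ c) * X ^ (2 : ℝ) := by
    intro c t X
    rw [ENNReal.mul_rpow_of_nonneg _ _ zero_le_two,
      ENNReal.ofReal_rpow_of_nonneg (by positivity) zero_le_two, ← Real.rpow_mul (abs_nonneg t)]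
    congr 3; ring
  have h1 := ENNReal.lintegral_mul_le_Lp_mul_Lq volume Real.HolderConjugate.two_two
    (f := fun h : ℝ => ENNReal.ofReal (|h| ^ a) * incr q f h)
    (g := fun h : ℝ => ENNReal.ofReal (|h| ^ b) * incr p g h)
    (by fun_prop) (by fun_prop)
  simp only [ha, hb, hsq] at h1
  refine le_trans (lintegral_mono_ae ?_) h1
  filter_upwards [Measure.ae_ne volume (0 : ℝ)] with h hh
  simp only [Pi.mul_apply]
  rw [mul_mul_mul_comm, ← ENNReal.ofReal_mul (by positivity), ← Real.rpow_add (abs_pos.2 hh)]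
  have e : (-1 - 1 / q * 2) / 2 + (-1 - 1 / p * 2) / 2 = (-(3 / 2) : ℝ) := by linarith
  rw [e]

/-- The trilinear estimate behind the multi-commutator. -/
theorem lintegral_le_of_increment_bound [NormedSpace ℝ F] [CompleteSpace F] {p q : ℝ} (hp : 2 < p)
    (hq : 2 < q) (hpq : 1 / p + 1 / q = 1 / 2) {f : ℝ → E} {g : ℝ → F} {k : ℝ → G}
    (hf : AEStronglyMeasurable f volume) (hg : MemHHalf g) (hk : AEStronglyMeasurable k volume)
    {T : ℝ × ℝ → ℝ≥0∞} (hT : AEMeasurable T ((volume : Measure ℝ).prod quarterKer)) {A : ℝ≥0∞}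
    (hle : ∀ h, ∀ᵐ x, T (x, h) ≤
      A * (‖f (x + h) - f x‖ₑ * ‖g (x + h) - g x‖ₑ * (‖k (x + h)‖ₑ + ‖k x‖ₑ))) :
    ∫⁻ z, T z ∂((volume : Measure ℝ).prod quarterKer) ≤
      2 * embConst p * A * hHalfNorm g * eLpNorm k 2 volume * besovNorm (1 / q) q 2 f := by
  have hgm := hg.1.aestronglyMeasurable
  have hinner : ∀ h, ∫⁻ x, T (x, h) ≤
      (A * 2 * eLpNorm k 2 volume) * (incr q f h * incr p g h) := by
    intro h
    have hm : AEMeasurable (fun x => ‖f (x + h) - f x‖ₑ * ‖g (x + h) - g x‖ₑ *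
        (‖k (x + h)‖ₑ + ‖k x‖ₑ)) volume :=
      ((((aestronglyMeasurable_comp_add_right hf h).sub hf).enorm.mul
        ((aestronglyMeasurable_comp_add_right hgm h).sub hgm).enorm)).mul
        ((aestronglyMeasurable_comp_add_right hk h).enorm.add hk.enorm)
    refine (lintegral_mono_ae (hle h)).trans ?_
    rw [lintegral_const_mul'' _ hm]
    calc _ ≤ A * (2 * (incr q f h * incr p g h) * eLpNorm k 2 volume) := by
          gcongr
          exact lintegral_increment_mul_le hp hpq hf hgm hk h
      _ = _ := by ring
  rw [lintegral_prod_symm _ hT]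
  refine (lintegral_mono hinner).trans ?_
  have hm : Measurable fun h => incr q f h * incr p g h :=
    (measurable_incr_of_ae hf).mul (measurable_incr_of_ae hgm)
  rw [lintegral_const_mul _ hm]
  calc _ ≤ A * 2 * eLpNorm k 2 volume * (besovNorm (1 / q) q 2 f * (embConst p * hHalfNorm g)) := by
        gcongr
        refine (lintegral_incr_mul_incr_le hp hq hpq hf hgm).trans ?_
        gcongr
        exact besovNorm_le_hHalfNorm hp hg.1
    _ = _ := by ring

end Bound

section FormBound

variable {m : ℕ} {P Q : ℝ → Matrix (Fin m) (Fin m) ℝ} {v φ : ℝ → EuclideanSpace ℝ (Fin m)}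

theorem lintegral_mcKer_le {p q : ℝ} (hp : 2 < p) (hq : 2 < q) (hpq : 1 / p + 1 / q = 1 / 2)
    (hP : ∀ i j, AEStronglyMeasurable (fun x => P x i j) volume) (hQ : MemHHalf Q)
    (hv : AEStronglyMeasurable v volume) (hφ : AEStronglyMeasurable φ volume) :
    ∫⁻ z, ‖mcKer P Q v φ z‖ₑ ∂((volume : Measure ℝ).prod quarterKer) ≤
      2 * embConst p * eLpNorm P ∞ volume * hHalfNorm Q * eLpNorm v 2 volume *
        besovNorm (1 / q) q 2 φ := by
  let : NormedSpace ℝ (Matrix (Fin m) (Fin m) ℝ) := Matrix.frobeniusNormedSpace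
  have : CompleteSpace (Matrix (Fin m) (Fin m) ℝ) := FiniteDimensional.complete ℝ _
  have hPae : ∀ᵐ x, ‖P x‖ₑ ≤ eLpNorm P ∞ volume := by
    rw [eLpNorm_exponent_top]
    exact ae_le_eLpNormEssSup
  refine lintegral_le_of_increment_bound hp hq hpq hφ hQ hv (aestronglyMeasurable_mcKer hP
    (fun i j => (hQ.entry i j).1.aestronglyMeasurable) hv hφ).enorm fun h => ?_
  filter_upwards [hPae] with x hx
  refine (enorm_mcKer_le P Q v φ (x, h)).trans ?_
  gcongr

/-- The symmetric choice `p = q = 4` suffices, as the embedding makes both Besov norms finite. -/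
theorem integrable_mcKer (hP : ∀ i j, AEStronglyMeasurable (fun x => P x i j) volume)
    (hPb : eLpNorm P ∞ volume < ∞) (hQ : MemHHalf Q) (hv : MemLp v 2 volume)
    (hφ : LocallyIntegrable φ volume) (hφe : hHalfNorm φ < ∞) :
    Integrable (mcKer P Q v φ) ((volume : Measure ℝ).prod quarterKer) := by
  refine ⟨aestronglyMeasurable_mcKer hP (fun i j => (hQ.entry i j).1.aestronglyMeasurable) hv.1
    hφ.aestronglyMeasurable, ?_⟩
  refine (lintegral_mcKer_le (p := 4) (q := 4) (by norm_num) (by norm_num) (by norm_num) hP hQ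
    hv.1 hφ.aestronglyMeasurable).trans_lt ?_
  have h1 : besovNorm (1 / 4) 4 2 φ < ∞ :=
    (besovNorm_le_hHalfNorm (p := 4) (by norm_num) hφ).trans_lt
      (ENNReal.mul_lt_top ENNReal.coe_lt_top hφe)
  refine ENNReal.mul_lt_top (ENNReal.mul_lt_top (ENNReal.mul_lt_top (ENNReal.mul_lt_top
    (ENNReal.mul_lt_top ?_ ENNReal.coe_lt_top) hPb) hQ.2) hv.2) h1
  exact ENNReal.ofNat_lt_top

end FormBound

/-! ### Truncated pairings -/

/-- A locally integrable function of finite energy. -/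
def FinEnergy (u : ℝ → ℝ) : Prop := LocallyIntegrable u volume ∧ energy u < ∞

theorem FinEnergy.mul {R L M : ℝ} {ψ u : ℝ → ℝ} (hu : FinEnergy u) (h : BoundedLip R L M ψ) :
    FinEnergy (fun x => ψ x * u x) :=
  ⟨(h.memLp_mul hu.1.aestronglyMeasurable hu.2).locallyIntegrable one_le_two,
    h.energy_mul_lt_top hu.1.aestronglyMeasurable hu.2⟩

theorem FinEnergy.sum {ι : Type*} (s : Finset ι) {u : ι → ℝ → ℝ} (hu : ∀ i, FinEnergy (u i)) :
    FinEnergy (fun x => ∑ i ∈ s, u i x) := by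
  classical
  induction s using Finset.induction_on with
  | empty =>
    refine ⟨by simpa using (locallyIntegrable_const (0 : ℝ)), ?_⟩
    simp [energy]
  | insert a s ha ih =>
    simp only [Finset.sum_insert ha]
    exact ⟨(hu a).1.add ih.1, energy_add_lt_top (hu a).2 ih.2 (hu a).1.aestronglyMeasurable⟩

/-- Integrals of truncated functions which converge to an absolutely convergent integral. -/
def TruncLim (g : ℝ → ℝ) (G : ℕ → ℝ → ℝ) : Prop :=
  Integrable g volume ∧ (∀ N, Integrable (G N) volume) ∧
    Filter.Tendsto (fun N => ∫ x, G N x) Filter.atTop (nhds (∫ x, g x))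

section TruncLim

variable {g g' : ℝ → ℝ} {G G' : ℕ → ℝ → ℝ}

theorem TruncLim.add (h : TruncLim g G) (h' : TruncLim g' G') :
    TruncLim (fun x => g x + g' x) (fun N x => G N x + G' N x) := by
  refine ⟨h.1.add h'.1, fun N => (h.2.1 N).add (h'.2.1 N), ?_⟩
  rw [integral_add h.1 h'.1]
  exact (h.2.2.add h'.2.2).congr fun N => (integral_add (h.2.1 N) (h'.2.1 N)).symm

theorem TruncLim.sub (h : TruncLim g G) (h' : TruncLim g' G') :
    TruncLim (fun x => g x - g' x) (fun N x => G N x - G' N x) := by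
  refine ⟨h.1.sub h'.1, fun N => (h.2.1 N).sub (h'.2.1 N), ?_⟩
  rw [integral_sub h.1 h'.1]
  exact (h.2.2.sub h'.2.2).congr fun N => (integral_sub (h.2.1 N) (h'.2.1 N)).symm

theorem TruncLim.sum {ι : Type*} (s : Finset ι) {g : ι → ℝ → ℝ} {G : ι → ℕ → ℝ → ℝ}
    (h : ∀ i, TruncLim (g i) (G i)) :
    TruncLim (fun x => ∑ i ∈ s, g i x) (fun N x => ∑ i ∈ s, G i N x) := by
  refine ⟨integrable_finsetSum _ fun i _ => (h i).1,
    fun N => integrable_finsetSum _ fun i _ => (h i).2.1 N, ?_⟩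
  rw [integral_finsetSum _ fun i _ => (h i).1]
  exact (tendsto_finsetSum _ fun i _ => (h i).2.2).congr fun N =>
    (integral_finsetSum _ fun i _ => (h i).2.1 N).symm

/-- For terms 1, 4 and 6: `Λ` acts on a test function and decays like `(1 + |x|)^(-3/2)`, against
which an `Ḣ^{1/2}` function times a bounded one is integrable. -/
theorem truncLim_quarterLapTest {b q ψ : ℝ → ℝ} {R L M : ℝ} (hb : MemLp b ∞ volume)
    (hq : FinEnergy q) (hψ : BoundedLip R L M ψ) :
    TruncLim (fun x => b x * q x * quarterLapTest ψ x)
      (fun N x => b x * q x * truncLap N ψ x) := by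
  refine hψ.tendsto_integral_mul_truncLap (hb.1.mul hq.1.aestronglyMeasurable) ?_
  have hae : ∀ᵐ x, ‖b x‖ₑ ≤ eLpNorm b ∞ volume := by
    rw [eLpNorm_exponent_top]
    exact ae_le_eLpNormEssSup
  have hlt := ENNReal.mul_lt_top hb.2 (lintegral_decay_lt_top hq.1 hq.2)
  rw [← lintegral_const_mul' _ _ hb.2.ne] at hlt
  refine (lintegral_mono_ae ?_).trans_lt hlt
  filter_upwards [hae] with x hx
  rw [enorm_mul, mul_left_comm]
  gcongr

/-- For terms 2, 3 and 5: `Λ` acts on an `Ḣ^{1/2}` function, and the cofactor is bounded with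
compact support, hence in `L²`. -/
theorem truncLim_quarterLap {b u ψ : ℝ → ℝ} {R L M : ℝ} (hb : MemLp b ∞ volume)
    (hu : FinEnergy u) (hψ : BoundedLip R L M ψ) :
    TruncLim (fun x => b x * ψ x * quarterLap u x) (fun N x => b x * ψ x * truncLap N u x) :=
  tendsto_integral_mul_truncLap_of_memLp hu.1 hu.2
    (MemLp.mul' (p := ∞) (q := 2)
      (hψ.continuous.memLp_of_hasCompactSupport hψ.hasCompactSupport) hb)

/-- For term 7: the cofactor is merely bounded, and the compact support of `ψ u` provides the decay.
-/
theorem truncLim_quarterLap_mul {b u ψ : ℝ → ℝ} {R L M : ℝ} (hb : MemLp b ∞ volume)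
    (hu : FinEnergy u) (hψ : BoundedLip R L M ψ) :
    TruncLim (fun x => b x * quarterLap (fun y => ψ y * u y) x)
      (fun N x => b x * truncLap N (fun y => ψ y * u y) x) :=
  tendsto_integral_mul_truncLap_of_bounded (hu.mul hψ).1 (hu.mul hψ).2 hψ.one_le
    (fun y hy => by rw [hψ.eq_zero y hy, zero_mul]) hb

end TruncLim

/-- `f` is integrable with integral `c`. -/
def IntegralIs (ν : Measure ℝ) (c : ℝ) (f : ℝ → ℝ) : Prop := Integrable f ν ∧ ∫ h, f h ∂ν = c

section IntegralIs

variable {ν : Measure ℝ} {c c' : ℝ} {f f' : ℝ → ℝ}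

theorem IntegralIs.add (h : IntegralIs ν c f) (h' : IntegralIs ν c' f') :
    IntegralIs ν (c + c') (fun t => f t + f' t) :=
  ⟨h.1.add h'.1, by rw [integral_add h.1 h'.1, h.2, h'.2]⟩

theorem IntegralIs.sub (h : IntegralIs ν c f) (h' : IntegralIs ν c' f') :
    IntegralIs ν (c - c') (fun t => f t - f' t) :=
  ⟨h.1.sub h'.1, by rw [integral_sub h.1 h'.1, h.2, h'.2]⟩

theorem IntegralIs.const_mul (h : IntegralIs ν c f) (a : ℝ) :
    IntegralIs ν (a * c) (fun t => a * f t) :=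
  ⟨h.1.const_mul a, by rw [integral_const_mul, h.2]⟩

theorem IntegralIs.sum {ι : Type*} (s : Finset ι) {c : ι → ℝ} {f : ι → ℝ → ℝ}
    (h : ∀ i, IntegralIs ν (c i) (f i)) : IntegralIs ν (∑ i ∈ s, c i) (fun t => ∑ i ∈ s, f i t) :=
  ⟨integrable_finsetSum _ fun i _ => (h i).1, by
    rw [integral_finsetSum _ fun i _ => (h i).1]
    exact Finset.sum_congr rfl fun i _ => (h i).2⟩

theorem integralIs_truncLap {u : ℝ → ℝ} (hu : LocallyIntegrable u volume) (N : ℕ) (x : ℝ) :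
    IntegralIs (truncKer (truncSet N)) (truncLap N u x) (fun h => u x - u (x + h)) := by
  have := (isTruncation_truncSet N).isFiniteMeasure
  exact ⟨(integrable_const _).sub ((isTruncation_truncSet N).integrable_comp_add hu x), rfl⟩

end IntegralIs

/-! ### The multi-commutator on test functions -/

section Identity

variable {m : ℕ} {P Q : ℝ → Matrix (Fin m) (Fin m) ℝ}

open scoped ContDiff in
theorem contDiff_coord (φ : VTest m) (i : Fin m) : ContDiff ℝ ∞ fun y => φ y i :=
  (EuclideanSpace.proj (𝕜 := ℝ) i).contDiff.comp φ.contDiff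

theorem hasCompactSupport_coord (φ : VTest m) (i : Fin m) : HasCompactSupport fun y => φ y i :=
  φ.hasCompactSupport.comp_left (g := fun z : EuclideanSpace ℝ (Fin m) => z i) rfl

theorem exists_boundedLip_coord (φ : VTest m) (i : Fin m) :
    ∃ R L M, BoundedLip R L M fun y => φ y i :=
  exists_boundedLip (contDiff_coord φ i) (hasCompactSupport_coord φ i)

theorem exists_boundedLip_coord_mul (φ v : VTest m) (i j : Fin m) :
    ∃ R L M, BoundedLip R L M fun y => φ y i * v y j :=
  exists_boundedLip ((contDiff_coord φ i).mul (contDiff_coord v j))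
    (hasCompactSupport_coord φ i).mul_right

theorem MemHHalf.finEnergy_entry (hQ : MemHHalf Q) (i j : Fin m) : FinEnergy fun x => Q x i j :=
  hQ.entry i j

theorem MemHHalf.finEnergy_mulVec (hQ : MemHHalf Q) (v : VTest m) (j : Fin m) :
    FinEnergy fun y => (Q y *ᵥ (v y).ofLp) j := by
  simp only [mulVec, dotProduct]
  refine FinEnergy.sum _ fun k => ?_
  obtain ⟨R, L, M, h⟩ := exists_boundedLip_coord v k
  simpa only [mul_comm] using (hQ.finEnergy_entry j k).mul h

theorem MemHHalf.finEnergy_transpose_mulVec (hQ : MemHHalf Q) (φ : VTest m) (j : Fin m) :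
    FinEnergy fun y => ((Q y)ᵀ *ᵥ (φ y).ofLp) j := by
  simp only [mulVec, dotProduct, transpose_apply]
  refine FinEnergy.sum _ fun k => ?_
  obtain ⟨R, L, M, h⟩ := exists_boundedLip_coord φ k
  simpa only [mul_comm] using (hQ.finEnergy_entry k j).mul h

theorem memLp_entry (hP : MemLp P ∞ volume) (i j : Fin m) :
    MemLp (fun x => P x i j) ∞ volume := by
  have hc : Continuous fun M : Matrix (Fin m) (Fin m) ℝ => M i j :=
    (continuous_apply j).comp (continuous_apply i)
  refine ⟨hc.comp_aestronglyMeasurable hP.1, lt_of_le_of_lt ?_ hP.2⟩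
  refine eLpNorm_mono_enorm_ae (ae_of_all _ fun x => ?_)
  rw [← ofReal_norm, ← ofReal_norm]
  exact ENNReal.ofReal_le_ofReal (abs_entry_le _ i j)

variable (v φ : VTest m)

theorem truncLim_mcTerm1 (hP : MemLp P ∞ volume) (hQ : MemHHalf Q) :
    TruncLim (mcTerm1 P Q v φ) fun N x => ∑ i, ∑ j, ∑ k,
      P x i j * (φ x i * Q x j k) * truncLap N (fun y => v y k) x := by
  have e : mcTerm1 P Q v φ = fun x => ∑ i, ∑ j, ∑ k,
      P x i j * (φ x i * Q x j k) * quarterLapTest (fun y => v y k) x := by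
    funext x
    simp only [mcTerm1, dotProduct, mulVec, mul_apply, Finset.mul_sum, Finset.sum_mul]
    refine Finset.sum_congr rfl fun i _ => Finset.sum_comm.trans ?_
    refine Finset.sum_congr rfl fun j _ => Finset.sum_congr rfl fun k _ => ?_
    ring
  rw [e]
  refine .sum _ fun i => .sum _ fun j => .sum _ fun k => ?_
  obtain ⟨R, L, M, h⟩ := exists_boundedLip_coord φ i
  obtain ⟨R', L', M', h'⟩ := exists_boundedLip_coord v k
  exact truncLim_quarterLapTest (memLp_entry hP i j) ((hQ.finEnergy_entry j k).mul h) h'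

theorem truncLim_mcTerm2 (hP : MemLp P ∞ volume) (hQ : MemHHalf Q) :
    TruncLim (mcTerm2 P Q v φ) fun N x => ∑ i, ∑ j,
      P x i j * φ x i * truncLap N (fun y => (Q y *ᵥ (v y).ofLp) j) x := by
  have e : mcTerm2 P Q v φ = fun x => ∑ i, ∑ j,
      P x i j * φ x i * quarterLap (fun y => (Q y *ᵥ (v y).ofLp) j) x := by
    funext x
    rw [mcTerm2, dotProduct]
    refine Finset.sum_congr rfl fun i _ => ?_
    rw [mulVec, dotProduct, Finset.mul_sum]
    refine Finset.sum_congr rfl fun j _ => ?_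
    ring
  rw [e]
  refine .sum _ fun i => .sum _ fun j => ?_
  obtain ⟨R, L, M, h⟩ := exists_boundedLip_coord φ i
  exact truncLim_quarterLap (memLp_entry hP i j) (hQ.finEnergy_mulVec v j) h

theorem truncLim_mcTerm3 (hP : MemLp P ∞ volume) (hQ : MemHHalf Q) :
    TruncLim (mcTerm3 P Q v φ) fun N x => ∑ j, ∑ k,
      P x j k * v x k * truncLap N (fun y => ((Q y)ᵀ *ᵥ (φ y).ofLp) j) x := by
  have e : mcTerm3 P Q v φ = fun x => ∑ j, ∑ k,
      P x j k * v x k * quarterLap (fun y => ((Q y)ᵀ *ᵥ (φ y).ofLp) j) x := by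
    funext x
    rw [mcTerm3, dotProduct]
    refine Finset.sum_congr rfl fun i _ => ?_
    rw [mulVec, dotProduct, Finset.mul_sum]
    refine Finset.sum_congr rfl fun j _ => ?_
    ring
  rw [e]
  refine .sum _ fun j => .sum _ fun k => ?_
  obtain ⟨R, L, M, h⟩ := exists_boundedLip_coord v k
  exact truncLim_quarterLap (memLp_entry hP j k) (hQ.finEnergy_transpose_mulVec φ j) h

theorem truncLim_mcTerm4 (hP : MemLp P ∞ volume) (hQ : MemHHalf Q) :
    TruncLim (mcTerm4 P Q v φ) fun N x => ∑ i, ∑ j, ∑ k,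
      P x j k * (v x k * Q x i j) * truncLap N (fun y => φ y i) x := by
  have e : mcTerm4 P Q v φ = fun x => ∑ i, ∑ j, ∑ k,
      P x j k * (v x k * Q x i j) * quarterLapTest (fun y => φ y i) x := by
    funext x
    simp only [mcTerm4, dotProduct, mulVec, mul_apply, Finset.mul_sum, Finset.sum_mul]
    refine Finset.sum_congr rfl fun i _ => Finset.sum_comm.trans ?_
    refine Finset.sum_congr rfl fun j _ => Finset.sum_congr rfl fun k _ => ?_
    ring
  rw [e]
  refine .sum _ fun i => .sum _ fun j => .sum _ fun k => ?_
  obtain ⟨R, L, M, h⟩ := exists_boundedLip_coord φ i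
  obtain ⟨R', L', M', h'⟩ := exists_boundedLip_coord v k
  exact truncLim_quarterLapTest (memLp_entry hP j k) ((hQ.finEnergy_entry i j).mul h') h

theorem truncLim_mcTerm5 (hP : MemLp P ∞ volume) (hQ : MemHHalf Q) :
    TruncLim (mcTerm5 P Q v φ) fun N x => ∑ i, ∑ j, ∑ k,
      P x j k * (φ x i * v x k) * truncLap N (fun y => Q y i j) x := by
  have e : mcTerm5 P Q v φ = fun x => ∑ i, ∑ j, ∑ k,
      P x j k * (φ x i * v x k) * quarterLap (fun y => Q y i j) x := by
    funext x
    simp only [mcTerm5, dotProduct, mulVec, mul_apply, of_apply, Finset.mul_sum, Finset.sum_mul]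
    refine Finset.sum_congr rfl fun i _ => Finset.sum_comm.trans ?_
    refine Finset.sum_congr rfl fun j _ => Finset.sum_congr rfl fun k _ => ?_
    ring
  rw [e]
  refine .sum _ fun i => .sum _ fun j => .sum _ fun k => ?_
  obtain ⟨R, L, M, h⟩ := exists_boundedLip_coord_mul φ v i k
  exact truncLim_quarterLap (memLp_entry hP j k) (hQ.finEnergy_entry i j) h

theorem truncLim_mcTerm6 (hP : MemLp P ∞ volume) (hQ : MemHHalf Q) :
    TruncLim (mcTerm6 P Q v φ) fun N x => ∑ i, ∑ j, ∑ k,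
      P x i j * Q x j k * truncLap N (fun y => φ y i * v y k) x := by
  have e : mcTerm6 P Q v φ = fun x => ∑ i, ∑ j, ∑ k,
      P x i j * Q x j k * quarterLapTest (fun y => φ y i * v y k) x := by
    funext x
    simp only [mcTerm6, mul_apply, Finset.sum_mul]
    exact Finset.sum_congr rfl fun i _ => Finset.sum_comm
  rw [e]
  refine .sum _ fun i => .sum _ fun j => .sum _ fun k => ?_
  obtain ⟨R, L, M, h⟩ := exists_boundedLip_coord_mul φ v i k
  exact truncLim_quarterLapTest (memLp_entry hP i j) (hQ.finEnergy_entry j k) h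

theorem truncLim_mcTerm7 (hP : MemLp P ∞ volume) (hQ : MemHHalf Q) :
    TruncLim (mcTerm7 P Q v φ) fun N x => ∑ i, ∑ j,
      P x i j * truncLap N (fun y => φ y i * (Q y *ᵥ (v y).ofLp) j) x := by
  refine .sum _ fun i => .sum _ fun j => ?_
  obtain ⟨R, L, M, h⟩ := exists_boundedLip_coord φ i
  exact truncLim_quarterLap_mul (memLp_entry hP i j) (hQ.finEnergy_mulVec v j) h

theorem multiCommWellDefined (hP : MemLp P ∞ volume) (hQ : MemHHalf Q) :
    MultiCommWellDefined P Q v φ := by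
  refine ⟨fun i j => exists_hasQuarterLap (hQ.entry i j).1 (hQ.entry i j).2,
    fun j => exists_hasQuarterLap (hQ.finEnergy_mulVec v j).1 (hQ.finEnergy_mulVec v j).2,
    fun j => exists_hasQuarterLap (hQ.finEnergy_transpose_mulVec φ j).1
      (hQ.finEnergy_transpose_mulVec φ j).2, fun i k => ?_,
    (truncLim_mcTerm1 v φ hP hQ).1, (truncLim_mcTerm2 v φ hP hQ).1,
    (truncLim_mcTerm3 v φ hP hQ).1, (truncLim_mcTerm4 v φ hP hQ).1,
    (truncLim_mcTerm5 v φ hP hQ).1, (truncLim_mcTerm6 v φ hP hQ).1,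
    (truncLim_mcTerm7 v φ hP hQ).1⟩
  obtain ⟨R, L, M, h⟩ := exists_boundedLip_coord φ i
  have := (hQ.finEnergy_mulVec v k).mul h
  exact exists_hasQuarterLap this.1 this.2

/-- The sum of the seven truncated terms. -/
def mcTrunc (P Q : ℝ → Matrix (Fin m) (Fin m) ℝ) (v φ : VTest m) (N : ℕ) (x : ℝ) : ℝ :=
  (∑ i, ∑ j, ∑ k, P x i j * (φ x i * Q x j k) * truncLap N (fun y => v y k) x)
    - (∑ i, ∑ j, P x i j * φ x i * truncLap N (fun y => (Q y *ᵥ (v y).ofLp) j) x)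
    + (∑ j, ∑ k, P x j k * v x k * truncLap N (fun y => ((Q y)ᵀ *ᵥ (φ y).ofLp) j) x)
    - (∑ i, ∑ j, ∑ k, P x j k * (v x k * Q x i j) * truncLap N (fun y => φ y i) x)
    - (∑ i, ∑ j, ∑ k, P x j k * (φ x i * v x k) * truncLap N (fun y => Q y i j) x)
    - (∑ i, ∑ j, ∑ k, P x i j * Q x j k * truncLap N (fun y => φ y i * v y k) x)
    + (∑ i, ∑ j, P x i j * truncLap N (fun y => φ y i * (Q y *ᵥ (v y).ofLp) j) x)

theorem tendsto_integral_mcTrunc (hP : MemLp P ∞ volume) (hQ : MemHHalf Q) :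
    Filter.Tendsto (fun N => ∫ x, mcTrunc P Q v φ N x) Filter.atTop
      (nhds (multiComm P Q v φ)) := by
  have h1 := truncLim_mcTerm1 v φ hP hQ
  have h2 := h1.sub (truncLim_mcTerm2 v φ hP hQ)
  have h3 := h2.add (truncLim_mcTerm3 v φ hP hQ)
  have h4 := h3.sub (truncLim_mcTerm4 v φ hP hQ)
  have h5 := h4.sub (truncLim_mcTerm5 v φ hP hQ)
  have h6 := h5.sub (truncLim_mcTerm6 v φ hP hQ)
  have h7 := h6.add (truncLim_mcTerm7 v φ hP hQ)
  have e : multiComm P Q v φ = ∫ x, (mcTerm1 P Q v φ x - mcTerm2 P Q v φ x + mcTerm3 P Q v φ x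
      - mcTerm4 P Q v φ x - mcTerm5 P Q v φ x - mcTerm6 P Q v φ x + mcTerm7 P Q v φ x) := by
    rw [integral_add h6.1 (truncLim_mcTerm7 v φ hP hQ).1,
      integral_sub h5.1 (truncLim_mcTerm6 v φ hP hQ).1,
      integral_sub h4.1 (truncLim_mcTerm5 v φ hP hQ).1,
      integral_sub h3.1 (truncLim_mcTerm4 v φ hP hQ).1,
      integral_add h2.1 (truncLim_mcTerm3 v φ hP hQ).1,
      integral_sub h1.1 (truncLim_mcTerm2 v φ hP hQ).1]
    rfl
  rw [e]
  exact h7.2.2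

/-- The algebraic cancellation. Put `y = x + h` and expand. In terms 1, 2, 6, 7 the products `φ P Q
v` taken entirely at `x` cancel, and the rest factors as `(φ x - φ y) · P x (Q y - Q x) v y`. Terms
3, 4, 5 factor likewise into `(φ x - φ y) · (Q y - Q x) P x v x`. -/
theorem mcKer_eq_sum (P Q : ℝ → Matrix (Fin m) (Fin m) ℝ) (v φ : ℝ → EuclideanSpace ℝ (Fin m))
    (x h : ℝ) : mcKer P Q v φ (x, h) =
    (∑ i, ∑ j, ∑ k, P x i j * (φ x i * Q x j k) * (v x k - v (x + h) k))
    - (∑ i, ∑ j, P x i j * φ x i * ((Q x *ᵥ (v x).ofLp) j - (Q (x + h) *ᵥ (v (x + h)).ofLp) j))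
    + (∑ j, ∑ k, P x j k * v x k *
        (((Q x)ᵀ *ᵥ (φ x).ofLp) j - ((Q (x + h))ᵀ *ᵥ (φ (x + h)).ofLp) j))
    - (∑ i, ∑ j, ∑ k, P x j k * (v x k * Q x i j) * (φ x i - φ (x + h) i))
    - (∑ i, ∑ j, ∑ k, P x j k * (φ x i * v x k) * (Q x i j - Q (x + h) i j))
    - (∑ i, ∑ j, ∑ k, P x i j * Q x j k * (φ x i * v x k - φ (x + h) i * v (x + h) k))
    + (∑ i, ∑ j, P x i j * (φ x i * (Q x *ᵥ (v x).ofLp) j -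
        φ (x + h) i * (Q (x + h) *ᵥ (v (x + h)).ofLp) j)) := by
  -- In the transposed third term the index of `φ` is summed innermost. Bringing it outside aligns
  -- it with the others, so the identity can be checked summand by summand.
  have e3 : (∑ j, ∑ k, P x j k * v x k *
        (((Q x)ᵀ *ᵥ (φ x).ofLp) j - ((Q (x + h))ᵀ *ᵥ (φ (x + h)).ofLp) j)) =
      ∑ i, ∑ j, ∑ k, P x j k * v x k * (Q x i j * φ x i - Q (x + h) i j * φ (x + h) i) := by
    refine Eq.trans (Finset.sum_congr rfl fun j _ => ?_) Finset.sum_comm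
    refine Eq.trans ?_ Finset.sum_comm
    refine Finset.sum_congr rfl fun k _ => ?_
    simp only [mulVec, dotProduct, transpose_apply, ← Finset.sum_sub_distrib, Finset.mul_sum]
  rw [e3]
  simp only [mcKer, mulVec, dotProduct, Pi.add_apply, Matrix.sub_apply, WithLp.ofLp_sub,
    Pi.sub_apply, Finset.mul_sum, ← Finset.sum_sub_distrib, ← Finset.sum_add_distrib]
  refine Finset.sum_congr rfl fun i _ => Finset.sum_congr rfl fun j _ =>
    Finset.sum_congr rfl fun k _ => ?_
  ring

/-- Against a truncated kernel every term is an honest integral in `h`, so the seven may be merged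
under one integral sign before the cancellation is used. -/
theorem mcTrunc_eq_integral (hQ : MemHHalf Q) (N : ℕ) (x : ℝ) :
    mcTrunc P Q v φ N x = ∫ h, mcKer P Q v φ (x, h) ∂(truncKer (truncSet N)) := by
  have hv : ∀ k, LocallyIntegrable (fun y => v y k) volume := fun k =>
    (contDiff_coord v k).continuous.locallyIntegrable
  have hφ : ∀ k, LocallyIntegrable (fun y => φ y k) volume := fun k =>
    (contDiff_coord φ k).continuous.locallyIntegrable
  have hφv : ∀ i k, LocallyIntegrable (fun y => φ y i * v y k) volume := fun i k =>
    ((contDiff_coord φ i).continuous.mul (contDiff_coord v k).continuous).locallyIntegrable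
  have hφQv : ∀ i j, LocallyIntegrable (fun y => φ y i * (Q y *ᵥ (v y).ofLp) j) volume := by
    intro i j
    obtain ⟨R, L, M, h⟩ := exists_boundedLip_coord φ i
    exact ((hQ.finEnergy_mulVec v j).mul h).1
  have h1 : IntegralIs (truncKer (truncSet N)) _ _ := .sum Finset.univ fun i => .sum Finset.univ
    fun j => .sum Finset.univ fun k =>
      (integralIs_truncLap (hv k) N x).const_mul (P x i j * (φ x i * Q x j k))
  have h2 : IntegralIs (truncKer (truncSet N)) _ _ := .sum Finset.univ fun i => .sum Finset.univ
    fun j => (integralIs_truncLap (hQ.finEnergy_mulVec v j).1 N x).const_mul (P x i j * φ x i)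
  have h3 : IntegralIs (truncKer (truncSet N)) _ _ := .sum Finset.univ fun j => .sum Finset.univ
    fun k => (integralIs_truncLap (hQ.finEnergy_transpose_mulVec φ j).1 N x).const_mul
      (P x j k * v x k)
  have h4 : IntegralIs (truncKer (truncSet N)) _ _ := .sum Finset.univ fun i => .sum Finset.univ
    fun j => .sum Finset.univ fun k =>
      (integralIs_truncLap (hφ i) N x).const_mul (P x j k * (v x k * Q x i j))
  have h5 : IntegralIs (truncKer (truncSet N)) _ _ := .sum Finset.univ fun i => .sum Finset.univ
    fun j => .sum Finset.univ fun k =>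
      (integralIs_truncLap (hQ.entry i j).1 N x).const_mul (P x j k * (φ x i * v x k))
  have h6 : IntegralIs (truncKer (truncSet N)) _ _ := .sum Finset.univ fun i => .sum Finset.univ
    fun j => .sum Finset.univ fun k =>
      (integralIs_truncLap (hφv i k) N x).const_mul (P x i j * Q x j k)
  have h7 : IntegralIs (truncKer (truncSet N)) _ _ := .sum Finset.univ fun i => .sum Finset.univ
    fun j => (integralIs_truncLap (hφQv i j) N x).const_mul (P x i j)
  have key := (((((h1.sub h2).add h3).sub h4).sub h5).sub h6).add h7
  simp only [mcKer_eq_sum]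
  exact key.2.symm

/-- Two limits of the same truncated sums: termwise they tend to the seven separately defined
pairings, and by Fubini and integrability of the combined kernel they tend to the full double
integral. -/
theorem multiComm_eq_mcForm (hP : MemLp P ∞ volume) (hQ : MemHHalf Q) :
    multiComm P Q v φ = mcForm P Q v φ := by
  obtain ⟨R, L, M, h⟩ := exists_boundedLip φ.contDiff φ.hasCompactSupport
  have hi : Integrable (mcKer P Q v φ) ((volume : Measure ℝ).prod quarterKer) :=
    integrable_mcKer (fun i j => (memLp_entry hP i j).1) hP.2 hQ
      (v.continuous.memLp_of_hasCompactSupport v.hasCompactSupport)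
      φ.continuous.locallyIntegrable ((hHalfNorm_lt_top_iff _).2 h.energy_lt_top)
  refine tendsto_nhds_unique (tendsto_integral_mcTrunc v φ hP hQ) ?_
  have e : ∀ N, ∫ x, mcTrunc P Q v φ N x =
      ∫ h, (∫ x, mcKer P Q v φ (x, h)) ∂(truncKer (truncSet N)) := by
    intro N
    simp only [mcTrunc_eq_integral v φ hQ]
    refine integral_integral_swap (hi.mono_measure ?_)
    exact Measure.prod_mono le_rfl Measure.restrict_le_self
  simp only [e]
  rw [mcForm, integral_prod_symm _ hi]
  exact tendsto_integral_truncKer hi.integral_prod_right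

end Identity

/-! ### Linear functionals bounded by the `Ḣ^{1/2}` norm -/

section Functional

variable {m : ℕ}

theorem hHalfNorm_test_lt_top (φ : VTest m) : hHalfNorm φ < ∞ := by
  obtain ⟨R, L, M, h⟩ := exists_boundedLip φ.contDiff φ.hasCompactSupport
  exact (hHalfNorm_lt_top_iff _).2 h.energy_lt_top

/-- On a fixed compact set the radius is uniform, and the sup and Lipschitz constants are the
seminorms of order `0` and `1`, the latter by the mean value inequality. -/
theorem exists_boundedLip_supportedIn (K : TopologicalSpace.Compacts ℝ) : ∃ R : ℝ,
    ∀ f : 𝓓_{K}(ℝ, EuclideanSpace ℝ (Fin m)),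
      BoundedLip R (ContDiffMapSupportedIn.seminorm ℝ ℝ (EuclideanSpace ℝ (Fin m)) ⊤ K 1 f)
        (ContDiffMapSupportedIn.seminorm ℝ ℝ (EuclideanSpace ℝ (Fin m)) ⊤ K 0 f) f := by
  obtain ⟨R, hR⟩ := K.isCompact.isBounded.exists_norm_le
  refine ⟨max R 1, fun f => ⟨le_max_right _ _, apply_nonneg _ _, apply_nonneg _ _, fun x hx => ?_,
    fun x => ContDiffMapSupportedIn.norm_apply_le_seminorm ℝ, fun x y => ?_⟩⟩
  · refine f.zero_on_compl fun hxK => ?_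
    have := hR x hxK
    rw [Real.norm_eq_abs] at this
    exact absurd (this.trans (le_max_left R 1)) (not_le.2 hx)
  · have hd : Differentiable ℝ f := f.contDiff.differentiable (by simp)
    refine convex_univ.norm_image_sub_le_of_norm_fderiv_le (𝕜 := ℝ) (fun z _ => hd z)
      (fun z _ => ?_) (Set.mem_univ y) (Set.mem_univ x)
    rw [← norm_iteratedFDeriv_one]
    exact ContDiffMapSupportedIn.norm_iteratedFDeriv_apply_le_seminorm_top ℝ

/-- Continuity on test functions is tested on each fixed compact support, where the `Ḣ^{1/2}` norm
is bounded by the seminorms of order `0` and `1`. The `3` comes from `L + 2 M` with both constants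
below their maximum. -/
theorem continuous_of_enorm_le_hHalfNorm (T : VTest m →ₗ[ℝ] ℝ) {C : ℝ≥0∞} (hC : C ≠ ∞)
    (hT : ∀ φ, ‖T φ‖ₑ ≤ C * hHalfNorm φ) : Continuous T := by
  rw [TestFunction.continuous_iff_continuous_comp]
  intro K hK
  obtain ⟨R, hR⟩ := exists_boundedLip_supportedIn (m := m) K
  have hD := decayMass_lt_top.ne
  let A : 𝓓_{K}(ℝ, EuclideanSpace ℝ (Fin m)) →ₗ[ℝ] ℝ :=
    T ∘ₗ (TestFunction.ofSupportedInCLM ℝ hK).toLinearMap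
  refine (ContDiffMapSupportedIn.mkCLMtoNormedSpace ℝ A A.map_add A.map_smul ⟨{0, 1},
      C.toReal * ((1 + R) ^ 2 * 3) * decayMass.toReal, by positivity, fun f => ?_⟩).continuous
  set N0 := ContDiffMapSupportedIn.seminorm ℝ ℝ (EuclideanSpace ℝ (Fin m)) ⊤ K 0 f
  set N1 := ContDiffMapSupportedIn.seminorm ℝ ℝ (EuclideanSpace ℝ (Fin m)) ⊤ K 1 f
  set S := (Finset.sup {0, 1} fun i =>
    ContDiffMapSupportedIn.seminorm ℝ ℝ (EuclideanSpace ℝ (Fin m)) ⊤ K i) f with hS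
  have h0 : N0 ≤ S := Seminorm.le_finset_sup_apply (by simp)
  have h1 : N1 ≤ S := Seminorm.le_finset_sup_apply (by simp)
  have h := (hT (TestFunction.ofSupportedIn hK f)).trans
    (mul_le_mul_right (hR f).hHalfNorm_le C)
  have h' := ENNReal.toReal_mono (by finiteness) h
  rw [toReal_enorm, ENNReal.toReal_mul, ENNReal.toReal_mul, ENNReal.toReal_ofReal] at h'
  · refine h'.trans ?_
    calc _ ≤ C.toReal * ((1 + R) ^ 2 * (S + 2 * S) * decayMass.toReal) := by gcongr
      _ = _ := by ring
  · have : 0 ≤ N0 := apply_nonneg _ _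
    have : 0 ≤ N1 := apply_nonneg _ _
    positivity

theorem hNegHalfNorm_eq (F : VDist m) : hNegHalfNorm F = ⨆ φ : VTest m, ‖F φ‖ₑ / hHalfNorm φ := by
  have e1 : Real.conjExponent 2 = 2 := by norm_num [Real.conjExponent]
  have e2 : -(-1 / 2 : ℝ) = 1 / 2 := by norm_num
  simp only [hNegHalfNorm, negBesovNorm, hHalfNorm, e1, e2]

/-- The conjugate exponent of `2p/(p+2)` is `q = 2p/(p-2)`, and `1/2 - 1/p = 1/q`: the dual space
has the form occurring in the trilinear estimate. -/
theorem negBesovNorm_eq {p : ℝ} (hp : 2 < p) (F : VDist m) :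
    negBesovNorm (-1 / 2 + 1 / p) (2 * p / (p + 2)) 2 F =
      ⨆ φ : VTest m, ‖F φ‖ₑ / besovNorm (1 / (2 * p / (p - 2))) (2 * p / (p - 2)) 2 φ := by
  have h0 : p ≠ 0 := by linarith
  have h1 : p - 2 ≠ 0 := by linarith
  have h2 : p + 2 ≠ 0 := by linarith
  have e1 : Real.conjExponent 2 = 2 := by norm_num [Real.conjExponent]
  have e2 : Real.conjExponent (2 * p / (p + 2)) = 2 * p / (p - 2) := by
    have : 2 * p / (p + 2) - 1 = (p - 2) / (p + 2) := by field_simp; ring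
    rw [Real.conjExponent, this]
    field_simp
  have e3 : -(-1 / 2 + 1 / p) = 1 / (2 * p / (p - 2)) := by field_simp; ring
  rw [negBesovNorm, e1, e2, e3]

theorem two_lt_conj {p : ℝ} (hp : 2 < p) : 2 < 2 * p / (p - 2) := by
  rw [lt_div_iff₀ (by linarith)]
  linarith

theorem inv_add_inv_conj {p : ℝ} (hp : 2 < p) : 1 / p + 1 / (2 * p / (p - 2)) = 1 / 2 := by
  have h0 : p ≠ 0 := by linarith
  have h1 : p - 2 ≠ 0 := by linarith
  field_simp
  ring

/-- The embedding of the negative order Besov spaces into `H^{-1/2}`. -/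
theorem hNegHalfNorm_le_negBesovNorm {p : ℝ} (hp : 2 < p) (F : VDist m) :
    hNegHalfNorm F ≤ embConst (2 * p / (p - 2)) *
      negBesovNorm (-1 / 2 + 1 / p) (2 * p / (p + 2)) 2 F := by
  have hq := two_lt_conj hp
  rw [hNegHalfNorm_eq, negBesovNorm_eq hp]
  set q := 2 * p / (p - 2)
  refine iSup_le fun φ => ?_
  have hb := besovNorm_le_hHalfNorm hq (f := φ) φ.continuous.locallyIntegrable
  have hc0 : (embConst q : ℝ≥0∞) ≠ 0 := by
    have := one_le_embConst (p := q) (by linarith)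
    exact_mod_cast (zero_lt_one.trans_le this).ne'
  refine le_trans ?_ (mul_le_mul_right (le_iSup (fun φ : VTest m =>
    ‖F φ‖ₑ / besovNorm (1 / q) q 2 φ) φ) _)
  -- The embedding for `φ`, inverted; its constant is at least `1`, so it can be cancelled in
  -- `ℝ≥0∞`.
  have h1 : (hHalfNorm φ)⁻¹ ≤ embConst q * (besovNorm (1 / q) q 2 φ)⁻¹ := by
    rw [← ENNReal.inv_le_inv, ENNReal.mul_inv (.inl hc0) (.inl ENNReal.coe_ne_top)] at hb
    calc (hHalfNorm φ)⁻¹ = embConst q * ((embConst q : ℝ≥0∞)⁻¹ * (hHalfNorm φ)⁻¹) := by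
          rw [← mul_assoc, ENNReal.mul_inv_cancel hc0 ENNReal.coe_ne_top, one_mul]
      _ ≤ _ := by gcongr
  rw [div_eq_mul_inv, div_eq_mul_inv, mul_left_comm]
  gcongr

/-- If `hHalfNorm φ` is `0`, the quotient in the supremum is `∞` unless `F φ = 0`, so a finite dual
norm covers this case as well. -/
theorem enorm_apply_le_hNegHalfNorm_mul {F : VDist m} (hF : hNegHalfNorm F ≠ ∞) (φ : VTest m) :
    ‖F φ‖ₑ ≤ hNegHalfNorm F * hHalfNorm φ := by
  rw [← ENNReal.div_le_iff_le_mul (.inr hF) (.inl (hHalfNorm_test_lt_top φ).ne), hNegHalfNorm_eq]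
  exact le_iSup (fun φ : VTest m => ‖F φ‖ₑ / hHalfNorm φ) φ

end Functional

/-! ### The operator on `L²` -/

section Operator

variable {m : ℕ} {P Q : ℝ → Matrix (Fin m) (Fin m) ℝ} {v v' φ φ' : ℝ → EuclideanSpace ℝ (Fin m)}

theorem mcForm_congr_ae (h : v =ᵐ[volume] v') : mcForm P Q v φ = mcForm P Q v' φ := by
  have h1 : ∀ᵐ q ∂((volume : Measure ℝ).prod quarterKer), v q.1 = v' q.1 :=
    Measure.quasiMeasurePreserving_fst.ae h
  have h2 : ∀ᵐ q ∂((volume : Measure ℝ).prod quarterKer), v (q.1 + q.2) = v' (q.1 + q.2) :=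
    (Measure.AbsolutelyContinuous.rfl.prod quarterKer_absolutelyContinuous).ae_le
      ((quasiMeasurePreserving_add volume volume).ae h)
  refine integral_congr_ae ?_
  filter_upwards [h1, h2] with q h1 h2
  simp only [mcKer, h1, h2]

theorem mcForm_add_left
    (hv : Integrable (mcKer P Q v φ) ((volume : Measure ℝ).prod quarterKer))
    (hv' : Integrable (mcKer P Q v' φ) ((volume : Measure ℝ).prod quarterKer)) :
    mcForm P Q (v + v') φ = mcForm P Q v φ + mcForm P Q v' φ := by
  rw [mcForm, mcForm, mcForm, ← integral_add hv hv']
  refine integral_congr_ae (ae_of_all _ fun q => ?_)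
  simp only [mcKer, Pi.add_apply, WithLp.ofLp_add, mulVec_add, dotProduct_add]
  ring

theorem mcForm_smul_left (c : ℝ) : mcForm P Q (c • v) φ = c * mcForm P Q v φ := by
  rw [mcForm, mcForm, ← integral_const_mul]
  refine integral_congr_ae (ae_of_all _ fun q => ?_)
  simp only [mcKer, Pi.smul_apply, WithLp.ofLp_smul, mulVec_smul, dotProduct_add, dotProduct_smul,
    smul_eq_mul]
  ring

theorem mcForm_add_right
    (hφ : Integrable (mcKer P Q v φ) ((volume : Measure ℝ).prod quarterKer))
    (hφ' : Integrable (mcKer P Q v φ') ((volume : Measure ℝ).prod quarterKer)) :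
    mcForm P Q v (φ + φ') = mcForm P Q v φ + mcForm P Q v φ' := by
  rw [mcForm, mcForm, mcForm, ← integral_add hφ hφ']
  refine integral_congr_ae (ae_of_all _ fun q => ?_)
  simp only [mcKer, Pi.add_apply, add_sub_add_comm, WithLp.ofLp_add, add_dotProduct]

theorem mcForm_smul_right (c : ℝ) : mcForm P Q v (c • φ) = c * mcForm P Q v φ := by
  rw [mcForm, mcForm, ← integral_const_mul]
  refine integral_congr_ae (ae_of_all _ fun q => ?_)
  simp only [mcKer, Pi.smul_apply, ← smul_sub, WithLp.ofLp_smul, smul_dotProduct, smul_eq_mul]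

theorem enorm_mcForm_le {p q : ℝ} (hp : 2 < p) (hq : 2 < q) (hpq : 1 / p + 1 / q = 1 / 2)
    (hP : MemLp P ∞ volume) (hQ : MemHHalf Q)
    (v : Lp (EuclideanSpace ℝ (Fin m)) 2 (volume : Measure ℝ)) (φ : VTest m) :
    ‖mcForm P Q v φ‖ₑ ≤ 2 * embConst p * eLpNorm P ∞ volume * hHalfNorm Q * ‖v‖ₑ *
      besovNorm (1 / q) q 2 φ := by
  rw [Lp.enorm_def]
  exact (enorm_integral_le_lintegral_enorm _).trans
    (lintegral_mcKer_le hp hq hpq (fun i j => (memLp_entry hP i j).1) hQ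
      (Lp.aestronglyMeasurable v) φ.continuous.aestronglyMeasurable)

/-- The case `p = q = 4`; the second `embConst 4` comes from embedding `φ` as well as `Q`. -/
theorem enorm_mcForm_le_hHalfNorm (hP : MemLp P ∞ volume) (hQ : MemHHalf Q)
    (v : Lp (EuclideanSpace ℝ (Fin m)) 2 (volume : Measure ℝ)) (φ : VTest m) :
    ‖mcForm P Q v φ‖ₑ ≤ 2 * embConst 4 * embConst 4 * eLpNorm P ∞ volume * hHalfNorm Q * ‖v‖ₑ *
      hHalfNorm φ := by
  refine (enorm_mcForm_le (p := 4) (q := 4) (by norm_num) (by norm_num) (by norm_num)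
    hP hQ v φ).trans ?_
  calc _ ≤ 2 * embConst 4 * eLpNorm P ∞ volume * hHalfNorm Q * ‖v‖ₑ *
        (embConst 4 * hHalfNorm φ) := by
        gcongr
        exact besovNorm_le_hHalfNorm (by norm_num) φ.continuous.locallyIntegrable
    _ = _ := by ring

theorem integrable_mcKer_test (hP : MemLp P ∞ volume) (hQ : MemHHalf Q)
    (v : Lp (EuclideanSpace ℝ (Fin m)) 2 (volume : Measure ℝ)) (φ : VTest m) :
    Integrable (mcKer P Q v φ) ((volume : Measure ℝ).prod quarterKer) :=
  integrable_mcKer (fun i j => (memLp_entry hP i j).1) hP.2 hQ (Lp.memLp v)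
    φ.continuous.locallyIntegrable (hHalfNorm_test_lt_top φ)

/-- The multi-commutator as an operator from `L²` to distributions. -/
def mcOperator (hP : MemLp P ∞ volume) (hQ : MemHHalf Q) :
    Lp (EuclideanSpace ℝ (Fin m)) 2 (volume : Measure ℝ) →ₗ[ℝ] VDist m where
  toFun v :=
    { toFun := fun φ => mcForm P Q v φ
      map_add' := fun φ φ' => mcForm_add_right (integrable_mcKer_test hP hQ v φ)
        (integrable_mcKer_test hP hQ v φ')
      map_smul' := fun c φ => mcForm_smul_right c
      cont := continuous_of_enorm_le_hHalfNorm
        { toFun := fun φ => mcForm P Q v φ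
          map_add' := fun φ φ' => mcForm_add_right (integrable_mcKer_test hP hQ v φ)
            (integrable_mcKer_test hP hQ v φ')
          map_smul' := fun c φ => mcForm_smul_right c }
        (C := 2 * embConst 4 * embConst 4 * eLpNorm P ∞ volume * hHalfNorm Q * ‖v‖ₑ)
        (by
          have h1 := hP.2.ne
          have h2 := hQ.2.ne
          finiteness)
        fun φ => enorm_mcForm_le_hHalfNorm hP hQ v φ }
  map_add' v v' := by
    ext φ
    exact (mcForm_congr_ae (Lp.coeFn_add v v')).trans (mcForm_add_left
      (integrable_mcKer_test hP hQ v φ) (integrable_mcKer_test hP hQ v' φ))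
  map_smul' c v := by
    ext φ
    exact (mcForm_congr_ae (Lp.coeFn_smul c v)).trans (mcForm_smul_left c)

theorem mcOperator_testToL2 (hP : MemLp P ∞ volume) (hQ : MemHHalf Q) (v φ : VTest m) :
    mcOperator hP hQ (testToL2 v) φ = multiComm P Q v φ := by
  rw [multiComm_eq_mcForm v φ hP hQ]
  exact mcForm_congr_ae (MemLp.coeFn_toLp _)

theorem negBesovNorm_mcOperator_le (hP : MemLp P ∞ volume) (hQ : MemHHalf Q) {p : ℝ} (hp : 2 < p)
    (v : Lp (EuclideanSpace ℝ (Fin m)) 2 (volume : Measure ℝ)) :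
    negBesovNorm (-1 / 2 + 1 / p) (2 * p / (p + 2)) 2 (mcOperator hP hQ v) ≤
      2 * embConst p * eLpNorm P ∞ volume * hHalfNorm Q * ‖v‖ₑ := by
  rw [negBesovNorm_eq hp]
  exact iSup_le fun φ => ENNReal.div_le_of_le_mul
    (enorm_mcForm_le hp (two_lt_conj hp) (inv_add_inv_conj hp) hP hQ v φ)

theorem hNegHalfNorm_mcOperator_le (hP : MemLp P ∞ volume) (hQ : MemHHalf Q)
    (v : Lp (EuclideanSpace ℝ (Fin m)) 2 (volume : Measure ℝ)) :
    hNegHalfNorm (mcOperator hP hQ v) ≤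
      2 * embConst 4 * embConst 4 * eLpNorm P ∞ volume * hHalfNorm Q * ‖v‖ₑ := by
  rw [hNegHalfNorm_eq]
  exact iSup_le fun φ => ENNReal.div_le_of_le_mul (enorm_mcForm_le_hHalfNorm hP hQ v φ)

theorem dense_range_testToL2 : DenseRange (testToL2 (m := m)) := by
  refine (Lp.dense_hasCompactSupport_contDiff (F := EuclideanSpace ℝ (Fin m))
    (μ := (volume : Measure ℝ)) (p := 2) ENNReal.ofNat_ne_top).mono ?_
  rintro f ⟨g, hfg, hg, hs⟩
  exact ⟨⟨g, hs, hg, fun _ _ => trivial⟩, Lp.ext ((MemLp.coeFn_toLp _).trans hfg.symm)⟩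

/-- Operators from `L²` to `H^{-1/2}` are determined by their values on test functions. -/
theorem eq_of_testToL2_eq
    {V V' : Lp (EuclideanSpace ℝ (Fin m)) 2 (volume : Measure ℝ) →ₗ[ℝ] VDist m}
    {C C' : ℝ≥0∞} (hC : C ≠ ∞) (hC' : C' ≠ ∞) (hV : ∀ v, hNegHalfNorm (V v) ≤ C * ‖v‖ₑ)
    (hV' : ∀ v, hNegHalfNorm (V' v) ≤ C' * ‖v‖ₑ)
    (h : ∀ v φ : VTest m, V (testToL2 v) φ = V' (testToL2 v) φ) : V = V' := by
  -- For a fixed `φ` the bound makes `v ↦ W v φ` continuous on `L²`, so values on the dense set of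
  -- test functions determine it.
  have hcont : ∀ {W : Lp (EuclideanSpace ℝ (Fin m)) 2 (volume : Measure ℝ) →ₗ[ℝ] VDist m}
      {C : ℝ≥0∞}, C ≠ ∞ → (∀ v, hNegHalfNorm (W v) ≤ C * ‖v‖ₑ) → ∀ φ : VTest m,
      Continuous fun v => W v φ := by
    intro W C hC hW φ
    have hφ := (hHalfNorm_test_lt_top φ).ne
    let T : Lp (EuclideanSpace ℝ (Fin m)) 2 (volume : Measure ℝ) →ₗ[ℝ] ℝ :=
      { toFun := fun v => W v φ
        map_add' := fun v w => by rw [map_add]; rfl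
        map_smul' := fun c v => by rw [map_smul]; rfl }
    refine AddMonoidHomClass.continuous_of_bound T (C.toReal * (hHalfNorm φ).toReal) fun v => ?_
    have h1 : hNegHalfNorm (W v) ≠ ∞ := ((hW v).trans_lt (by finiteness)).ne
    have h2 := (enorm_apply_le_hNegHalfNorm_mul h1 φ).trans (mul_le_mul_left (hW v) (hHalfNorm φ))
    have h3 := ENNReal.toReal_mono (by finiteness) h2
    rw [toReal_enorm, ENNReal.toReal_mul, ENNReal.toReal_mul, toReal_enorm] at h3
    exact h3.trans (le_of_eq (by ring))
  ext v φ
  have := dense_range_testToL2.equalizer (hcont hC hV φ) (hcont hC' hV' φ)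
    (funext fun w => h w φ)
  exact congrFun this v

end Operator

end

/-! ### Conclusion: the embedding, and existence, bounds and uniqueness of the operator. -/

theorem mainTheorem10 (m : ℕ) :
    -- the embedding of `B^{-1/2+1/p}_{2p/(p+2),2}` into `H^{-1/2}`
    (∀ p : ℝ, 2 < p → ∃ C : ℝ≥0, ∀ F : VDist m,
      hNegHalfNorm F ≤ C * negBesovNorm (-1 / 2 + 1 / p) (2 * p / (p + 2)) 2 F) ∧
    -- the mapping properties of the operator
    ∃ (C : ℝ → ℝ≥0) (C₀ : ℝ≥0), ∀ P Q : ℝ → Matrix (Fin m) (Fin m) ℝ,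
      MemLp P ∞ volume → (∀ᵐ x, (P x).IsSymm) →
      MemHHalf Q → (∀ᵐ x, (Q x).IsSymm) →
      (∀ v φ : VTest m, MultiCommWellDefined P Q v φ) ∧
      ∃! V : Lp (EuclideanSpace ℝ (Fin m)) 2 (volume : Measure ℝ) →ₗ[ℝ] VDist m,
        (∀ v φ : VTest m, V (testToL2 v) φ = multiComm P Q v φ) ∧
        (∀ p : ℝ, 2 < p → ∀ v : Lp (EuclideanSpace ℝ (Fin m)) 2 (volume : Measure ℝ),
          negBesovNorm (-1 / 2 + 1 / p) (2 * p / (p + 2)) 2 (V v) ≤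
            C p * eLpNorm P ∞ volume * hHalfNorm Q * ‖v‖ₑ) ∧
        (∀ v : Lp (EuclideanSpace ℝ (Fin m)) 2 (volume : Measure ℝ),
          hNegHalfNorm (V v) ≤ C₀ * eLpNorm P ∞ volume * hHalfNorm Q * ‖v‖ₑ) := by
  -- The constants: a factor `2` for the two translates of `v`, one embedding constant for `Q`, and
  -- in `C₀` a second one for `φ`.
  refine ⟨fun p hp => ⟨_, hNegHalfNorm_le_negBesovNorm hp⟩, fun p => 2 * embConst p,
    2 * embConst 4 * embConst 4, fun P Q hP _ hQ _ =>
      ⟨fun v φ => multiCommWellDefined v φ hP hQ, mcOperator hP hQ,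
        ⟨mcOperator_testToL2 hP hQ, fun p hp v => ?_, fun v => ?_⟩, fun V hV => ?_⟩⟩
  · simpa using negBesovNorm_mcOperator_le hP hQ hp v
  · simpa using hNegHalfNorm_mcOperator_le hP hQ v
  · have h1 := hP.2.ne
    have h2 := hQ.2.ne
    -- Uniqueness needs only the `H^{-1/2}` bound of the competitor and its values on test
    -- functions.
    refine eq_of_testToL2_eq ?_ ?_ hV.2.2 (hNegHalfNorm_mcOperator_le hP hQ) fun v φ => ?_
    · finiteness
    · finiteness
    · rw [hV.1, mcOperator_testToL2]
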